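/- Let $k$ be a field of characteristic zero and $A$ a smooth $k$-algebra of finite type. Let $\Omega^\bullet_A=\bigwedge_A^\bullet\Omega^1_{A/k}$ be the algebra of Kähler differential forms with its exterior derivative $d$, and let $H^*_{\mathrm{DR}}(A)=\ker d/\operatorname{im} d$ be the algebraic de Rham cohomology ring. Let $\mathrm K_0(A)$ be the Grothendieck ring of finitely generated projective (that is, locally free of finite rank) $A$-modules: the free abelian group on isomorphism classes, with product induced by $\otimes_A$, modulo the relations $[E\oplus F]=[E]+[F]$. Let $\mathfrak g=\operatorname{Der}_k(A)$, and let $H^p(\mathfrak g,A)$ be its Lie–Rinehart cohomology, that is, the cohomology of the complex $\operatorname{Hom}_A(\bigwedge^p_A\mathfrak g,A)$ with the Chevalley–Eilenberg differential. The natural maps $\Omega^p_A\to\operatorname{Hom}_A(\bigwedge^p_A\mathfrak g,A)$, $\omega_1\wedge\cdots\wedge\omega_p\mapsto\big(\delta_1\wedge\cdots\wedge\delta_p\mapsto\det(\omega_j(\delta_i))\big)$, send closed forms to cocycles and induce $k$-linear isomorphisms $i_p:H^p_{\mathrm{DR}}(A)\cong H^p(\mathfrak g,A)$ for all $p\ge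 0$, and there exists a ring homomorphism $$ch^A:\mathrm K_0(A)\longrightarrow H^*_{\mathrm{DR}}(A)$$ with the following two properties. 1. (It is the classical Chern character.) For every finitely generated projective $A$-module $E$ and every connection $\nabla:E\to\Omega^1_A\otimes_A E$ with curvature $R_\nabla=\nabla^2$, the forms $\operatorname{tr}(R_\nabla^n)\in\Omega^{2n}_A$ are closed, vanish for large $n$, and $$ch^A([E])=\sum_{n\ge 0}\frac1{n!}\,\overline{\operatorname{tr}(R_\nabla^n)}.$$ 2. (It is the Chern character of the Lie–Rinehart algebra $\mathfrak g=\operatorname{Der}_k(A)$.) For every finitely generated projective $A$-module $E$ and every $\mathfrak g$-connection $\nabla:\mathfrak g\to\operatorname{End}_k(E)$ with curvature $R_\nabla(\delta\wedge\eta)=[\nabla_\delta,\nabla_\eta]-\nabla_{[\delta,\eta]}$, the cochains $\operatorname{tr}(R_\nabla^n)\in\operatorname{Hom}_A(\bigwedge^{2n}_A\mathfrak g,A)$ are cocycles, vanish for large $n$, and $$ch^A([E])=\sum_{n\ge 0}\frac1{n!}\,i_{2n}^{-1}\big(\overline{\operatorname{tr}(R_\nabla^n)}\big).$$ Each of the two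 properties by itself determines $ch^A$ uniquely among ring homomorphisms $\mathrm K_0(A)\to H^*_{\mathrm{DR}}(A)$. -/

import Mathlib

open scoped TensorProduct

namespace ChernCharacter

section DeRham

variable (k A : Type*) [CommRing k] [CommRing A] [Algebra k A]

/-- The algebra of Kähler differential forms. -/
abbrev Form : Type _ := ExteriorAlgebra A (Ω[A⁄k])

variable {k A}

/-- The one-form `da`, as an element of the algebra of differential forms. -/
noncomputable def dOne (a : A) : Form k A := ExteriorAlgebra.ι A (KaehlerDifferential.D k A a)

/-- The grading involution: multiplication by `(-1) ^ p` on forms of degree `p`. -/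
noncomputable def sgn : Form k A →ₐ[A] Form k A := CliffordAlgebra.involute

theorem sgn_ι (w : Ω[A⁄k]) : sgn (ExteriorAlgebra.ι A w) = -ExteriorAlgebra.ι A w :=
  CliffordAlgebra.involute_ι w

theorem sgn_sgn (z : Form k A) : sgn (sgn z) = z := CliffordAlgebra.involute_involute z

theorem ι_mul_comm (w : Ω[A⁄k]) (z : Form k A) :
    ExteriorAlgebra.ι A w * z = sgn z * ExteriorAlgebra.ι A w := by
  induction z using ExteriorAlgebra.induction with
  | algebraMap r => rw [AlgHom.commutes, Algebra.commutes]
  | ι x =>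
    rw [sgn_ι, neg_mul]
    exact eq_neg_of_add_eq_zero_left (ExteriorAlgebra.ι_add_mul_swap w x)
  | mul a b ha hb => rw [map_mul, ← mul_assoc, ha, mul_assoc, hb, mul_assoc]
  | add a b ha hb => rw [map_add, mul_add, ha, hb, add_mul]

variable (k A) in
/-- Auxiliary ring for the construction of the exterior derivative: pairs `(z, y)` with
`(z, y) * (z', y') = (z z', (-1)^|z| z y' + y z')`. A map `z ↦ (z, d z)` is multiplicative
exactly when `d` is an antiderivation. -/
@[ext]
structure Jet where
  /-- The form `z`. -/
  fst : Form k A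
  /-- The form `y`. -/
  snd : Form k A

namespace Jet

noncomputable instance : Add (Jet k A) := ⟨fun x y => ⟨x.1 + y.1, x.2 + y.2⟩⟩
noncomputable instance : Zero (Jet k A) := ⟨⟨0, 0⟩⟩
noncomputable instance : Neg (Jet k A) := ⟨fun x => ⟨-x.1, -x.2⟩⟩
noncomputable instance : Mul (Jet k A) := ⟨fun x y => ⟨x.1 * y.1, sgn x.1 * y.2 + x.2 * y.1⟩⟩
noncomputable instance : One (Jet k A) := ⟨⟨1, 0⟩⟩

theorem mul_fst (x y : Jet k A) : (x * y).1 = x.1 * y.1 := rfl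
theorem mul_snd (x y : Jet k A) : (x * y).2 = sgn x.1 * y.2 + x.2 * y.1 := rfl
theorem one_fst : (1 : Jet k A).1 = 1 := rfl
theorem one_snd : (1 : Jet k A).2 = 0 := rfl
theorem add_fst (x y : Jet k A) : (x + y).1 = x.1 + y.1 := rfl
theorem add_snd (x y : Jet k A) : (x + y).2 = x.2 + y.2 := rfl
theorem neg_fst (x : Jet k A) : (-x).1 = -x.1 := rfl
theorem neg_snd (x : Jet k A) : (-x).2 = -x.2 := rfl
theorem zero_fst : (0 : Jet k A).1 = 0 := rfl
theorem zero_snd : (0 : Jet k A).2 = 0 := rfl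

noncomputable instance : Ring (Jet k A) where
  add_assoc x y z := by ext <;> simp [add_fst, add_snd, add_assoc]
  add_comm x y := by ext <;> simp [add_fst, add_snd, add_comm]
  zero_add x := by ext <;> simp [add_fst, add_snd, zero_fst, zero_snd]
  add_zero x := by ext <;> simp [add_fst, add_snd, zero_fst, zero_snd]
  neg_add_cancel x := by
    ext <;> simp [add_fst, add_snd, zero_fst, zero_snd, neg_fst, neg_snd]
  mul_assoc x y z := by
    ext <;> simp only [mul_fst, mul_snd, map_mul] <;> noncomm_ring
  one_mul x := by ext <;> simp [mul_fst, mul_snd, one_fst, one_snd]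
  mul_one x := by ext <;> simp [mul_fst, mul_snd, one_fst, one_snd]
  left_distrib x y z := by
    ext <;> simp only [mul_fst, mul_snd, add_fst, add_snd] <;> noncomm_ring
  right_distrib x y z := by
    ext <;> simp only [mul_fst, mul_snd, add_fst, add_snd, map_add] <;> noncomm_ring
  zero_mul x := by ext <;> simp [mul_fst, mul_snd, zero_fst, zero_snd]
  mul_zero x := by ext <;> simp [mul_fst, mul_snd, zero_fst, zero_snd]
  nsmul := nsmulRec
  zsmul := zsmulRec

end Jet

theorem dOne_add (a b : A) : dOne (k := k) (a + b) = dOne a + dOne b := by simp [dOne]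

theorem dOne_mul (a b : A) : dOne (k := k) (a * b) =
    algebraMap A (Form k A) a * dOne b + algebraMap A (Form k A) b * dOne a := by
  simp [dOne, Algebra.smul_def]

theorem dOne_algebraMap (c : k) : dOne (k := k) (algebraMap k A c) = 0 := by simp [dOne]

/-- `a ↦ (a, d a)`. -/
noncomputable def Jet.ofRing : A →+* Jet k A where
  toFun a := ⟨algebraMap A (Form k A) a, dOne a⟩
  map_one' := Jet.ext (map_one _) (by simp [dOne, Jet.one_snd])
  map_zero' := Jet.ext (map_zero _) (by simp [dOne, Jet.zero_snd])
  map_add' a b := Jet.ext (map_add _ _ _) (dOne_add a b)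
  map_mul' a b := Jet.ext (map_mul _ _ _) (by
    simp only [Jet.mul_snd, dOne_mul, AlgHom.commutes]
    rw [Algebra.commutes b])

noncomputable instance : Algebra A (Jet k A) :=
  Jet.ofRing.toAlgebra' fun a x => by
    apply Jet.ext
    · exact Algebra.commutes a x.1
    · simp only [Jet.mul_snd]
      simp only [Jet.ofRing, RingHom.coe_mk, MonoidHom.coe_mk, OneHom.coe_mk, AlgHom.commutes]
      rw [dOne, ι_mul_comm, Algebra.commutes, add_comm]

noncomputable instance : Algebra k (Jet k A) := Algebra.compHom _ (algebraMap k A)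

instance : IsScalarTower k A (Jet k A) := IsScalarTower.of_algebraMap_eq' rfl

theorem Jet.smul_fst (a : A) (x : Jet k A) : (a • x).1 = a • x.1 := by
  rw [Algebra.smul_def, Jet.mul_fst, Algebra.smul_def]; rfl

theorem Jet.smul_snd (a : A) (x : Jet k A) : (a • x).2 = a • x.2 + dOne a * x.1 := by
  rw [Algebra.smul_def, Jet.mul_snd, Algebra.smul_def, ← AlgHom.commutes sgn]; rfl

variable (k A) in
/-- `a ↦ (d a, 0)`, as a derivation. -/
noncomputable def Jet.derivation : Derivation k A (Jet k A) :=
  Derivation.mk'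
    { toFun := fun a => (⟨dOne a, 0⟩ : Jet k A)
      map_add' := fun a b => Jet.ext (dOne_add a b) (by simp [Jet.add_snd])
      map_smul' := fun c a => by
        rw [RingHom.id_apply, ← algebraMap_smul A c (Jet.mk _ _)]
        apply Jet.ext
        · rw [Jet.smul_fst]
          simp [dOne]
        · rw [Jet.smul_snd, dOne_algebraMap]
          simp }
    fun a b => by
      apply Jet.ext
      · simp only [LinearMap.coe_mk, AddHom.coe_mk, Jet.add_fst, Jet.smul_fst, dOne_mul]
        simp only [Algebra.smul_def]
      · simp only [LinearMap.coe_mk, AddHom.coe_mk, Jet.add_snd, Jet.smul_snd]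
        simp only [smul_zero, zero_add]
        exact (ExteriorAlgebra.ι_add_mul_swap _ _).symm

theorem Jet.lift_anticomm (x y : Ω[A⁄k]) :
    (Jet.derivation k A).liftKaehlerDifferential x * (Jet.derivation k A).liftKaehlerDifferential y
      + (Jet.derivation k A).liftKaehlerDifferential y *
        (Jet.derivation k A).liftKaehlerDifferential x = 0 := by
  have hx : x ∈ Submodule.span A (Set.range (KaehlerDifferential.D k A)) := by
    rw [KaehlerDifferential.span_range_derivation]; trivial
  have hy : y ∈ Submodule.span A (Set.range (KaehlerDifferential.D k A)) := by
    rw [KaehlerDifferential.span_range_derivation]; trivial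
  induction hx using Submodule.span_induction with
  | zero => simp
  | add a b _ _ ha hb =>
    rw [map_add, add_mul, mul_add, add_add_add_comm, ha, hb, add_zero]
  | smul r a _ ha => rw [map_smul, smul_mul_assoc, mul_smul_comm, ← smul_add, ha, smul_zero]
  | mem a ha =>
    obtain ⟨a, rfl⟩ := ha
    induction hy using Submodule.span_induction with
    | zero => simp
    | add c b _ _ hc hb =>
      rw [map_add, add_mul, mul_add, add_add_add_comm, hc, hb, add_zero]
    | smul r c _ hc => rw [map_smul, smul_mul_assoc, mul_smul_comm, ← smul_add, hc, smul_zero]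
    | mem b hb =>
      obtain ⟨b, rfl⟩ := hb
      simp only [Derivation.liftKaehlerDifferential_comp_D]
      apply Jet.ext
      · exact ExteriorAlgebra.ι_add_mul_swap _ _
      · simp [Jet.add_snd, Jet.mul_snd, Jet.derivation, Jet.zero_snd]

theorem Jet.lift_sq (x : Ω[A⁄k]) :
    (Jet.derivation k A).liftKaehlerDifferential x *
      (Jet.derivation k A).liftKaehlerDifferential x = 0 := by
  have hx : x ∈ Submodule.span A (Set.range (KaehlerDifferential.D k A)) := by
    rw [KaehlerDifferential.span_range_derivation]; trivial
  induction hx using Submodule.span_induction with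
  | zero => simp
  | add a b _ _ ha hb =>
    rw [map_add, add_mul, mul_add, mul_add, ha, hb, zero_add, add_zero, Jet.lift_anticomm]
  | smul r a _ ha => rw [map_smul, smul_mul_assoc, mul_smul_comm, ha, smul_zero, smul_zero]
  | mem a ha =>
    obtain ⟨a, rfl⟩ := ha
    simp only [Derivation.liftKaehlerDifferential_comp_D]
    apply Jet.ext
    · exact ExteriorAlgebra.ι_sq_zero _
    · simp [Jet.mul_snd, Jet.derivation, Jet.zero_snd]

variable (k A) in
/-- The algebra homomorphism `z ↦ (z, d z)`. -/
noncomputable def Jet.prolong : Form k A →ₐ[A] Jet k A :=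
  ExteriorAlgebra.lift A ⟨(Jet.derivation k A).liftKaehlerDifferential, Jet.lift_sq⟩

theorem Jet.prolong_fst (z : Form k A) : (Jet.prolong k A z).1 = z := by
  have key : ∀ x : Ω[A⁄k],
      ((Jet.derivation k A).liftKaehlerDifferential x).1 = ExteriorAlgebra.ι A x := by
    intro x
    have hx : x ∈ Submodule.span A (Set.range (KaehlerDifferential.D k A)) := by
      rw [KaehlerDifferential.span_range_derivation]; trivial
    induction hx using Submodule.span_induction with
    | zero => simp [Jet.zero_fst]
    | add a b _ _ ha hb => rw [map_add, Jet.add_fst, ha, hb, map_add]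
    | smul r a _ ha => rw [map_smul, Jet.smul_fst, ha, map_smul]
    | mem a ha =>
      obtain ⟨a, rfl⟩ := ha
      rw [Derivation.liftKaehlerDifferential_comp_D]; rfl
  induction z using ExteriorAlgebra.induction with
  | algebraMap r => rw [AlgHom.commutes]; rfl
  | ι x => rw [Jet.prolong, ExteriorAlgebra.lift_ι_apply]; exact key x
  | mul a b ha hb => rw [map_mul, Jet.mul_fst, ha, hb]
  | add a b ha hb => rw [map_add, Jet.add_fst, ha, hb]

variable (k A) in
/-- The exterior derivative on Kähler differential forms. -/
noncomputable def extD : Form k A →ₗ[k] Form k A where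
  toFun z := (Jet.prolong k A z).2
  map_add' x y := by rw [map_add]; rfl
  map_smul' c x := by
    rw [RingHom.id_apply, ← algebraMap_smul A c x, map_smul, Jet.smul_snd, dOne_algebraMap,
      zero_mul, add_zero, algebraMap_smul]

theorem extD_mul (x y : Form k A) : extD k A (x * y) = extD k A x * y + sgn x * extD k A y := by
  change (Jet.prolong k A (x * y)).2 = _
  rw [map_mul, Jet.mul_snd, Jet.prolong_fst, Jet.prolong_fst, add_comm]; rfl

theorem extD_algebraMap (a : A) : extD k A (algebraMap A (Form k A) a) = dOne a := by
  change (Jet.prolong k A (algebraMap A (Form k A) a)).2 = _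
  rw [AlgHom.commutes]; rfl

theorem extD_dOne (a : A) : extD k A (dOne a) = 0 := by
  change (Jet.prolong k A (dOne a)).2 = _
  rw [dOne, Jet.prolong, ExteriorAlgebra.lift_ι_apply]
  change ((Jet.derivation k A).liftKaehlerDifferential _).2 = _
  rw [Derivation.liftKaehlerDifferential_comp_D]; rfl

theorem extD_smul (a : A) (x : Form k A) :
    extD k A (a • x) = dOne a * x + a • extD k A x := by
  rw [Algebra.smul_def, extD_mul, extD_algebraMap, AlgHom.commutes, Algebra.smul_def]

/-- The algebra of forms is generated by the elements `a` and `d a`. -/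
theorem form_induction {P : Form k A → Prop} (h0 : ∀ a, P (algebraMap A (Form k A) a))
    (h1 : ∀ a, P (dOne a)) (hm : ∀ x y, P x → P y → P (x * y))
    (ha : ∀ x y, P x → P y → P (x + y)) (z : Form k A) : P z := by
  induction z using ExteriorAlgebra.induction with
  | algebraMap r => exact h0 r
  | mul a b ha hb => exact hm _ _ ha hb
  | add a b ha' hb => exact ha _ _ ha' hb
  | ι x =>
    have hx : x ∈ Submodule.span A (Set.range (KaehlerDifferential.D k A)) := by
      rw [KaehlerDifferential.span_range_derivation]; trivial
    induction hx using Submodule.span_induction with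
    | zero => rw [map_zero, ← map_zero (algebraMap A (Form k A))]; exact h0 0
    | add a b _ _ ha' hb => rw [map_add]; exact ha _ _ ha' hb
    | smul r a _ ha => rw [map_smul, Algebra.smul_def]; exact hm _ _ (h0 r) ha
    | mem a ha =>
      obtain ⟨a, rfl⟩ := ha
      exact h1 a

theorem extD_sgn (z : Form k A) : extD k A (sgn z) = -sgn (extD k A z) := by
  induction z using form_induction with
  | h0 a => rw [AlgHom.commutes, extD_algebraMap, dOne, sgn_ι, neg_neg]
  | h1 a => rw [extD_dOne, dOne, sgn_ι, map_neg, ← dOne, extD_dOne]; simp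
  | hm x y hx hy =>
    rw [map_mul, extD_mul, extD_mul, hx, hy, map_add, map_mul, map_mul, neg_add, neg_mul, mul_neg]
  | ha x y hx hy => rw [map_add, map_add, hx, hy, map_add, map_add, neg_add]

theorem extD_extD (z : Form k A) : extD k A (extD k A z) = 0 := by
  induction z using form_induction with
  | h0 a => rw [extD_algebraMap, extD_dOne]
  | h1 a => rw [extD_dOne, map_zero]
  | hm x y hx hy =>
    rw [extD_mul, map_add, extD_mul, extD_mul, hx, hy, extD_sgn, sgn_sgn]; simp
  | ha x y hx hy => rw [map_add, map_add, hx, hy, add_zero]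

variable (k A) in
/-- The algebra of closed forms. -/
noncomputable def closedForms : Subalgebra k (Form k A) where
  carrier := {z | extD k A z = 0}
  mul_mem' {x y} hx hy := by
    simp only [Set.mem_ofPred_eq] at *
    rw [extD_mul, hx, hy, zero_mul, mul_zero, add_zero]
  add_mem' {x y} hx hy := by
    simp only [Set.mem_ofPred_eq] at *
    rw [map_add, hx, hy, add_zero]
  algebraMap_mem' c := by
    simp only [Set.mem_ofPred_eq]
    rw [IsScalarTower.algebraMap_apply k A (Form k A), extD_algebraMap, dOne_algebraMap]

variable (k A) in
/-- The ideal of exact forms in the algebra of closed forms. -/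
noncomputable def exactForms : Ideal (closedForms k A) where
  carrier := {z | ∃ y, extD k A y = z}
  add_mem' := by
    rintro x y ⟨u, hu⟩ ⟨v, hv⟩
    exact ⟨u + v, by rw [map_add, hu, hv]; rfl⟩
  zero_mem' := ⟨0, by simp⟩
  smul_mem' := by
    rintro ⟨c, hc⟩ x ⟨u, hu⟩
    refine ⟨sgn c * u, ?_⟩
    change extD k A c = 0 at hc
    rw [extD_mul, extD_sgn, hc, hu, sgn_sgn]; simp

instance : (exactForms k A).IsTwoSided where
  mul_mem_of_left {x} y := by
    rintro ⟨u, hu⟩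
    refine ⟨u * y, ?_⟩
    have hy : extD k A y = 0 := y.2
    rw [extD_mul, hy, hu]; simp

variable (k A) in
/-- The algebraic de Rham cohomology ring. -/
abbrev DeRhamCohomology : Type _ := closedForms k A ⧸ exactForms k A

variable (k A) in
/-- The degree `p` part of de Rham cohomology: the classes of closed `p`-forms. -/
noncomputable def deRhamDegree (p : ℕ) : Submodule k (DeRhamCohomology k A) :=
  Submodule.map (Ideal.Quotient.mkₐ k (exactForms k A)).toLinearMap
    (Submodule.comap (closedForms k A).val.toLinearMap
      ((⋀[A]^p (Ω[A⁄k])).restrictScalars k))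

end DeRham
section Trace

variable (A : Type*) [CommRing A] (E : Type*) [AddCommGroup E] [Module A E]
  [Module.Finite A E] [Module.Projective A E]

/-- The trace of an endomorphism of a finitely generated projective module. -/
noncomputable def projTrace : Module.End A E →ₗ[A] A :=
  contractLeft A E ∘ₗ (dualTensorHomEquiv A E E).symm.toLinearMap

/-- The trace `N ⊗ End E → N`, on `Hom(E, N ⊗ E) ≃ N ⊗ End E`. -/
noncomputable def coeffTrace (N : Type*) [AddCommGroup N] [Module A N] :
    (E →ₗ[A] N ⊗[A] E) →ₗ[A] N :=
  (TensorProduct.rid A N).toLinearMap ∘ₗ (projTrace A E).lTensor N ∘ₗ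
    (lTensorHomEquivHomLTensor A E N E).symm.toLinearMap

end Trace

section KaehlerConnection

variable (k A : Type*) [CommRing k] [CommRing A] [Algebra k A]
variable (E : Type*) [AddCommGroup E] [Module A E]

/-- A connection `∇ : E → Ω¹ ⊗ E` on an `A`-module. It is automatically `k`-linear, since
`d` vanishes on `k`. -/
structure Connection where
  /-- The underlying additive map. -/
  toAddMonoidHom : E →+ Ω[A⁄k] ⊗[A] E
  leibniz : ∀ (a : A) (e : E), toAddMonoidHom (a • e) =
    a • toAddMonoidHom e + KaehlerDifferential.D k A a ⊗ₜ[A] e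

variable {k A E}

namespace Connection

variable (nabla : Connection k A E)

/-- The connection, with values in `Ω ⊗ E`, where `Ω` is the algebra of all forms. -/
noncomputable def toForm : E →+ Form k A ⊗[A] E :=
  ((ExteriorAlgebra.ι A).rTensor E).toAddMonoidHom.comp nabla.toAddMonoidHom

theorem toForm_smul (a : A) (e : E) :
    nabla.toForm (a • e) = a • nabla.toForm e + dOne a ⊗ₜ[A] e := by
  simp only [toForm, AddMonoidHom.comp_apply, nabla.leibniz, map_add]
  congr 1
  exact map_smul ((ExteriorAlgebra.ι A).rTensor E) a _

/-- The extension of the connection to a map `Ω ⊗ E → Ω ⊗ E`, with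
`∇ (ω ⊗ e) = dω ⊗ e + (-1) ^ |ω| ω ∧ ∇ e`. -/
noncomputable def extend : Form k A ⊗[A] E →+ Form k A ⊗[A] E :=
  TensorProduct.liftAddHom
    { toFun := fun w =>
        { toFun := fun e => extD k A w ⊗ₜ[A] e + sgn w • nabla.toForm e
          map_zero' := by simp
          map_add' := fun x y => by
            rw [TensorProduct.tmul_add, map_add, smul_add, add_add_add_comm] }
      map_zero' := by ext; simp
      map_add' := fun x y => by
        ext e
        simp only [AddMonoidHom.coe_mk, ZeroHom.coe_mk, AddMonoidHom.add_apply, map_add,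
          TensorProduct.add_tmul, add_smul]
        abel }
    (fun a w e => by
      simp only [AddMonoidHom.coe_mk, ZeroHom.coe_mk, toForm_smul, extD_smul, map_smul,
        TensorProduct.add_tmul, smul_add, TensorProduct.tmul_smul, TensorProduct.smul_tmul',
        smul_eq_mul]
      rw [dOne, ι_mul_comm, smul_comm, smul_assoc]
      abel)

theorem extend_tmul (w : Form k A) (e : E) :
    nabla.extend (w ⊗ₜ[A] e) = extD k A w ⊗ₜ[A] e + sgn w • nabla.toForm e := rfl

theorem extend_smul (w : Form k A) (x : Form k A ⊗[A] E) :
    nabla.extend (w • x) = extD k A w • x + sgn w • nabla.extend x := by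
  induction x using TensorProduct.induction_on with
  | zero => simp
  | add x y hx hy => rw [smul_add, map_add, hx, hy, map_add, smul_add, smul_add]; abel
  | tmul z e =>
    rw [TensorProduct.smul_tmul', smul_eq_mul, extend_tmul, extend_tmul, extD_mul, map_mul,
      TensorProduct.add_tmul, smul_add, mul_smul, TensorProduct.smul_tmul',
      TensorProduct.smul_tmul', smul_eq_mul, smul_eq_mul, add_assoc]

/-- The curvature `∇ ∘ ∇`, a linear map over the algebra of forms. -/
noncomputable def curvature : Form k A ⊗[A] E →ₗ[Form k A] Form k A ⊗[A] E where
  toFun x := nabla.extend (nabla.extend x)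
  map_add' x y := by rw [map_add, map_add]
  map_smul' w x := by
    rw [extend_smul, map_add, extend_smul, extend_smul, extD_extD, extD_sgn, sgn_sgn,
      RingHom.id_apply, zero_smul, zero_add, ← add_assoc, ← add_smul, add_neg_cancel, zero_smul,
      zero_add]

/-- The `n`-th power of the curvature, restricted to `E`. -/
noncomputable def curvaturePow (n : ℕ) : E →ₗ[A] Form k A ⊗[A] E :=
  ((nabla.curvature ^ n).restrictScalars A) ∘ₗ TensorProduct.mk A (Form k A) E 1

/-- The form `tr (R ^ n)`. -/
noncomputable def traceForm [Module.Finite A E] [Module.Projective A E] (n : ℕ) : Form k A :=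
  coeffTrace A E (Form k A) (nabla.curvaturePow n)

end Connection

end KaehlerConnection

section Subquotient

variable {k C : Type*} [CommRing k] [AddCommGroup C] [Module k C] (Z B : Submodule k C)

/-- The quotient of a submodule `Z` by `B ∩ Z`. -/
def Subquotient : Type _ := Z ⧸ B.comap Z.subtype

instance : AddCommGroup (Subquotient Z B) := inferInstanceAs (AddCommGroup (Z ⧸ B.comap Z.subtype))

instance : Module k (Subquotient Z B) := inferInstanceAs (Module k (Z ⧸ B.comap Z.subtype))

/-- The projection to the quotient. -/
def Subquotient.mk : Z →ₗ[k] Subquotient Z B := (B.comap Z.subtype).mkQ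

end Subquotient

section LieRinehart

variable (k A L : Type*) [CommRing k] [CommRing A] [Algebra k A] [LieRing L] [Module A L]
  [LieRingModule L A] [LieRinehartRing A L] [LieAlgebra k L] [LieRinehartAlgebra k A L]

/-- The `p`-cochains `Hom_A(⋀^p L, A)` of the Lie-Rinehart complex, as alternating maps. -/
abbrev Cochain (A L : Type*) [CommRing A] [LieRing L] [Module A L] (p : ℕ) : Type _ :=
  L [⋀^Fin p]→ₗ[A] A

variable {A L} in
/-- The second part of the Chevalley-Eilenberg differential. The pair `(i, j)` in the sum stands
for the pair of positions `i < j + 1`. -/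
def bracketTerm : (p : ℕ) → Cochain A L p → (Fin (p + 1) → L) → A
  | 0, _, _ => 0
  | q + 1, f, v => ∑ i : Fin (q + 1), ∑ j ∈ Finset.Ici i, (-1 : A) ^ ((i : ℕ) + (j : ℕ) + 1) *
      f (Matrix.vecCons ⁅v i.castSucc, v j.succ⁆ (j.removeNth (i.castSucc.removeNth v)))

/-- The differential of the Lie-Rinehart complex, given by
`∑ i, (-1)^i δ_i (f (δ_0, …, δ̂_i, …)) + ∑ i < j, (-1)^(i+j) f ([δ_i, δ_j], …, δ̂_i, …, δ̂_j, …)`.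
The value is recorded as a function; it is always alternating and `A`-multilinear. -/
def lrDiff (p : ℕ) : Cochain A L p →ₗ[k] ((Fin (p + 1) → L) → A) where
  toFun f v := (∑ i : Fin (p + 1), (-1 : A) ^ (i : ℕ) * ⁅v i, f (i.removeNth v)⁆) +
    bracketTerm p f v
  map_add' f g := by
    ext v
    cases p <;> simp [bracketTerm, mul_add, Finset.sum_add_distrib]; abel
  map_smul' c f := by
    ext v
    cases p <;> simp [bracketTerm, Finset.smul_sum]

/-- The cocycles of degree `p`. -/
def lrCocycles (p : ℕ) : Submodule k (Cochain A L p) := LinearMap.ker (lrDiff k A L p)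

/-- The coboundaries of degree `p`. -/
def lrCoboundaries : (p : ℕ) → Submodule k (Cochain A L p)
  | 0 => ⊥
  | p + 1 => Submodule.comap
      ({ toFun := fun f v => f v, map_add' := fun _ _ => rfl, map_smul' := fun _ _ => rfl } :
        Cochain A L (p + 1) →ₗ[k] ((Fin (p + 1) → L) → A))
      (LinearMap.range (lrDiff k A L p))

/-- The Lie-Rinehart cohomology `H^p(L, A)`. -/
abbrev LRCohomology (p : ℕ) : Type _ :=
  Subquotient (lrCocycles k A L p) (lrCoboundaries k A L p)

end LieRinehart

section LRConnection

variable (A L : Type*) [CommRing A] [LieRing L] [Module A L] [LieRingModule L A]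
  [LieRinehartRing A L] (W : Type*) [AddCommGroup W] [Module A W]

/-- An `L`-connection on an `A`-module `W`. The operators `∇ δ` are automatically linear over
a base ring on which `L` acts by zero. -/
structure LRConnection where
  /-- The underlying `A`-linear map. -/
  toLinearMap : L →ₗ[A] (W →+ W)
  leibniz : ∀ (x : L) (a : A) (w : W), toLinearMap x (a • w) = a • toLinearMap x w + ⁅x, a⁆ • w

variable {A L W}

/-- The exterior product of alternating maps with values in an algebra, as a signed sum over
shuffles. -/
noncomputable def wedge {N : Type*} [Ring N] [Algebra A N] {p q : ℕ} (f : L [⋀^Fin p]→ₗ[A] N)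
    (g : L [⋀^Fin q]→ₗ[A] N) : L [⋀^Fin (p + q)]→ₗ[A] N :=
  ((LinearMap.mul' A N).compAlternatingMap (f.domCoprod g)).domDomCongr finSumFinEquiv

namespace LRConnection

variable (nabla : LRConnection A L W)

/-- The endomorphism `R(x, y) = [∇ x, ∇ y] - ∇ [x, y]` of `W`. -/
def curvatureEnd (x y : L) : Module.End A W where
  toFun w := nabla.toLinearMap x (nabla.toLinearMap y w) -
    nabla.toLinearMap y (nabla.toLinearMap x w) - nabla.toLinearMap ⁅x, y⁆ w
  map_add' u v := by simp only [map_add]; abel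
  map_smul' a w := by
    simp only [nabla.leibniz, map_add, RingHom.id_apply, smul_sub, lie_lie, sub_smul]
    abel

theorem curvatureEnd_self (x : L) : nabla.curvatureEnd x x = 0 := by
  ext w; simp [curvatureEnd]

theorem curvatureEnd_neg (x y : L) : nabla.curvatureEnd x y = -nabla.curvatureEnd y x := by
  ext w
  simp only [curvatureEnd, LinearMap.coe_mk, AddHom.coe_mk, LinearMap.neg_apply]
  rw [← lie_skew y x, map_neg, AddMonoidHom.neg_apply]
  abel

theorem curvatureEnd_add_left (x x' y : L) :
    nabla.curvatureEnd (x + x') y = nabla.curvatureEnd x y + nabla.curvatureEnd x' y := by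
  ext w
  simp only [curvatureEnd, LinearMap.coe_mk, AddHom.coe_mk, LinearMap.add_apply, map_add, add_lie,
    AddMonoidHom.add_apply]
  abel

theorem curvatureEnd_smul_left (a : A) (x y : L) :
    nabla.curvatureEnd (a • x) y = a • nabla.curvatureEnd x y := by
  ext w
  have h : ⁅a • x, y⁆ = a • ⁅x, y⁆ - ⁅y, a⁆ • x := by
    rw [← lie_skew, LieRinehartRing.leibniz_smul_right, ← lie_skew x y, smul_neg]; abel
  simp only [curvatureEnd, LinearMap.coe_mk, AddHom.coe_mk, LinearMap.smul_apply, map_smul, h,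
    map_sub, AddMonoidHom.sub_apply, AddMonoidHom.smul_apply, nabla.leibniz, smul_sub]
  abel

/-- The curvature, as a 2-cochain with values in `End W`. -/
def curvature : L [⋀^Fin 2]→ₗ[A] Module.End A W where
  toFun v := nabla.curvatureEnd (v 0) (v 1)
  map_update_add' := by
    intro inst v i x y
    obtain rfl := Subsingleton.elim inst (instDecidableEqFin 2)
    fin_cases i
    · simp [curvatureEnd_add_left]
    · simp only [Fin.mk_one, Function.update_self, ne_eq, zero_ne_one, not_false_eq_true,
        Function.update_of_ne]
      rw [curvatureEnd_neg, curvatureEnd_add_left, neg_add, ← curvatureEnd_neg,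
        ← curvatureEnd_neg]
  map_update_smul' := by
    intro inst v i a x
    obtain rfl := Subsingleton.elim inst (instDecidableEqFin 2)
    fin_cases i
    · simp [curvatureEnd_smul_left]
    · simp only [Fin.mk_one, Function.update_self, ne_eq, zero_ne_one, not_false_eq_true,
        Function.update_of_ne]
      rw [curvatureEnd_neg, curvatureEnd_smul_left, ← smul_neg, ← curvatureEnd_neg]
  map_eq_zero_of_eq' v i j h hij := by
    have : v 0 = v 1 := by
      fin_cases i <;> fin_cases j <;> simp_all
    rw [this, curvatureEnd_self]

/-- The powers of the curvature for the exterior product. -/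
noncomputable def curvaturePow : (n : ℕ) → L [⋀^Fin (2 * n)]→ₗ[A] Module.End A W
  | 0 => AlternatingMap.constOfIsEmpty A L (Fin 0) 1
  | n + 1 => wedge (curvaturePow n) nabla.curvature

/-- The cochain `tr (R ^ n)`. -/
noncomputable def traceForm [Module.Finite A W] [Module.Projective A W] (n : ℕ) :
    Cochain A L (2 * n) :=
  (projTrace A W).compAlternatingMap (nabla.curvaturePow n)

end LRConnection

end LRConnection

section Comparison

variable (k A : Type*) [CommRing k] [CommRing A] [Algebra k A]

/-- Evaluation `Ω¹ → Hom_A(Der_k(A), A)`. -/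
noncomputable def evalDer : Ω[A⁄k] →ₗ[A] Module.Dual A (Derivation k A A) :=
  LinearMap.flip (KaehlerDifferential.linearMapEquivDerivation k A (M := A)).symm.toLinearMap

/-- The natural map `Ω^p → Hom_A(⋀^p Der_k(A), A)`. -/
noncomputable def toCochain (p : ℕ) : ⋀[A]^p (Ω[A⁄k]) →ₗ[A] Cochain A (Derivation k A A) p :=
  (exteriorPower.alternatingMapLinearEquiv (R := A) (M := Derivation k A A) (N := A)
      (n := p)).symm.toLinearMap ∘ₗ
    exteriorPower.pairingDual A (Derivation k A A) p ∘ₗ exteriorPower.map p (evalDer k A)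

/-- On decomposable forms the natural map is the determinant of the pairing. -/
theorem toCochain_apply (p : ℕ) (w : Fin p → Ω[A⁄k]) (v : Fin p → Derivation k A A) :
    toCochain k A p (exteriorPower.ιMulti A p w) v =
      Matrix.det (Matrix.of fun i j => (v i).liftKaehlerDifferential (w j)) := by
  simp [toCochain]
  rfl

end Comparison

section KTheory

universe v

variable (A : Type v) [CommRing A]

/-- Finitely generated projective (i.e. locally free of finite rank) modules. -/
structure FGProj where
  /-- The underlying module. -/
  carrier : Type v
  [addCommGroup : AddCommGroup carrier]
  [module : Module A carrier]
  [finite : Module.Finite A carrier]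
  [projective : Module.Projective A carrier]

attribute [instance] FGProj.addCommGroup FGProj.module FGProj.finite FGProj.projective

/-- Isomorphism of modules. -/
instance FGProj.setoid : Setoid (FGProj A) where
  r E F := Nonempty (E.carrier ≃ₗ[A] F.carrier)
  iseqv :=
    { refl := fun E => ⟨LinearEquiv.refl A E.carrier⟩
      symm := fun ⟨e⟩ => ⟨e.symm⟩
      trans := fun ⟨e⟩ ⟨f⟩ => ⟨e.trans f⟩ }

/-- Isomorphism classes of finitely generated projective modules. -/
def IsoClass : Type (v + 1) := Quotient (FGProj.setoid A)

variable {A}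

/-- The isomorphism class of a module. -/
def IsoClass.mk (E : Type v) [AddCommGroup E] [Module A E] [Module.Finite A E]
    [Module.Projective A E] : IsoClass A := Quotient.mk _ (FGProj.mk E)

/-- The commutative monoid of isomorphism classes under the tensor product. -/
noncomputable instance : CommMonoid (IsoClass A) where
  mul := Quotient.map₂ (fun E F => FGProj.mk (E.carrier ⊗[A] F.carrier))
    fun _ _ ⟨e⟩ _ _ ⟨f⟩ => ⟨TensorProduct.congr e f⟩
  one := IsoClass.mk A
  mul_assoc := by
    rintro ⟨E⟩ ⟨F⟩ ⟨G⟩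
    exact Quotient.sound ⟨TensorProduct.assoc A E.carrier F.carrier G.carrier⟩
  one_mul := by
    rintro ⟨E⟩
    exact Quotient.sound ⟨TensorProduct.lid A E.carrier⟩
  mul_one := by
    rintro ⟨E⟩
    exact Quotient.sound ⟨TensorProduct.rid A E.carrier⟩
  mul_comm := by
    rintro ⟨E⟩ ⟨F⟩
    exact Quotient.sound ⟨TensorProduct.comm A E.carrier F.carrier⟩

variable (A) in
/-- The relations `[E ⊕ F] - [E] - [F]` in the free abelian group on isomorphism classes. The
subgroup that they generate is an ideal, as the tensor product distributes over direct sums. -/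
noncomputable def directSumRelations : Ideal (MonoidAlgebra ℤ (IsoClass A)) :=
  Ideal.span {x | ∃ E F : FGProj A,
    x = MonoidAlgebra.of ℤ _ (IsoClass.mk (E.carrier × F.carrier)) -
      MonoidAlgebra.of ℤ _ (IsoClass.mk E.carrier) -
      MonoidAlgebra.of ℤ _ (IsoClass.mk F.carrier)}

variable (A) in
/-- The Grothendieck ring `K₀(A)`: the free abelian group on isomorphism classes of finitely
generated projective modules, with product induced by `⊗`, modulo the direct sum relations. -/
abbrev KZero : Type (v + 1) := MonoidAlgebra ℤ (IsoClass A) ⧸ directSumRelations A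

/-- The class of a module in `K₀(A)`. -/
noncomputable def KZero.mk (E : Type v) [AddCommGroup E] [Module A E] [Module.Finite A E]
    [Module.Projective A E] : KZero A :=
  Ideal.Quotient.mk _ (MonoidAlgebra.of ℤ _ (IsoClass.mk E))

end KTheory

section Main

open Finset

variable {k A : Type*} [Field k] [CommRing A] [Algebra k A]

/-- A family of maps `H^p_DR(A) ≃ H^p(Der_k(A), A)` is the natural comparison if it is induced by
the maps `Ω^p → Hom_A(⋀^p Der_k(A), A)` (which therefore send closed forms to cocycles). -/
def IsNaturalComparison
    (i : ∀ p, deRhamDegree k A p ≃ₗ[k] LRCohomology k A (Derivation k A A) p) : Prop :=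
  ∀ (p : ℕ) (w : closedForms k A) (hw : (w : Form k A) ∈ ⋀[A]^p (Ω[A⁄k])),
    ∃ hc : toCochain k A p ⟨w, hw⟩ ∈ lrCocycles k A (Derivation k A A) p,
      i p ⟨Ideal.Quotient.mkₐ k (exactForms k A) w, w, hw, rfl⟩ =
        Subquotient.mk (lrCocycles k A (Derivation k A A) p)
          (lrCoboundaries k A (Derivation k A A) p) ⟨_, hc⟩

/-- `ch` is given by `ch [E] = ∑ n, (1 / n!) [tr (R ^ n)]`, for every finitely generated projective
module `E` and every connection `∇ : E → Ω¹ ⊗ E`, with curvature `R`. Here `tr (R ^ n)` is a closed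
form of degree `2 n`, zero for large `n`. -/
def IsChernCharacter (ch : KZero A →+* DeRhamCohomology k A) : Prop :=
  ∀ (E : Type _) [AddCommGroup E] [Module A E] [Module.Finite A E] [Module.Projective A E]
    (nabla : Connection k A E),
    ∃ (z : ℕ → closedForms k A) (N : ℕ),
      (∀ n, (z n : Form k A) = nabla.traceForm n ∧
        (z n : Form k A) ∈ ⋀[A]^(2 * n) (Ω[A⁄k])) ∧
      (∀ n ≥ N, z n = 0) ∧
      ch (KZero.mk E) =
        ∑ n ∈ range N, ((n.factorial : k)⁻¹) • Ideal.Quotient.mkₐ k (exactForms k A) (z n)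

/-- `ch` corresponds to the Chern character of the Lie-Rinehart algebra `Der_k(A)`: for every
finitely generated projective module `E` and every `Der_k(A)`-connection on `E`, with curvature `R`,
the class of `∑ n, (1 / n!) tr (R ^ n)` in the cohomology of the Lie-Rinehart complex of `Der_k(A)`
is the image of `ch [E]`. Here `tr (R ^ n)` is a cocycle of degree `2 n`, zero for large `n`. -/
def IsLRChernCharacter
    (i : ∀ p, deRhamDegree k A p ≃ₗ[k] LRCohomology k A (Derivation k A A) p)
    (ch : KZero A →+* DeRhamCohomology k A) : Prop :=
  ∀ (E : Type _) [AddCommGroup E] [Module A E] [Module.Finite A E] [Module.Projective A E]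
    (nabla : LRConnection A (Derivation k A A) E),
    ∃ (c : ∀ n, lrCocycles k A (Derivation k A A) (2 * n)) (N : ℕ),
      (∀ n, (c n : Cochain A (Derivation k A A) (2 * n)) = nabla.traceForm n) ∧
      (∀ n ≥ N, c n = 0) ∧
      ch (KZero.mk E) =
        ∑ n ∈ range N, ((n.factorial : k)⁻¹) •
          (((i (2 * n)).symm (Subquotient.mk _ _ (c n)) : deRhamDegree k A (2 * n)) :
            DeRhamCohomology k A)

end Main

end ChernCharacter

/-! This is Chern–Weil theory, carried out for two kinds of connections and then compared. A
connection extends to an odd operator ∇ on Ω ⊗ E with ∇(ω m) = dω m ± ω ∇m. Its square R is Ω-linear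
and commutes with ∇, and the trace turns the supercommutator with ∇ into d
(`Connection.coeffTrace_bracket`), so tr(Rⁿ) is closed. For two connections put a = ∇' − ∇ and D = ∇
+ t a. The t-derivative of (D²)ⁿ is the supercommutator of D with an explicit odd operator
(`derivative_sq_pow`). Hence the trace of its coefficient at t^(j+1) becomes exact after
multiplication by j + 1 (`Connection.hasTrace_line_coeff`), and in characteristic zero the class of
tr(Rⁿ) does not depend on the connection (`Connection.traceForm_sub_exact`).

The class Σ tr(Rⁿ)/n! is therefore an invariant of E. It is additive because the curvature of a
direct sum is block diagonal, and multiplicative because the curvature of a tensor product is R ⊗ 1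
+ 1 ⊗ R', so that the binomial theorem and the factorials give a Cauchy product
(`Connection.traceForm_tensor`, `Connection.chernTerm_tensor`). Every projective module has a
connection and the classes of modules generate K₀, so the formula defines a ring homomorphism and
leaves no other choice.

For a smooth algebra Ω¹ is finitely generated projective. Then Ω^p → Hom_A(⋀^p Der, A) is bijective
(`toCochain_bijective`), and it commutes with the differentials, which is checked on forms a db₁ ∧ ⋯
∧ db_p (`lrDiff_toCochain`). The two complexes are thus isomorphic. In the same way Ω¹ ⊗ E ≅
Hom_A(Der, E) matches the two kinds of connections, and evaluating curvature powers on derivations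
carries the form tr(Rⁿ) to the cochain tr(Rⁿ) (`LRConnection.IsContraction.toCochain_traceForm`).
Both properties therefore prescribe the same value on each [E]. -/

namespace ChernCharacter

/-! ### Traces with coefficients, computed on maps of rank one -/

section RankOne

variable {A : Type*} [CommRing A] {E F N N' : Type*} [AddCommGroup E] [Module A E]
  [AddCommGroup F] [Module A F] [AddCommGroup N] [Module A N] [AddCommGroup N'] [Module A N']

/-- The map `e ↦ n ⊗ f(e) x`. -/
noncomputable def rankOne (n : N) (f : Module.Dual A E) (x : F) : E →ₗ[A] N ⊗[A] F :=
  f.smulRight (n ⊗ₜ[A] x)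

theorem rankOne_apply (n : N) (f : Module.Dual A E) (x : F) (e : E) :
    rankOne n f x e = f e • n ⊗ₜ[A] x := rfl

variable [Module.Finite A E] [Module.Projective A E]

theorem rankOne_eq (n : N) (f : Module.Dual A E) (x : F) :
    rankOne n f x = lTensorHomEquivHomLTensor A E N F (n ⊗ₜ dualTensorHom A E F (f ⊗ₜ x)) := by
  ext e
  simp [rankOne, lTensorHomEquivHomLTensor_apply]

/-- Maps `E → N ⊗ F` are sums of maps of rank one, if `E` is finitely generated projective. -/
theorem hom_tensor_induction {P : (E →ₗ[A] N ⊗[A] F) → Prop} (h0 : P 0)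
    (h1 : ∀ n f x, P (rankOne n f x)) (ha : ∀ u v, P u → P v → P (u + v))
    (u : E →ₗ[A] N ⊗[A] F) : P u := by
  obtain ⟨t, rfl⟩ := (lTensorHomEquivHomLTensor A E N F).surjective u
  induction t using TensorProduct.induction_on with
  | zero => rwa [map_zero]
  | add x y hx hy => rw [map_add]; exact ha _ _ hx hy
  | tmul n φ =>
    obtain ⟨s, rfl⟩ := (dualTensorHomEquiv A E F).surjective φ
    induction s using TensorProduct.induction_on with
    | zero => rwa [map_zero, TensorProduct.tmul_zero, map_zero]
    | add x y hx hy => rw [map_add, TensorProduct.tmul_add, map_add]; exact ha _ _ hx hy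
    | tmul f x =>
      have := h1 n f x
      rw [rankOne_eq] at this
      exact this

theorem projTrace_dualTensorHom (f : Module.Dual A E) (x : E) :
    projTrace A E (dualTensorHom A E E (f ⊗ₜ x)) = f x := by
  have h : dualTensorHom A E E (f ⊗ₜ x) = dualTensorHomEquiv A E E (f ⊗ₜ x) := rfl
  rw [h]
  simp [projTrace]

theorem coeffTrace_equiv_tmul (n : N) (φ : Module.End A E) :
    coeffTrace A E N (lTensorHomEquivHomLTensor A E N E (n ⊗ₜ φ)) = projTrace A E φ • n := by
  rw [coeffTrace, LinearMap.comp_apply, LinearMap.comp_apply, LinearEquiv.coe_coe,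
    LinearEquiv.coe_coe, LinearEquiv.symm_apply_apply, LinearMap.lTensor_tmul,
    TensorProduct.rid_tmul]

theorem coeffTrace_rankOne (n : N) (f : Module.Dual A E) (x : E) :
    coeffTrace A E N (rankOne n f x) = f x • n := by
  rw [rankOne_eq, coeffTrace_equiv_tmul, projTrace_dualTensorHom]

/-- Contraction of `N ⊗ E` with a functional on `E`. -/
noncomputable def contract (N : Type*) [AddCommGroup N] [Module A N] (f : Module.Dual A E) :
    N ⊗[A] E →ₗ[A] N :=
  (TensorProduct.rid A N).toLinearMap ∘ₗ f.lTensor N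

omit [Module.Finite A E] [Module.Projective A E] in
theorem contract_tmul (f : Module.Dual A E) (n : N) (e : E) :
    contract N f (n ⊗ₜ e) = f e • n := by
  simp [contract]

theorem coeffTrace_smulRight (f : Module.Dual A E) (y : N ⊗[A] E) :
    coeffTrace A E N (f.smulRight y) = contract N f y := by
  induction y using TensorProduct.induction_on with
  | zero => simp
  | add x y hx hy =>
    rw [map_add, ← hx, ← hy, ← map_add]
    congr 1
    ext e
    simp
  | tmul n x => exact (coeffTrace_rankOne n f x).trans (contract_tmul f n x).symm

/-- Cyclicity of the trace. Both sides are additive in `u`, and on a map of rank one both equal `f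
(h x) • n`. -/
theorem coeffTrace_comp (u : F →ₗ[A] N ⊗[A] E) (h : E →ₗ[A] F) [Module.Finite A F]
    [Module.Projective A F] :
    coeffTrace A E N (u ∘ₗ h) = coeffTrace A F N (h.lTensor N ∘ₗ u) := by
  induction u using hom_tensor_induction with
  | h0 => simp
  | ha u v hu hv => rw [LinearMap.add_comp, LinearMap.comp_add, map_add, map_add, hu, hv]
  | h1 n f x =>
    have h1 : rankOne n f x ∘ₗ h = rankOne n (f ∘ₗ h) x := rfl
    have h2 : h.lTensor N ∘ₗ rankOne n f x = rankOne n f (h x) := by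
      ext e; simp [rankOne_apply]
    rw [h1, h2, coeffTrace_rankOne, coeffTrace_rankOne]
    rfl

theorem coeffTrace_rTensor_comp (j : N →ₗ[A] N') (u : E →ₗ[A] N ⊗[A] E) :
    coeffTrace A E N' (j.rTensor E ∘ₗ u) = j (coeffTrace A E N u) := by
  induction u using hom_tensor_induction with
  | h0 => simp
  | ha u v hu hv => rw [LinearMap.comp_add, map_add, map_add, hu, hv, map_add]
  | h1 n f x =>
    have h2 : j.rTensor E ∘ₗ rankOne n f x = rankOne (j n) f x := by
      ext e; simp [rankOne_apply]
    rw [h2, coeffTrace_rankOne, coeffTrace_rankOne, map_smul]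

/-- Here the functional, not the vector, carries the coefficients. Naturality in the coefficients
reduces to the universal case `g = id`; the map e ↦ e ⊗ x then factors through `A`, and cyclicity
moves the trace to `A`, where the map has rank one. -/
theorem coeffTrace_tmul_right (g : E →ₗ[A] N) (x : E) :
    coeffTrace A E N ((TensorProduct.mk A N E).flip x ∘ₗ g) = g x := by
  have h : (TensorProduct.mk A N E).flip x ∘ₗ g =
      g.rTensor E ∘ₗ (TensorProduct.mk A E E).flip x := by
    ext; simp
  rw [h, coeffTrace_rTensor_comp]
  congr 1
  have h : (TensorProduct.mk A E E).flip x =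
      (LinearMap.toSpanSingleton A E x).lTensor E ∘ₗ (TensorProduct.rid A E).symm.toLinearMap := by
    ext; simp
  rw [h, ← coeffTrace_comp]
  have h : (TensorProduct.rid A E).symm.toLinearMap ∘ₗ LinearMap.toSpanSingleton A E x =
      rankOne x LinearMap.id 1 := by
    ext; simp [rankOne_apply]
  rw [h, coeffTrace_rankOne]
  simp

/-- The trace of a map with coefficients in the image of `N` lies in the image of `N`. -/
theorem coeffTrace_mem_range (j : N →ₗ[A] N') (u : E →ₗ[A] N' ⊗[A] E)
    (hu : ∀ e, u e ∈ LinearMap.range (j.rTensor E)) :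
    coeffTrace A E N' u ∈ LinearMap.range j := by
  -- Projectivity of `E` lifts `u` through the surjection of `N ⊗ E` onto its image, so injectivity
  -- of `j` plays no role.
  obtain ⟨v, hv⟩ := Module.projective_lifting_property (j.rTensor E).rangeRestrict
    (u.codRestrict _ hu) (LinearMap.surjective_rangeRestrict _)
  have : u = j.rTensor E ∘ₗ v := by
    ext e
    exact (congrArg Subtype.val (LinearMap.congr_fun hv e)).symm
  rw [this, coeffTrace_rTensor_comp]
  exact ⟨_, rfl⟩

end RankOne

/-! ### Multiplicativity of the trace on tensor products -/

section TensorTrace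

variable {A : Type*} [CommRing A] {E F N : Type*} [AddCommGroup E] [Module A E]
  [AddCommGroup F] [Module A F] [Ring N] [Algebra A N]

/-- The multiplication `(N ⊗ E) ⊗ (N ⊗ F) → N ⊗ (E ⊗ F)`. -/
noncomputable def mulTensor (N E F : Type*) [AddCommGroup E] [Module A E]
    [AddCommGroup F] [Module A F] [Ring N] [Algebra A N] :
    (N ⊗[A] E) ⊗[A] (N ⊗[A] F) →ₗ[A] N ⊗[A] (E ⊗[A] F) :=
  (LinearMap.mul' A N).rTensor (E ⊗[A] F) ∘ₗ
    (TensorProduct.tensorTensorTensorComm A N E N F).toLinearMap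

theorem mulTensor_tmul (a b : N) (e : E) (f : F) :
    mulTensor N E F ((a ⊗ₜ[A] e) ⊗ₜ[A] (b ⊗ₜ[A] f)) = (a * b) ⊗ₜ[A] (e ⊗ₜ[A] f) := by
  simp [mulTensor]

/-- Both sides are biadditive, and the tensor product of two maps of rank one again has rank one,
with functional f ⊗ g. -/
theorem coeffTrace_mulTensor [Module.Finite A E] [Module.Projective A E] [Module.Finite A F]
    [Module.Projective A F] (u : E →ₗ[A] N ⊗[A] E) (v : F →ₗ[A] N ⊗[A] F) :
    coeffTrace A (E ⊗[A] F) N (mulTensor N E F ∘ₗ TensorProduct.map u v) =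
      coeffTrace A E N u * coeffTrace A F N v := by
  induction u using hom_tensor_induction with
  | h0 => simp
  | ha u u' hu hu' =>
    rw [TensorProduct.map_add_left, LinearMap.comp_add, map_add, map_add, add_mul, hu, hu']
  | h1 n f x =>
    induction v using hom_tensor_induction with
    | h0 => simp
    | ha v v' hv hv' =>
      rw [TensorProduct.map_add_right, LinearMap.comp_add, map_add, map_add, mul_add, hv, hv']
    | h1 m g y =>
      have : mulTensor N E F ∘ₗ TensorProduct.map (rankOne n f x) (rankOne m g y) =
          rankOne (n * m) (LinearMap.mul' A A ∘ₗ TensorProduct.map f g) (x ⊗ₜ[A] y) := by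
        ext e e'
        simp [rankOne_apply, mulTensor_tmul, smul_smul, TensorProduct.smul_tmul', mul_comm]
      rw [this, coeffTrace_rankOne, coeffTrace_rankOne, coeffTrace_rankOne]
      simp [smul_smul, mul_comm]

end TensorTrace

/-! ### Homogeneous forms -/

section Degree

variable {k A : Type*} [CommRing k] [CommRing A] [Algebra k A]

theorem sgn_eq_of_mem {p : ℕ} {z : Form k A} (hz : z ∈ ⋀[A]^p (Ω[A⁄k])) :
    sgn z = (-1 : A) ^ p • z := by
  rw [← ExteriorAlgebra.ιMulti_span_fixedDegree] at hz
  induction hz using Submodule.span_induction with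
  | zero => simp
  | add x y _ _ hx hy => rw [map_add, hx, hy, smul_add]
  | smul a x _ hx => rw [map_smul, hx, smul_comm]
  | mem x hx =>
    obtain ⟨w, rfl⟩ := hx
    induction p with
    | zero => simp
    | succ p ih =>
      rw [ExteriorAlgebra.ιMulti_succ_apply, map_mul, sgn_ι, ih, pow_succ, mul_smul]
      simp

theorem sgn_mem {p : ℕ} {z : Form k A} (hz : z ∈ ⋀[A]^p (Ω[A⁄k])) :
    sgn z ∈ ⋀[A]^p (Ω[A⁄k]) := by
  rw [sgn_eq_of_mem hz]
  exact Submodule.smul_mem _ _ hz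

theorem ι_mem (w : Ω[A⁄k]) : ExteriorAlgebra.ι A w ∈ ⋀[A]^1 (Ω[A⁄k]) := by
  rw [ExteriorAlgebra.exteriorPower, pow_one]
  exact ⟨w, rfl⟩

theorem mul_mem_exteriorPower {p q : ℕ} {x y : Form k A} (hx : x ∈ ⋀[A]^p (Ω[A⁄k]))
    (hy : y ∈ ⋀[A]^q (Ω[A⁄k])) : x * y ∈ ⋀[A]^(p + q) (Ω[A⁄k]) :=
  SetLike.mul_mem_graded (A := fun i : ℕ => ⋀[A]^i (Ω[A⁄k])) hx hy

theorem extD_ιMulti_D {p : ℕ} (b : Fin p → A) :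
    extD k A (ExteriorAlgebra.ιMulti A p fun i => KaehlerDifferential.D k A (b i)) = 0 := by
  induction p with
  | zero =>
    rw [ExteriorAlgebra.ιMulti_zero_apply, ← map_one (algebraMap A (Form k A)), extD_algebraMap]
    simp [dOne]
  | succ p ih =>
    rw [ExteriorAlgebra.ιMulti_succ_apply, extD_mul]
    have h1 : extD k A (ExteriorAlgebra.ι A (KaehlerDifferential.D k A (b 0))) = 0 :=
      extD_dOne (b 0)
    rw [h1]
    have h2 := ih (fun i => b i.succ)
    simp only [Matrix.vecTail, Function.comp_def]
    rw [h2]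
    simp

/-- Forms of degree `p` are sums of forms `a • db₁ ∧ ⋯ ∧ db_p`. -/
theorem exteriorPower_induction {p : ℕ} {P : Form k A → Prop} (h0 : P 0)
    (ha : ∀ x y, x ∈ ⋀[A]^p (Ω[A⁄k]) → y ∈ ⋀[A]^p (Ω[A⁄k]) → P x → P y → P (x + y))
    (h1 : ∀ (a : A) (b : Fin p → A),
      P (a • ExteriorAlgebra.ιMulti A p fun i => KaehlerDifferential.D k A (b i)))
    {z : Form k A} (hz : z ∈ ⋀[A]^p (Ω[A⁄k])) : P z := by
  rw [← exteriorPower.ιMulti_span_fixedDegree_of_span_eq_top A p _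
    (KaehlerDifferential.span_range_derivation k A)] at hz
  have h := exteriorPower.ιMulti_span_fixedDegree_of_span_eq_top A p _
    (KaehlerDifferential.span_range_derivation k A)
  -- Membership in the exterior power is carried along because the additivity hypothesis on `P` asks
  -- for it.
  refine (Submodule.closure_induction (p := fun x _ => P x ∧ x ∈ ⋀[A]^p (Ω[A⁄k]))
    ⟨h0, zero_mem _⟩ ?_ ?_ hz).1
  · rintro x y _ _ ⟨hx, hx'⟩ ⟨hy, hy'⟩
    exact ⟨ha x y hx' hy' hx hy, add_mem hx' hy'⟩
  · rintro a x hx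
    refine ⟨?_, ?_⟩
    · obtain ⟨w, hw, rfl⟩ := hx
      choose b hb using Set.range_subset_iff.mp hw
      have := h1 a b
      simp only [hb] at this
      exact this
    · rw [← h]
      exact Submodule.smul_mem _ _ (Submodule.subset_span hx)

theorem extD_mem {p : ℕ} {z : Form k A} (hz : z ∈ ⋀[A]^p (Ω[A⁄k])) :
    extD k A z ∈ ⋀[A]^(p + 1) (Ω[A⁄k]) := by
  refine exteriorPower_induction (P := fun z => extD k A z ∈ ⋀[A]^(p + 1) (Ω[A⁄k])) ?_ ?_ ?_ hz
  · rw [map_zero]; exact zero_mem _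
  · intro x y _ _ hx hy; rw [map_add]; exact add_mem hx hy
  · intro a b
    rw [extD_smul, extD_ιMulti_D, smul_zero, add_zero, add_comm p]
    exact mul_mem_exteriorPower (ι_mem _) (SetLike.coe_mem (exteriorPower.ιMulti A p _))

/-- Forms of large degree vanish. -/
theorem exists_forall_exteriorPower_eq_zero [Module.Finite A (Ω[A⁄k])] :
    ∃ N, ∀ p ≥ N, ∀ z ∈ ⋀[A]^p (Ω[A⁄k]), z = 0 := by
  obtain ⟨s, hs⟩ := Module.Finite.fg_top (R := A) (M := Ω[A⁄k])
  refine ⟨s.card + 1, fun p hp z hz => ?_⟩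
  rw [← exteriorPower.ιMulti_span_fixedDegree_of_span_eq_top A p _ hs] at hz
  induction hz using Submodule.span_induction with
  | zero => rfl
  | add x y _ _ hx hy => rw [hx, hy, add_zero]
  | smul a x _ hx => rw [hx, smul_zero]
  | mem x hx =>
    obtain ⟨w, hw, rfl⟩ := hx
    replace hw := Set.range_subset_iff.mp hw
    -- Pigeonhole: more than `s.card` one-forms taken from `s` must contain a repetition.
    refine ExteriorAlgebra.ιMulti_eq_zero_of_not_inj fun hinj => ?_
    have := Fintype.card_le_of_injective (fun i => (⟨w i, hw i⟩ : (s : Set (Ω[A⁄k]))))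
      fun i j hij => hinj (congrArg Subtype.val hij)
    simp at this
    omega

end Degree

/-! ### Forms with values in a module -/

section Ext

variable {k A : Type*} [CommRing k] [CommRing A] [Algebra k A]
variable {E : Type*} [AddCommGroup E] [Module A E]

/-- The extension of an `A`-linear map `E → Ω ⊗ E` to an `Ω`-linear map on `Ω ⊗ E`. -/
noncomputable def formExtend (u : E →ₗ[A] Form k A ⊗[A] E) :
    Form k A ⊗[A] E →ₗ[Form k A] Form k A ⊗[A] E :=
  TensorProduct.AlgebraTensorModule.lift (LinearMap.toSpanSingleton (Form k A) _ u)

theorem formExtend_tmul (u : E →ₗ[A] Form k A ⊗[A] E) (w : Form k A) (e : E) :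
    formExtend u (w ⊗ₜ e) = w • u e := rfl

theorem formExtend_add (u v : E →ₗ[A] Form k A ⊗[A] E) :
    formExtend (u + v) = formExtend u + formExtend v := by
  ext
  simp [formExtend_tmul]

/-- For rank one maps the extension is a contraction followed by multiplication; the contracted form
stands on the left, which matters since forms do not commute. -/
theorem formExtend_smulRight (f : Module.Dual A E) (y : Form k A ⊗[A] E) (m : Form k A ⊗[A] E) :
    formExtend (f.smulRight y) m = contract (Form k A) f m • y := by
  induction m using TensorProduct.induction_on with
  | zero => simp
  | add x y hx hy => rw [map_add, map_add, hx, hy, add_smul]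
  | tmul w e =>
    rw [formExtend_tmul, contract_tmul, LinearMap.smulRight_apply, smul_assoc, smul_comm]

variable (k A E) in
/-- The grading involution on forms with values in `E`. -/
noncomputable def sgnTensor : Form k A ⊗[A] E →ₗ[A] Form k A ⊗[A] E :=
  (sgn (k := k) (A := A)).toLinearMap.rTensor E

theorem sgnTensor_tmul (w : Form k A) (e : E) :
    sgnTensor k A E (w ⊗ₜ e) = sgn w ⊗ₜ e := rfl

theorem sgnTensor_smul (w : Form k A) (m : Form k A ⊗[A] E) :
    sgnTensor k A E (w • m) = sgn w • sgnTensor k A E m := by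
  induction m using TensorProduct.induction_on with
  | zero => simp
  | add x y hx hy => rw [smul_add, map_add, map_add, hx, hy, smul_add]
  | tmul z e =>
    rw [TensorProduct.smul_tmul', sgnTensor_tmul, sgnTensor_tmul, smul_eq_mul, map_mul]; rfl

theorem sgnTensor_sgnTensor (m : Form k A ⊗[A] E) : sgnTensor k A E (sgnTensor k A E m) = m := by
  induction m using TensorProduct.induction_on with
  | zero => simp
  | add x y hx hy => rw [map_add, map_add, hx, hy]
  | tmul z e => rw [sgnTensor_tmul, sgnTensor_tmul, sgn_sgn]

theorem sgnTensor_ι_rTensor (m : Ω[A⁄k] ⊗[A] E) :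
    sgnTensor k A E ((ExteriorAlgebra.ι A).rTensor E m) = -(ExteriorAlgebra.ι A).rTensor E m := by
  induction m using TensorProduct.induction_on with
  | zero => simp
  | add x y hx hy => rw [map_add, map_add, hx, hy, neg_add]
  | tmul z e => rw [LinearMap.rTensor_tmul, sgnTensor_tmul, sgn_ι, TensorProduct.neg_tmul]

variable (k A E) in
/-- The forms of degree `p` with values in `E`. -/
noncomputable def degreePart (p : ℕ) : Submodule A (Form k A ⊗[A] E) :=
  LinearMap.range ((⋀[A]^p (Ω[A⁄k])).subtype.rTensor E)

theorem tmul_mem_degreePart {p : ℕ} {w : Form k A} (hw : w ∈ ⋀[A]^p (Ω[A⁄k])) (e : E) :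
    w ⊗ₜ e ∈ degreePart k A E p := ⟨⟨w, hw⟩ ⊗ₜ e, rfl⟩

theorem degreePart_induction {p : ℕ} {P : Form k A ⊗[A] E → Prop} (h0 : P 0)
    (ha : ∀ x y, P x → P y → P (x + y)) (h1 : ∀ w ∈ ⋀[A]^p (Ω[A⁄k]), ∀ e, P (w ⊗ₜ e))
    {m : Form k A ⊗[A] E} (hm : m ∈ degreePart k A E p) : P m := by
  obtain ⟨t, rfl⟩ := hm
  induction t using TensorProduct.induction_on with
  | zero => rwa [map_zero]
  | add x y hx hy => rw [map_add]; exact ha _ _ hx hy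
  | tmul w e => exact h1 w w.2 e

theorem smul_mem_degreePart {p q : ℕ} {w : Form k A} (hw : w ∈ ⋀[A]^p (Ω[A⁄k]))
    {m : Form k A ⊗[A] E} (hm : m ∈ degreePart k A E q) : w • m ∈ degreePart k A E (p + q) := by
  refine degreePart_induction (P := fun m => w • m ∈ degreePart k A E (p + q)) ?_ ?_ ?_ hm
  · rw [smul_zero]; exact zero_mem _
  · intro x y hx hy; rw [smul_add]; exact add_mem hx hy
  · intro z hz e; exact tmul_mem_degreePart (mul_mem_exteriorPower hw hz) e

theorem ι_rTensor_mem_degreePart (m : Ω[A⁄k] ⊗[A] E) :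
    (ExteriorAlgebra.ι A).rTensor E m ∈ degreePart k A E 1 := by
  induction m using TensorProduct.induction_on with
  | zero => rw [map_zero]; exact zero_mem _
  | add x y hx hy => rw [map_add]; exact add_mem hx hy
  | tmul z e => exact tmul_mem_degreePart (ι_mem z) e

end Ext

/-! ### Existence of connections, and closedness of the trace forms -/

namespace Connection

variable {k A : Type*} [CommRing k] [CommRing A] [Algebra k A]
variable {E : Type*} [AddCommGroup E] [Module A E] (nabla : Connection k A E)

/-- Every projective module has a connection. -/
theorem nonempty_of_projective [Module.Projective A E] : Nonempty (Connection k A E) := by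
  -- `s` splits the canonical surjection from the free module on the set `E`. The connection is d on
  -- the coordinates of that free module, projected back: e ↦ Σ d(s(e)_x) ⊗ x.
  obtain ⟨s, hs⟩ := Module.Projective.out (R := A) (P := E)
  let g : E → A → Ω[A⁄k] ⊗[A] E := fun x a => KaehlerDifferential.D k A a ⊗ₜ[A] x
  have hg0 : ∀ x, g x 0 = 0 := fun x => by simp [g]
  refine ⟨⟨⟨⟨fun e => (s e).sum g, ?_⟩, ?_⟩, ?_⟩⟩
  · simp
  · intro x y
    change (s (x + y)).sum g = (s x).sum g + (s y).sum g
    rw [map_add]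
    exact Finsupp.sum_add_index' hg0 (fun x a b => by simp [g, TensorProduct.add_tmul])
  · intro a e
    change (s (a • e)).sum g = a • (s e).sum g + _
    rw [map_smul, Finsupp.sum_smul_index hg0, Finsupp.smul_sum]
    have he : e = ∑ x ∈ (s e).support, s e x • x := (hs e).symm
    have he' : KaehlerDifferential.D k A a ⊗ₜ[A] e =
        ∑ x ∈ (s e).support, KaehlerDifferential.D k A a ⊗ₜ[A] (s e x • x) := by
      rw [← TensorProduct.tmul_sum, ← he]
    rw [he', Finsupp.sum, Finsupp.sum, ← Finset.sum_add_distrib]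
    refine Finset.sum_congr rfl fun x _ => ?_
    simp only [g]
    rw [Derivation.leibniz, TensorProduct.add_tmul, TensorProduct.smul_tmul',
      TensorProduct.smul_tmul, TensorProduct.smul_tmul]

theorem extend_one_tmul (e : E) : nabla.extend (1 ⊗ₜ e) = nabla.toForm e := by
  rw [extend_tmul, map_one sgn, one_smul, ← map_one (algebraMap A (Form k A)), extD_algebraMap]
  simp [dOne]

theorem sgnTensor_toForm (e : E) : sgnTensor k A E (nabla.toForm e) = -nabla.toForm e :=
  sgnTensor_ι_rTensor _

theorem extend_sgnTensor (m : Form k A ⊗[A] E) :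
    nabla.extend (sgnTensor k A E m) = -sgnTensor k A E (nabla.extend m) := by
  induction m using TensorProduct.induction_on with
  | zero => simp
  | add x y hx hy => rw [map_add, map_add, map_add, hx, hy, map_add, neg_add]
  | tmul z e =>
    rw [sgnTensor_tmul, extend_tmul, extend_tmul, map_add, sgnTensor_tmul, sgnTensor_smul, extD_sgn,
      sgnTensor_toForm, sgn_sgn, TensorProduct.neg_tmul, smul_neg]
    abel

theorem extend_mem_degreePart {p : ℕ} {m : Form k A ⊗[A] E} (hm : m ∈ degreePart k A E p) :
    nabla.extend m ∈ degreePart k A E (p + 1) := by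
  refine degreePart_induction (P := fun m => nabla.extend m ∈ degreePart k A E (p + 1))
    ?_ ?_ ?_ hm
  · rw [map_zero]; exact zero_mem _
  · intro x y hx hy; rw [map_add]; exact add_mem hx hy
  · intro z hz e
    exact add_mem (tmul_mem_degreePart (extD_mem hz) e)
      (smul_mem_degreePart (sgn_mem hz) (ι_rTensor_mem_degreePart _))

theorem curvature_apply (m : Form k A ⊗[A] E) :
    nabla.curvature m = nabla.extend (nabla.extend m) := rfl

theorem curvature_pow_mem_degreePart (n : ℕ) (e : E) :
    (nabla.curvature ^ n) (1 ⊗ₜ e) ∈ degreePart k A E (2 * n) := by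
  induction n with
  | zero =>
    refine tmul_mem_degreePart ?_ e
    exact SetLike.one_mem_graded (A := fun i : ℕ => ⋀[A]^i (Ω[A⁄k]))
  | succ n ih =>
    rw [pow_succ', Module.End.mul_apply]
    exact nabla.extend_mem_degreePart (nabla.extend_mem_degreePart ih)

/-- Rⁿ sends `E` into forms of degree 2n, and the trace respects a submodule of coefficients by
`coeffTrace_mem_range`. -/
theorem traceForm_mem [Module.Finite A E] [Module.Projective A E] (n : ℕ) :
    nabla.traceForm n ∈ ⋀[A]^(2 * n) (Ω[A⁄k]) := by
  obtain ⟨z, hz⟩ := coeffTrace_mem_range (⋀[A]^(2 * n) (Ω[A⁄k])).subtype (nabla.curvaturePow n)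
    (nabla.curvature_pow_mem_degreePart n)
  rw [traceForm, ← hz]
  exact z.2

theorem extend_smul_ring (a : A) (m : Form k A ⊗[A] E) :
    nabla.extend (a • m) = dOne (k := k) a • m + a • nabla.extend m := by
  rw [← algebraMap_smul (Form k A) a m, extend_smul, extD_algebraMap, AlgHom.commutes sgn,
    algebraMap_smul (Form k A) a (nabla.extend m)]

/-- The map `e ↦ ∇ (u e) - u (∇ e)`. -/
noncomputable def bracket (u : E →ₗ[A] Form k A ⊗[A] E) : E →ₗ[A] Form k A ⊗[A] E where
  toFun e := nabla.extend (u e) - formExtend u (nabla.toForm e)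
  map_add' x y := by simp only [map_add]; abel
  map_smul' a x := by
    rw [toForm_smul, map_smul, extend_smul_ring, map_add, formExtend_tmul, RingHom.id_apply,
      ← algebraMap_smul (Form k A) a (nabla.toForm x), map_smul, algebraMap_smul, smul_sub]
    abel

theorem bracket_apply (u : E →ₗ[A] Form k A ⊗[A] E) (e : E) :
    nabla.bracket u e = nabla.extend (u e) - formExtend u (nabla.toForm e) := rfl

theorem bracket_add (u v : E →ₗ[A] Form k A ⊗[A] E) :
    nabla.bracket (u + v) = nabla.bracket u + nabla.bracket v := by
  ext e
  simp only [bracket_apply, LinearMap.add_apply, map_add, formExtend_add]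
  abel

/-- The dual connection, evaluated at `f`. -/
noncomputable def dualApply (f : Module.Dual A E) : E →ₗ[A] Form k A where
  toFun e := dOne (f e) - contract (Form k A) f (nabla.toForm e)
  map_add' x y := by simp only [map_add, dOne_add]; abel
  map_smul' a x := by
    rw [toForm_smul, map_smul, map_add, map_smul, contract_tmul, RingHom.id_apply, smul_eq_mul,
      dOne_mul, ← Algebra.smul_def, ← Algebra.smul_def, smul_sub]
    abel

variable [Module.Finite A E] [Module.Projective A E]

/-- The trace intertwines the connection and the exterior derivative. -/
theorem coeffTrace_bracket (u : E →ₗ[A] Form k A ⊗[A] E) :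
    coeffTrace A E _ (nabla.bracket u) = extD k A (coeffTrace A E _ u) := by
  induction u using hom_tensor_induction with
  | h0 =>
    have : nabla.bracket 0 = 0 := by
      have := nabla.bracket_add 0 0
      rw [add_zero] at this
      ext e
      have := LinearMap.congr_fun this e
      rw [LinearMap.add_apply] at this
      exact left_eq_add.mp this
    rw [this, map_zero, map_zero]
  | ha u v hu hv => rw [bracket_add, map_add, map_add, map_add, hu, hv]
  | h1 w f x =>
    -- For e ↦ f(e) w ⊗ x the bracket splits by Leibniz into three terms: d falls on w, the dual
    -- connection acts on f, and ∇ acts on x.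
    have key : nabla.bracket (rankOne w f x) = rankOne (extD k A w) f x +
        (LinearMap.mulLeft A (sgn w)).rTensor E ∘ₗ
          ((TensorProduct.mk A _ E).flip x ∘ₗ nabla.dualApply f + f.smulRight (nabla.toForm x)) := by
      have hs : ∀ m : Form k A ⊗[A] E, (LinearMap.mulLeft A (sgn w)).rTensor E m = sgn w • m :=
        fun m => rfl
      -- The contraction of ∇e is a one-form, so it passes w at the cost of the grading sign.
      have hc : ∀ e, contract (Form k A) f (nabla.toForm e) * w =
          sgn w * contract (Form k A) f (nabla.toForm e) := by
        intro e
        change contract (Form k A) f ((ExteriorAlgebra.ι A).rTensor E (nabla.toAddMonoidHom e)) * w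
          = sgn w * contract (Form k A) f ((ExteriorAlgebra.ι A).rTensor E (nabla.toAddMonoidHom e))
        induction nabla.toAddMonoidHom e using TensorProduct.induction_on with
        | zero => simp
        | add x y hx hy => rw [map_add, map_add, add_mul, mul_add, hx, hy]
        | tmul z e =>
          rw [LinearMap.rTensor_tmul, contract_tmul, smul_mul_assoc, mul_smul_comm, ι_mul_comm]
      ext e
      rw [bracket_apply, LinearMap.add_apply, LinearMap.comp_apply, hs]
      rw [rankOne, formExtend_smulRight, LinearMap.smulRight_apply, extend_smul_ring,
        extend_tmul, TensorProduct.smul_tmul', TensorProduct.smul_tmul', smul_eq_mul, smul_eq_mul,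
        hc]
      simp only [LinearMap.add_apply, LinearMap.comp_apply, LinearMap.flip_apply,
        TensorProduct.mk_apply, LinearMap.smulRight_apply, dualApply, LinearMap.coe_mk,
        AddHom.coe_mk, rankOne_apply, smul_add, smul_sub, TensorProduct.smul_tmul', smul_eq_mul,
        TensorProduct.sub_tmul]
      rw [dOne, ι_mul_comm, smul_comm (f e) (sgn w)]
      abel
    rw [key, map_add, coeffTrace_rankOne, coeffTrace_rTensor_comp, map_add, coeffTrace_tmul_right,
      coeffTrace_smulRight, coeffTrace_rankOne, extD_smul]
    change f x • extD k A w + sgn w * (dOne (f x) - contract (Form k A) f (nabla.toForm x) +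
      contract (Form k A) f (nabla.toForm x)) = _
    -- The contraction f(∇x) cancels between the dual connection and ∇x, leaving f(x) dw ± w
    -- d(f(x)), which is d(f(x) w).
    rw [sub_add_cancel, dOne, ι_mul_comm, add_comm]

/-- The forms `tr (R ^ n)` are closed. -/
theorem extD_traceForm (n : ℕ) : extD k A (nabla.traceForm n) = 0 := by
  rw [traceForm, ← coeffTrace_bracket]
  -- The Bianchi identity: ∇ commutes with every power of its own square.
  have h : nabla.bracket (nabla.curvaturePow n) = 0 := by
    have hc : formExtend (nabla.curvaturePow n) = nabla.curvature ^ n := by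
      ext e
      exact one_smul (Form k A) _
    have hcomm : ∀ m, nabla.extend ((nabla.curvature ^ n) m) =
        (nabla.curvature ^ n) (nabla.extend m) := by
      induction n with
      | zero => simp
      | succ n ih =>
        intro m
        have hc : formExtend (nabla.curvaturePow n) = nabla.curvature ^ n := by
          ext e
          exact one_smul (Form k A) _
        rw [pow_succ, Module.End.mul_apply, Module.End.mul_apply, ih hc]
        rfl
    ext e
    rw [bracket_apply, hc, ← extend_one_tmul, ← hcomm]
    exact sub_self _
  rw [h, map_zero]

end Connection

/-! ### Even and odd operators and their traces -/

section Operators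

theorem addEnd_add_apply {M : Type*} [AddCommGroup M] (S T : AddMonoid.End M) (m : M) :
    (S + T) m = S m + T m := rfl

theorem addEnd_mul_apply {M : Type*} [AddCommGroup M] (S T : AddMonoid.End M) (m : M) :
    (S * T) m = S (T m) := rfl

variable {k A : Type*} [CommRing k] [CommRing A] [Algebra k A]
variable {E : Type*} [AddCommGroup E] [Module A E]

variable (k A E) in
/-- The operators on `Ω ⊗ E` that are linear over forms. -/
def evenOps : AddSubgroup (AddMonoid.End (Form k A ⊗[A] E)) where
  carrier := {T | ∀ (w : Form k A) m, T (w • m) = w • T m}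
  zero_mem' w m := (smul_zero w).symm
  add_mem' {S T} hS hT w m := by
    rw [addEnd_add_apply, addEnd_add_apply, hS, hT, smul_add]
  neg_mem' {T} hT w m := by
    change -(T (w • m)) = w • -(T m)
    rw [hT, smul_neg]

variable (k A E) in
/-- The operators on `Ω ⊗ E` that are linear over forms up to the sign of odd operators. -/
def oddOps : AddSubgroup (AddMonoid.End (Form k A ⊗[A] E)) where
  carrier := {T | ∀ (w : Form k A) m, T (w • m) = sgn w • T m}
  zero_mem' w m := (smul_zero _).symm
  add_mem' {S T} hS hT w m := by
    rw [addEnd_add_apply, addEnd_add_apply, hS, hT, smul_add]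
  neg_mem' {T} hT w m := by
    change -(T (w • m)) = _ • -(T m)
    rw [hT, smul_neg]

theorem mul_mem_evenOps {S T : AddMonoid.End (Form k A ⊗[A] E)} (hS : S ∈ evenOps k A E)
    (hT : T ∈ evenOps k A E) : S * T ∈ evenOps k A E := fun w m => by
  rw [addEnd_mul_apply, addEnd_mul_apply, hT, hS]

theorem mul_mem_oddOps {S T : AddMonoid.End (Form k A ⊗[A] E)} (hS : S ∈ evenOps k A E)
    (hT : T ∈ oddOps k A E) : S * T ∈ oddOps k A E := fun w m => by
  rw [addEnd_mul_apply, addEnd_mul_apply, hT, hS]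

theorem mul_mem_oddOps' {S T : AddMonoid.End (Form k A ⊗[A] E)} (hS : S ∈ oddOps k A E)
    (hT : T ∈ evenOps k A E) : S * T ∈ oddOps k A E := fun w m => by
  rw [addEnd_mul_apply, addEnd_mul_apply, hT, hS]

theorem mul_odd_mem_evenOps {S T : AddMonoid.End (Form k A ⊗[A] E)} (hS : S ∈ oddOps k A E)
    (hT : T ∈ oddOps k A E) : S * T ∈ evenOps k A E := fun w m => by
  rw [addEnd_mul_apply, addEnd_mul_apply, hT, hS, sgn_sgn]

/-- The extension of a connection to forms, as an element of the ring of additive operators. -/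
noncomputable def Connection.extendOp (nabla : Connection k A E) :
    AddMonoid.End (Form k A ⊗[A] E) := nabla.extend

theorem Connection.extendOp_apply (nabla : Connection k A E) (m : Form k A ⊗[A] E) :
    nabla.extendOp m = nabla.extend m := rfl

/-- The two terms in which d hits w carry d(sgn w) and sgn(dw); these are opposite and cancel. -/
theorem Connection.anticomm_mem_evenOps (nabla : Connection k A E)
    {S : AddMonoid.End (Form k A ⊗[A] E)} (hS : S ∈ oddOps k A E) :
    nabla.extendOp * S + S * nabla.extendOp ∈ evenOps k A E := fun w m => by
  have hS' : ∀ (w : Form k A) m, S (w • m) = sgn w • S m := hS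
  rw [addEnd_add_apply, addEnd_add_apply, addEnd_mul_apply,
    addEnd_mul_apply, addEnd_mul_apply, addEnd_mul_apply,
    extendOp_apply, extendOp_apply, extendOp_apply, extendOp_apply, hS',
    Connection.extend_smul, Connection.extend_smul, map_add, hS', hS', sgn_sgn, extD_sgn,
    smul_add, add_add_add_comm, ← add_assoc, ← add_smul, neg_add_cancel, zero_smul, zero_add]

section Trace

variable [Module.Finite A E] [Module.Projective A E]

/-- An operator that is linear over `A` has trace `w`. -/
def HasTrace (T : AddMonoid.End (Form k A ⊗[A] E)) (w : Form k A) : Prop :=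
  ∃ u : E →ₗ[A] Form k A ⊗[A] E, (∀ e, u e = T (1 ⊗ₜ e)) ∧ coeffTrace A E _ u = w

/-- The trace is a relation since a general additive operator, such as ∇ itself, has none; where it
exists, the values on 1 ⊗ e determine it. -/
theorem HasTrace.unique {T : AddMonoid.End (Form k A ⊗[A] E)} {w z : Form k A}
    (hw : HasTrace T w) (hz : HasTrace T z) : w = z := by
  obtain ⟨u, hu, rfl⟩ := hw
  obtain ⟨v, hv, rfl⟩ := hz
  congr 1
  ext e
  rw [hu, hv]

theorem HasTrace.add {S T : AddMonoid.End (Form k A ⊗[A] E)} {w z : Form k A}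
    (hw : HasTrace S w) (hz : HasTrace T z) : HasTrace (S + T) (w + z) := by
  obtain ⟨u, hu, rfl⟩ := hw
  obtain ⟨v, hv, rfl⟩ := hz
  exact ⟨u + v, fun e => by rw [LinearMap.add_apply, hu, hv]; rfl, map_add _ _ _⟩

theorem HasTrace.sub {S T : AddMonoid.End (Form k A ⊗[A] E)} {w z : Form k A}
    (hw : HasTrace S w) (hz : HasTrace T z) : HasTrace (S - T) (w - z) := by
  obtain ⟨u, hu, rfl⟩ := hw
  obtain ⟨v, hv, rfl⟩ := hz
  exact ⟨u - v, fun e => by rw [LinearMap.sub_apply, hu, hv]; rfl,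
    eq_sub_of_add_eq ((map_add _ _ _).symm.trans
      (congrArg _ (LinearMap.ext fun e => sub_add_cancel (u e) (v e))))⟩

theorem HasTrace.sum {ι : Type*} (s : Finset ι) {T : ι → AddMonoid.End (Form k A ⊗[A] E)}
    {w : ι → Form k A} (h : ∀ i ∈ s, HasTrace (T i) (w i)) :
    HasTrace (∑ i ∈ s, T i) (∑ i ∈ s, w i) := by
  classical
  induction s using Finset.induction_on with
  | empty => exact ⟨0, fun e => rfl, map_zero _⟩
  | insert a s ha ih =>
    rw [Finset.sum_insert ha, Finset.sum_insert ha]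
    exact (h a (Finset.mem_insert_self a s)).add
      (ih fun i hi => h i (Finset.mem_insert_of_mem hi))

theorem exists_hasTrace {T : AddMonoid.End (Form k A ⊗[A] E)}
    (hT : ∀ (a : A) m, T (a • m) = a • T m) : ∃ w, HasTrace T w :=
  ⟨_, { toFun := fun e => T (1 ⊗ₜ e)
        map_add' := fun x y => by rw [TensorProduct.tmul_add, map_add]
        map_smul' := fun a x => by rw [TensorProduct.tmul_smul, hT]; rfl }, fun _ => rfl, rfl⟩

theorem exists_hasTrace_of_mem_evenOps {T : AddMonoid.End (Form k A ⊗[A] E)}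
    (hT : T ∈ evenOps k A E) : ∃ w, HasTrace T w :=
  exists_hasTrace fun a m => by
    rw [← algebraMap_smul (Form k A) a m, ← algebraMap_smul (Form k A) a (T m)]
    exact hT _ _

theorem exists_hasTrace_of_mem_oddOps {T : AddMonoid.End (Form k A ⊗[A] E)}
    (hT : T ∈ oddOps k A E) : ∃ w, HasTrace T w :=
  exists_hasTrace fun a m => by
    rw [← algebraMap_smul (Form k A) a m, ← algebraMap_smul (Form k A) a (T m)]
    refine (hT _ _).trans ?_
    rw [AlgHom.commutes sgn]

/-- The trace of the supercommutator with a connection is exact. -/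
theorem Connection.hasTrace_anticomm (nabla : Connection k A E)
    {S : AddMonoid.End (Form k A ⊗[A] E)} (hS : S ∈ oddOps k A E) {w : Form k A}
    (hw : HasTrace S w) : HasTrace (nabla.extendOp * S + S * nabla.extendOp) (extD k A w) := by
  obtain ⟨u, hu, rfl⟩ := hw
  refine ⟨nabla.bracket u, fun e => ?_, nabla.coeffTrace_bracket u⟩
  have hS' : ∀ (w : Form k A) m, S (w • m) = sgn w • S m := hS
  -- An odd operator differs from the sign-free extension of its restriction by the grading
  -- involution. As ∇e has degree one, this turns the minus sign of `bracket` into the plus sign of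
  -- the anticommutator.
  have key : ∀ m, S (sgnTensor k A E m) = formExtend u m := by
    intro m
    induction m using TensorProduct.induction_on with
    | zero => simp
    | add x y hx hy => rw [map_add (sgnTensor k A E), map_add S, map_add (formExtend u), hx, hy]
    | tmul z e =>
      have : z ⊗ₜ[A] e = z • ((1 : Form k A) ⊗ₜ[A] e) := by
        rw [TensorProduct.smul_tmul', smul_eq_mul, mul_one]
      rw [formExtend_tmul, this, sgnTensor_smul, hS', sgn_sgn, hu, sgnTensor_tmul, map_one sgn]
  rw [bracket_apply, ← key, sgnTensor_toForm, map_neg S, sub_neg_eq_add, hu,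
    ← nabla.extend_one_tmul]
  rfl

end Trace

end Operators

/-! ### Transgression along the line through two connections -/

section Homotopy

open Polynomial

variable {k A : Type*} [CommRing k] [CommRing A] [Algebra k A]
variable {E : Type*} [AddCommGroup E] [Module A E]

theorem coeff_mul_mem {R : Type*} [Ring R] {S T U : AddSubgroup R}
    (h : ∀ x ∈ S, ∀ y ∈ T, x * y ∈ U) {p q : R[X]} (hp : ∀ i, p.coeff i ∈ S)
    (hq : ∀ i, q.coeff i ∈ T) (i : ℕ) : (p * q).coeff i ∈ U := by
  rw [coeff_mul]
  exact AddSubgroup.sum_mem _ fun x _ => h _ (hp _) _ (hq _)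

/-- A primitive of the supercommutator form of the derivative of the `n`-th power of `d ^ 2`. -/
noncomputable def powHomotopy {R : Type*} [Semiring R] (d a : R[X]) : ℕ → R[X]
  | 0 => 0
  | n + 1 => powHomotopy d a n * (d * d) + (d * d) ^ n * a

/-- With d' for the derivative, the homotopy is Σ_{i<n} (d²)^i d' (d²)^(n−1−i). The identity follows
from (d²)' = d d' + d' d, since d commutes with powers of d². -/
theorem derivative_sq_pow {R : Type*} [Semiring R] (d : R[X]) (n : ℕ) :
    derivative ((d * d) ^ n) =
      d * powHomotopy d (derivative d) n + powHomotopy d (derivative d) n * d := by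
  induction n with
  | zero => simp [powHomotopy]
  | succ n ih =>
    have hc : (d * d) ^ n * d = d * (d * d) ^ n :=
      (((Commute.refl d).mul_left (Commute.refl d)).pow_left n).eq
    rw [pow_succ, derivative_mul, ih, derivative_mul, powHomotopy, mul_add, add_mul, mul_add,
      add_mul]
    have h1 : (d * d) ^ n * (d * derivative d) = d * ((d * d) ^ n * derivative d) := by
      rw [← mul_assoc, hc, mul_assoc]
    rw [h1]
    simp only [mul_assoc]
    abel

variable (nabla nabla' : Connection k A E)

theorem sub_mul_add_mul_sub {R : Type*} [Ring R] (a b s : R) :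
    (a - b) * s + s * (a - b) = a * s + s * a - (b * s + s * b) := by
  noncomm_ring

/-- The terms with dw are the same for all connections and drop out of the difference. -/
theorem Connection.sub_mem_oddOps : nabla'.extendOp - nabla.extendOp ∈ oddOps k A E := fun w m => by
  change nabla'.extend (w • m) - nabla.extend (w • m) =
    sgn w • (nabla'.extend m - nabla.extend m)
  rw [Connection.extend_smul, Connection.extend_smul, smul_sub]
  abel

/-- The line through two connections. -/
noncomputable def Connection.line : (AddMonoid.End (Form k A ⊗[A] E))[X] :=
  C nabla.extendOp +
    X * C (nabla'.extendOp - nabla.extendOp)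

theorem Connection.derivative_line : derivative (nabla.line nabla') =
    C (nabla'.extendOp - nabla.extendOp) := by
  rw [line, derivative_add, derivative_C, derivative_mul, derivative_X, derivative_C]
  simp

/-- The square of ∇ + t a is ∇² + t(∇a + a∇) + t² a²; each coefficient is linear over forms although
∇ is not. -/
theorem Connection.coeff_line_sq_mem (i : ℕ) :
    (nabla.line nabla' * nabla.line nabla').coeff i ∈ evenOps k A E := by
  set a : AddMonoid.End (Form k A ⊗[A] E) :=
    nabla'.extendOp - nabla.extendOp with ha
  set d : AddMonoid.End (Form k A ⊗[A] E) := nabla.extendOp with hd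
  have ha' : a ∈ oddOps k A E := nabla.sub_mem_oddOps nabla'
  have h : nabla.line nabla' * nabla.line nabla' =
      C (d * d) + C (d * a + a * d) * X + C (a * a) * X ^ 2 := by
    rw [line, ← ha, ← hd, X_mul_C, C_mul, C_mul, C_add, C_mul, C_mul]
    simp only [mul_add, add_mul, pow_two]
    have h1 : C a * X * C d = C a * C d * X := by rw [mul_assoc, X_mul_C, mul_assoc]
    have h2 : C a * X * (C a * X) = C a * C a * (X * X) := by
      rw [mul_assoc, ← mul_assoc X, X_mul_C, mul_assoc, mul_assoc]
    rw [h1, h2, ← mul_assoc]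
    abel
  rw [h, coeff_add, coeff_add, coeff_C, coeff_C_mul_X, coeff_C_mul_X_pow]
  refine add_mem (add_mem ?_ ?_) ?_
  · split_ifs
    · exact fun w m => nabla.curvature.map_smul w m
    · exact zero_mem _
  · split_ifs
    · exact nabla.anticomm_mem_evenOps ha'
    · exact zero_mem _
  · split_ifs
    · exact mul_odd_mem_evenOps ha' ha'
    · exact zero_mem _

theorem Connection.coeff_line_sq_pow_mem (n i : ℕ) :
    ((nabla.line nabla' * nabla.line nabla') ^ n).coeff i ∈ evenOps k A E := by
  induction n generalizing i with
  | zero =>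
    rw [pow_zero, coeff_one]
    split_ifs
    · exact fun w m => rfl
    · exact zero_mem _
  | succ n ih =>
    rw [pow_succ]
    exact coeff_mul_mem (fun _ hx _ hy => mul_mem_evenOps hx hy) ih
      (nabla.coeff_line_sq_mem nabla') i

theorem Connection.coeff_powHomotopy_mem (n i : ℕ) :
    (powHomotopy (nabla.line nabla') (derivative (nabla.line nabla')) n).coeff i ∈
      oddOps k A E := by
  induction n generalizing i with
  | zero => rw [powHomotopy, coeff_zero]; exact zero_mem _
  | succ n ih =>
    rw [powHomotopy, coeff_add]
    refine add_mem (coeff_mul_mem (fun _ hx _ hy => mul_mem_oddOps' hx hy) ih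
      (nabla.coeff_line_sq_mem nabla') i) ?_
    refine coeff_mul_mem (fun _ hx _ hy => mul_mem_oddOps hx hy)
      (nabla.coeff_line_sq_pow_mem nabla' n) (fun j => ?_) i
    rw [derivative_line, coeff_C]
    split_ifs
    · exact nabla.sub_mem_oddOps nabla'
    · exact zero_mem _

variable [Module.Finite A E] [Module.Projective A E]

theorem Connection.hasTrace_curvature_pow (n : ℕ) :
    HasTrace ((nabla.extendOp * nabla.extendOp) ^ n)
      (nabla.traceForm n) := by
  refine ⟨nabla.curvaturePow n, fun e => ?_, rfl⟩
  change (nabla.curvature ^ n) (1 ⊗ₜ e) = _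
  generalize (1 : Form k A) ⊗ₜ[A] e = m
  induction n with
  | zero => rfl
  | succ n ih => rw [pow_succ', pow_succ', Module.End.mul_apply, ih]; rfl

/-- The coefficient of t^j in `derivative_sq_pow` gives j + 1 times the coefficient of t^(j+1) in
(D²)ⁿ on one side. On the other, the constant part ∇ of the line contributes d tr(S_j), and the part
t a contributes nothing to the trace. Division by j + 1 is postponed, so no assumption on the
characteristic is needed yet. -/
theorem Connection.hasTrace_line_coeff (n j : ℕ) : ∃ w z : Form k A,
    HasTrace (((nabla.line nabla' * nabla.line nabla') ^ n).coeff (j + 1)) w ∧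
      ((j + 1 : ℕ) : Form k A) * w = extD k A z := by
  set a : AddMonoid.End (Form k A ⊗[A] E) :=
    nabla'.extendOp - nabla.extendOp with ha
  set S := powHomotopy (nabla.line nabla') (derivative (nabla.line nabla')) n with hS
  have hSmem : ∀ i, S.coeff i ∈ oddOps k A E := nabla.coeff_powHomotopy_mem nabla' n
  obtain ⟨w, hw⟩ := exists_hasTrace_of_mem_evenOps (nabla.coeff_line_sq_pow_mem nabla' n (j + 1))
  obtain ⟨z, hz⟩ := exists_hasTrace_of_mem_oddOps (hSmem j)
  refine ⟨w, z, hw, ?_⟩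
  -- a is a difference of connections, and the supercommutator of either one with the same odd
  -- operator has the same trace d tr(S).
  have h0 : HasTrace ((X * C a * S + S * (X * C a)).coeff j) 0 := by
    have hX : X * C a * S + S * (X * C a) = X * (C a * S + S * C a) := by
      rw [mul_add, mul_assoc, ← mul_assoc S, ← X_mul, mul_assoc]
    rw [hX]
    cases j with
    | zero => rw [coeff_X_mul_zero]; exact ⟨0, fun e => rfl, map_zero _⟩
    | succ j =>
      rw [coeff_X_mul, coeff_add, coeff_C_mul, coeff_mul_C]
      obtain ⟨y, hy⟩ := exists_hasTrace_of_mem_oddOps (hSmem j)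
      have h := (nabla'.hasTrace_anticomm (hSmem j) hy).sub (nabla.hasTrace_anticomm (hSmem j) hy)
      rw [sub_self] at h
      convert h using 1
      exact sub_mul_add_mul_sub _ _ _
  have hcoeff : (derivative ((nabla.line nabla' * nabla.line nabla') ^ n)).coeff j =
      (nabla.line nabla' * S + S * nabla.line nabla').coeff j :=
    congrArg (fun p => p.coeff j) (derivative_sq_pow (nabla.line nabla') n)
  have hsplit : nabla.line nabla' * S + S * nabla.line nabla' =
      (C nabla.extendOp * S + S * C nabla.extendOp) +
        (X * C a * S + S * (X * C a)) := by
    rw [line, ← ha, add_mul, mul_add]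
    abel
  rw [hsplit, coeff_derivative, coeff_add, coeff_add, coeff_C_mul, coeff_mul_C] at hcoeff
  have h1 := (nabla.hasTrace_anticomm (hSmem j) hz).add h0
  rw [← hcoeff, add_zero] at h1
  refine HasTrace.unique ?_ h1
  obtain ⟨u, hu, rfl⟩ := hw
  refine ⟨(j + 1) • u, fun e => ?_, ?_⟩
  · rw [LinearMap.smul_apply, hu, ← Nat.cast_succ, ← nsmul_eq_mul']
    rfl
  · rw [map_nsmul, nsmul_eq_mul]

theorem HasTrace.congr {T T' : AddMonoid.End (Form k A ⊗[A] E)} {w : Form k A}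
    (h : HasTrace T w) (hT : T = T') : HasTrace T' w := hT ▸ h

end Homotopy

/-! ### Independence of the connection in characteristic zero -/

section Independence

open Polynomial

variable {k A : Type*} [Field k] [CharZero k] [CommRing A] [Algebra k A]
variable {E : Type*} [AddCommGroup E] [Module A E] [Module.Finite A E] [Module.Projective A E]

/-- The class of `tr (R ^ n)` does not depend on the connection. -/
theorem Connection.traceForm_sub_exact (nabla nabla' : Connection k A E) (n : ℕ) :
    ∃ z, nabla'.traceForm n - nabla.traceForm n = extD k A z := by
  set P := (nabla.line nabla' * nabla.line nabla') ^ n with hP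
  choose w z hw hz using nabla.hasTrace_line_coeff nabla' n
  have hline (R : (AddMonoid.End (Form k A ⊗[A] E))[X] →+* AddMonoid.End (Form k A ⊗[A] E))
      (d : AddMonoid.End (Form k A ⊗[A] E)) (h : R (nabla.line nabla') = d) : R P = (d * d) ^ n := by
    rw [hP, map_pow, map_mul, h]
  -- Setting t = 0 gives the first connection; setting t = 1, that is, summing the coefficients,
  -- gives the second.
  have h0 : P.coeff 0 =
      (nabla.extendOp * nabla.extendOp) ^ n := by
    refine hline constantCoeff _ ?_
    rw [constantCoeff_apply, line, coeff_add, coeff_C_zero, coeff_X_mul_zero, add_zero]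
  have h1 : ∑ i ∈ Finset.range (P.natDegree + 1), P.coeff i =
      (nabla'.extendOp * nabla'.extendOp) ^ n := by
    have h := hline (eval₂RingHom' (RingHom.id _) 1 fun a => Commute.one_right a) nabla'.extendOp (by
      change eval₂ _ _ (nabla.line nabla') = _
      rw [line, eval₂_add, eval₂_C, X_mul_C, eval₂_mul_X, eval₂_C]
      simp only [RingHom.id_apply, mul_one]
      exact add_sub_cancel nabla.extendOp nabla'.extendOp)
    rw [← h]
    change _ = eval₂ (RingHom.id _) 1 P
    rw [eval₂_eq_sum_range]
    simp
  have h2 := (HasTrace.sum (Finset.range P.natDegree) fun j _ => hw j).add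
    ((nabla.hasTrace_curvature_pow n).congr h0.symm)
  rw [← Finset.sum_range_succ' (fun i => P.coeff i), h1] at h2
  have h3 := (nabla'.hasTrace_curvature_pow n).unique h2
  -- The j-th trace `w j` belongs to t^(j+1) and satisfies (j + 1) w_j = d z_j, so z_j/(j + 1) is a
  -- primitive of it.
  refine ⟨∑ j ∈ Finset.range P.natDegree, ((j + 1 : ℕ) : k)⁻¹ • z j, ?_⟩
  rw [h3, add_sub_cancel_right, map_sum]
  refine Finset.sum_congr rfl fun j _ => ?_
  have hj : ((j + 1 : ℕ) : k) ≠ 0 := Nat.cast_ne_zero.mpr (Nat.succ_ne_zero j)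
  rw [map_smul, ← hz, ← nsmul_eq_mul, ← Nat.cast_smul_eq_nsmul k, smul_smul, inv_mul_cancel₀ hj,
    one_smul]

end Independence

/-! ### Parallel maps, transport, direct sums and the unit -/

section Parallel

variable {k A : Type*} [CommRing k] [CommRing A] [Algebra k A]
variable {E F : Type*} [AddCommGroup E] [Module A E] [AddCommGroup F] [Module A F]

/-- A map is parallel if it commutes with the connections. -/
def Connection.IsParallel (nabla : Connection k A E) (nabla' : Connection k A F)
    (h : E →ₗ[A] F) : Prop :=
  ∀ e, nabla'.toAddMonoidHom (h e) = h.lTensor _ (nabla.toAddMonoidHom e)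

variable {nabla : Connection k A E} {nabla' : Connection k A F} {h : E →ₗ[A] F}

theorem lTensor_form_smul (h : E →ₗ[A] F) (w : Form k A) (m : Form k A ⊗[A] E) :
    h.lTensor (Form k A) (w • m) = w • h.lTensor (Form k A) m := by
  induction m using TensorProduct.induction_on with
  | zero => simp
  | add x y hx hy => rw [smul_add, map_add, map_add, hx, hy, smul_add]
  | tmul z e => rfl

theorem Connection.IsParallel.toForm (H : nabla.IsParallel nabla' h) (e : E) :
    nabla'.toForm (h e) = h.lTensor _ (nabla.toForm e) := by
  change (ExteriorAlgebra.ι A).rTensor F (nabla'.toAddMonoidHom (h e)) =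
    h.lTensor _ ((ExteriorAlgebra.ι A).rTensor E (nabla.toAddMonoidHom e))
  rw [H e, ← LinearMap.comp_apply, ← LinearMap.comp_apply, LinearMap.rTensor_comp_lTensor,
    LinearMap.lTensor_comp_rTensor]

theorem Connection.IsParallel.extend (H : nabla.IsParallel nabla' h) (m : Form k A ⊗[A] E) :
    nabla'.extend (h.lTensor _ m) = h.lTensor _ (nabla.extend m) := by
  induction m using TensorProduct.induction_on with
  | zero => simp
  | add x y hx hy => simp only [map_add, hx, hy]
  | tmul z e =>
    rw [LinearMap.lTensor_tmul, extend_tmul, extend_tmul, map_add, LinearMap.lTensor_tmul, H.toForm,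
      lTensor_form_smul]

/-- A parallel map commutes with the extended connections, hence with their squares. Together with
cyclicity of the trace this handles both transport and direct sums. -/
theorem Connection.IsParallel.curvaturePow (H : nabla.IsParallel nabla' h) (n : ℕ) :
    nabla'.curvaturePow n ∘ₗ h = h.lTensor _ ∘ₗ nabla.curvaturePow n := by
  ext e
  change (nabla'.curvature ^ n) (h.lTensor _ (1 ⊗ₜ e)) =
    h.lTensor _ ((nabla.curvature ^ n) (1 ⊗ₜ e))
  generalize (1 : Form k A) ⊗ₜ[A] e = m
  induction n generalizing m with
  | zero => rfl
  | succ n ih =>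
    rw [pow_succ, pow_succ, Module.End.mul_apply, Module.End.mul_apply, ← ih, curvature_apply,
      curvature_apply, H.extend, H.extend]

variable (nabla nabla')

/-- Transport of a connection along an isomorphism. -/
noncomputable def Connection.transport (f : E ≃ₗ[A] F) : Connection k A F where
  toAddMonoidHom := (f.toLinearMap.lTensor (Ω[A⁄k])).toAddMonoidHom.comp
    (nabla.toAddMonoidHom.comp f.symm.toLinearMap.toAddMonoidHom)
  leibniz a e := by
    simp [nabla.leibniz]

theorem Connection.isParallel_transport (f : E ≃ₗ[A] F) :
    nabla.IsParallel (nabla.transport f) f.toLinearMap := fun e => by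
  simp [transport]

/-- The direct sum of connections. -/
noncomputable def Connection.prod : Connection k A (E × F) where
  toAddMonoidHom := ((LinearMap.inl A E F).lTensor (Ω[A⁄k])).toAddMonoidHom.comp
      (nabla.toAddMonoidHom.comp (LinearMap.fst A E F).toAddMonoidHom) +
    ((LinearMap.inr A E F).lTensor (Ω[A⁄k])).toAddMonoidHom.comp
      (nabla'.toAddMonoidHom.comp (LinearMap.snd A E F).toAddMonoidHom)
  leibniz a e := by
    have : e = (e.1, 0) + (0, e.2) := by simp
    conv_rhs => rw [this, TensorProduct.tmul_add, ← this]
    simp [nabla.leibniz, nabla'.leibniz]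
    abel

theorem Connection.isParallel_inl :
    nabla.IsParallel (nabla.prod nabla') (LinearMap.inl A E F) := fun e => by
  simp [prod]

theorem Connection.isParallel_inr :
    nabla'.IsParallel (nabla.prod nabla') (LinearMap.inr A E F) := fun e => by
  simp [prod]

variable (A) in
/-- The connection `d` on `A`. -/
noncomputable def Connection.unit (k : Type*) [CommRing k] [Algebra k A] : Connection k A A where
  toAddMonoidHom := (TensorProduct.rid A (Ω[A⁄k])).symm.toLinearMap.toAddMonoidHom.comp
    (KaehlerDifferential.D k A).toLinearMap.toAddMonoidHom
  leibniz a e := by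
    simp [TensorProduct.add_tmul, TensorProduct.smul_tmul']
    rw [TensorProduct.smul_tmul, smul_eq_mul, mul_one]

variable [Module.Finite A E] [Module.Projective A E] [Module.Finite A F] [Module.Projective A F]

theorem Connection.traceForm_transport (f : E ≃ₗ[A] F) (n : ℕ) :
    (nabla.transport f).traceForm n = nabla.traceForm n := by
  have h := (nabla.isParallel_transport f).curvaturePow n
  have h1 : (nabla.transport f).curvaturePow n =
      f.toLinearMap.lTensor _ ∘ₗ (nabla.curvaturePow n ∘ₗ f.symm.toLinearMap) := by
    rw [← LinearMap.comp_assoc, ← h]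
    ext; simp
  rw [traceForm, h1, ← coeffTrace_comp, traceForm]
  congr 1
  ext; simp

/-- Both inclusions are parallel, so the curvature powers are block diagonal; cyclicity then removes
inclusions and projections. -/
theorem Connection.traceForm_prod (n : ℕ) :
    (nabla.prod nabla').traceForm n = nabla.traceForm n + nabla'.traceForm n := by
  have h1 : (nabla.prod nabla').curvaturePow n =
      (LinearMap.inl A E F).lTensor _ ∘ₗ (nabla.curvaturePow n ∘ₗ LinearMap.fst A E F) +
      (LinearMap.inr A E F).lTensor _ ∘ₗ (nabla'.curvaturePow n ∘ₗ LinearMap.snd A E F) := by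
    rw [← LinearMap.comp_assoc, ← LinearMap.comp_assoc,
      ← (nabla.isParallel_inl nabla').curvaturePow n,
      ← (nabla.isParallel_inr nabla').curvaturePow n]
    refine LinearMap.ext fun e => ?_
    rw [LinearMap.add_apply]
    simp only [LinearMap.comp_apply]
    rw [← map_add]
    simp
  rw [traceForm, h1, map_add, ← coeffTrace_comp, ← coeffTrace_comp, traceForm, traceForm]
  rfl

theorem Connection.traceForm_zero_unit : (Connection.unit A k).traceForm 0 = 1 := by
  have : (Connection.unit A k).curvaturePow 0 = rankOne 1 LinearMap.id 1 := by
    ext; simp [curvaturePow, rankOne_apply]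
  rw [traceForm, this, coeffTrace_rankOne]
  simp

theorem Connection.traceForm_succ_unit (n : ℕ) : (Connection.unit A k).traceForm (n + 1) = 0 := by
  have : (Connection.unit A k).curvaturePow (n + 1) = 0 := by
    ext
    change ((Connection.unit A k).curvature ^ (n + 1)) (1 ⊗ₜ 1) = 0
    rw [pow_succ, Module.End.mul_apply, curvature_apply]
    have : (Connection.unit A k).extend (1 ⊗ₜ[A] 1) = 0 := by
      rw [extend_one_tmul]
      simp [toForm, unit]
    rw [this]
    simp
  rw [traceForm, this, map_zero]

end Parallel

/-! ### Tensor products of connections -/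

section Tensor

variable {k A : Type*} [CommRing k] [CommRing A] [Algebra k A]
variable {E F : Type*} [AddCommGroup E] [Module A E] [AddCommGroup F] [Module A F]
variable (nabla : Connection k A E) (nabla' : Connection k A F)

/-- The underlying map of the tensor product of connections. -/
noncomputable def Connection.tensorHom : E ⊗[A] F →+ Ω[A⁄k] ⊗[A] (E ⊗[A] F) :=
  TensorProduct.liftAddHom
    { toFun := fun e =>
        { toFun := fun f => TensorProduct.assoc A _ E F (nabla.toAddMonoidHom e ⊗ₜ[A] f) +
            TensorProduct.leftComm A E _ F (e ⊗ₜ[A] nabla'.toAddMonoidHom f)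
          map_zero' := by simp
          map_add' := fun x y => by
            simp only [map_add, TensorProduct.tmul_add]
            abel }
      map_zero' := by ext; simp
      map_add' := fun x y => by
        ext f
        simp only [map_add, TensorProduct.add_tmul, AddMonoidHom.coe_mk, ZeroHom.coe_mk,
          AddMonoidHom.add_apply]
        abel }
    -- Neither ∇ ⊗ 1 nor 1 ⊗ ∇' is balanced over `A`, but their sum is: the term da ⊗ e ⊗ f occurs
    -- once on either side.
    (fun a e f => by
      simp only [AddMonoidHom.coe_mk, ZeroHom.coe_mk, nabla.leibniz, nabla'.leibniz,
        TensorProduct.add_tmul, TensorProduct.tmul_add, map_add, TensorProduct.assoc_tmul,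
        TensorProduct.leftComm_tmul, TensorProduct.smul_tmul]
      abel)

theorem Connection.tensorHom_tmul (e : E) (f : F) :
    nabla.tensorHom nabla' (e ⊗ₜ f) =
      TensorProduct.assoc A _ E F (nabla.toAddMonoidHom e ⊗ₜ[A] f) +
        TensorProduct.leftComm A E _ F (e ⊗ₜ[A] nabla'.toAddMonoidHom f) := rfl

theorem Connection.tensorHom_smul (a : A) (t : E ⊗[A] F) : nabla.tensorHom nabla' (a • t) =
    a • nabla.tensorHom nabla' t + KaehlerDifferential.D k A a ⊗ₜ[A] t := by
  induction t using TensorProduct.induction_on with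
  | zero => simp
  | add x y hx hy =>
    rw [smul_add, map_add, hx, hy, map_add, TensorProduct.tmul_add, smul_add, add_add_add_comm]
  | tmul e f =>
    rw [TensorProduct.smul_tmul', tensorHom_tmul, tensorHom_tmul, nabla.leibniz,
      TensorProduct.add_tmul, map_add, TensorProduct.assoc_tmul, smul_add,
      ← TensorProduct.smul_tmul', ← TensorProduct.smul_tmul', map_smul, map_smul, add_right_comm]

/-- The tensor product of connections. -/
noncomputable def Connection.tensor : Connection k A (E ⊗[A] F) where
  toAddMonoidHom := nabla.tensorHom nabla'
  leibniz := nabla.tensorHom_smul nabla'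

theorem Connection.tensor_toForm (e : E) (f : F) :
    (nabla.tensor nabla').toForm (e ⊗ₜ f) =
      mulTensor (Form k A) E F (nabla.toForm e ⊗ₜ[A] (1 ⊗ₜ[A] f)) +
        mulTensor (Form k A) E F ((1 ⊗ₜ[A] e) ⊗ₜ[A] nabla'.toForm f) := by
  change (ExteriorAlgebra.ι A).rTensor (E ⊗[A] F) _ = _
  rw [tensor, tensorHom_tmul, map_add]
  congr 1
  · change _ = mulTensor (Form k A) E F
      ((ExteriorAlgebra.ι A).rTensor E (nabla.toAddMonoidHom e) ⊗ₜ[A] (1 ⊗ₜ[A] f))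
    induction nabla.toAddMonoidHom e using TensorProduct.induction_on with
    | zero => simp
    | add x y hx hy => rw [TensorProduct.add_tmul, map_add, map_add, hx, hy, map_add,
        TensorProduct.add_tmul, map_add]
    | tmul x e => simp [mulTensor_tmul]
  · change _ = mulTensor (Form k A) E F
      ((1 ⊗ₜ[A] e) ⊗ₜ[A] (ExteriorAlgebra.ι A).rTensor F (nabla'.toAddMonoidHom f))
    induction nabla'.toAddMonoidHom f using TensorProduct.induction_on with
    | zero => simp
    | add x y hx hy => rw [TensorProduct.tmul_add, map_add, map_add, hx, hy, map_add,
        TensorProduct.tmul_add, map_add]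
    | tmul x e => simp [mulTensor_tmul]

theorem mulTensor_smul_left (w : Form k A) (m : Form k A ⊗[A] E) (n : Form k A ⊗[A] F) :
    mulTensor (Form k A) E F ((w • m) ⊗ₜ[A] n) = w • mulTensor (Form k A) E F (m ⊗ₜ[A] n) := by
  induction m using TensorProduct.induction_on with
  | zero => simp
  | add x y hx hy => rw [smul_add, TensorProduct.add_tmul, map_add, hx, hy, TensorProduct.add_tmul,
      map_add, smul_add]
  | tmul z e =>
    induction n using TensorProduct.induction_on with
    | zero => simp
    | add x y hx hy => rw [TensorProduct.tmul_add, map_add, hx, hy, TensorProduct.tmul_add,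
        map_add, smul_add]
    | tmul x f =>
      rw [TensorProduct.smul_tmul', mulTensor_tmul, mulTensor_tmul, TensorProduct.smul_tmul',
        smul_eq_mul, smul_eq_mul, mul_assoc]

theorem mulTensor_tmul_smul (z w : Form k A) (e : E) (n : Form k A ⊗[A] F) :
    mulTensor (Form k A) E F ((z ⊗ₜ[A] e) ⊗ₜ[A] (w • n)) =
      (z * w) • mulTensor (Form k A) E F ((1 ⊗ₜ[A] e) ⊗ₜ[A] n) := by
  induction n using TensorProduct.induction_on with
  | zero => simp
  | add x y hx hy => rw [smul_add, TensorProduct.tmul_add, map_add, hx, hy, TensorProduct.tmul_add,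
      map_add, smul_add]
  | tmul x f =>
    rw [TensorProduct.smul_tmul', mulTensor_tmul, mulTensor_tmul, TensorProduct.smul_tmul',
      smul_eq_mul, smul_eq_mul, one_mul, mul_assoc]

theorem mulTensor_ι_rTensor (m : Ω[A⁄k] ⊗[A] E) (w : Form k A) (f : F) :
    mulTensor (Form k A) E F ((ExteriorAlgebra.ι A).rTensor E m ⊗ₜ[A] (w ⊗ₜ[A] f)) =
      sgn w • mulTensor (Form k A) E F
        ((ExteriorAlgebra.ι A).rTensor E m ⊗ₜ[A] (1 ⊗ₜ[A] f)) := by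
  induction m using TensorProduct.induction_on with
  | zero => simp
  | add x y hx hy => rw [map_add, TensorProduct.add_tmul, map_add, hx, hy, TensorProduct.add_tmul,
      map_add, smul_add]
  | tmul z e =>
    rw [LinearMap.rTensor_tmul, mulTensor_tmul, mulTensor_tmul, TensorProduct.smul_tmul',
      smul_eq_mul, mul_one, ι_mul_comm]

/-- The graded Leibniz rule: the sign involution on m comes from moving the odd operator ∇' past it.
-/
theorem Connection.extend_mulTensor (m : Form k A ⊗[A] E) (n : Form k A ⊗[A] F) :
    (nabla.tensor nabla').extend (mulTensor (Form k A) E F (m ⊗ₜ[A] n)) =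
      mulTensor (Form k A) E F (nabla.extend m ⊗ₜ[A] n) +
        mulTensor (Form k A) E F (sgnTensor k A E m ⊗ₜ[A] nabla'.extend n) := by
  induction m using TensorProduct.induction_on with
  | zero => simp
  | add x y hx hy =>
    simp only [TensorProduct.add_tmul, map_add, hx, hy]
    abel
  | tmul z e =>
    induction n using TensorProduct.induction_on with
    | zero => simp
    | add x y hx hy =>
      simp only [TensorProduct.tmul_add, map_add, hx, hy]
      abel
    | tmul w f =>
      have h : mulTensor (Form k A) E F (nabla.toForm e ⊗ₜ[A] (w ⊗ₜ[A] f)) =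
        sgn w • mulTensor (Form k A) E F (nabla.toForm e ⊗ₜ[A] (1 ⊗ₜ[A] f)) :=
          mulTensor_ι_rTensor _ _ _
      rw [mulTensor_tmul, extend_tmul, extend_tmul, extend_tmul, tensor_toForm, sgnTensor_tmul,
        TensorProduct.add_tmul, TensorProduct.tmul_add, map_add, map_add, mulTensor_smul_left,
        mulTensor_tmul_smul, mulTensor_tmul, mulTensor_tmul, h, extD_mul, TensorProduct.add_tmul,
        smul_add, map_mul, smul_smul]
      abel

/-- Squaring the graded Leibniz rule produces two mixed terms ∇m ⊗ ∇'n; they have opposite signs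
because ∇ anticommutes with the grading involution. -/
theorem Connection.curvature_mulTensor (m : Form k A ⊗[A] E) (n : Form k A ⊗[A] F) :
    (nabla.tensor nabla').curvature (mulTensor (Form k A) E F (m ⊗ₜ[A] n)) =
      mulTensor (Form k A) E F (nabla.curvature m ⊗ₜ[A] n) +
        mulTensor (Form k A) E F (m ⊗ₜ[A] nabla'.curvature n) := by
  simp only [curvature_apply]
  have h : mulTensor (Form k A) E F (sgnTensor k A E (nabla.extend m) ⊗ₜ[A] nabla'.extend n) +
      mulTensor (Form k A) E F ((-sgnTensor k A E (nabla.extend m)) ⊗ₜ[A] nabla'.extend n) = 0 := by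
    rw [← map_add, ← TensorProduct.add_tmul, add_neg_cancel, TensorProduct.zero_tmul, map_zero]
  rw [extend_mulTensor, map_add, extend_mulTensor, extend_mulTensor, extend_sgnTensor,
    sgnTensor_sgnTensor, add_assoc, add_right_inj, ← add_assoc]
  exact (congrArg (· + _) h).trans (zero_add _)

/-- The endomorphism `f ⊗ 1 + 1 ⊗ g`. -/
noncomputable def tensorSum {M N : Type*} [AddCommGroup M] [Module A M] [AddCommGroup N]
    [Module A N] (f : Module.End A M) (g : Module.End A N) : Module.End A (M ⊗[A] N) :=
  f.rTensor N + g.lTensor M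

/-- The binomial theorem for the commuting operators f ⊗ 1 and 1 ⊗ g. -/
theorem tensorSum_pow_tmul {M N : Type*} [AddCommGroup M] [Module A M] [AddCommGroup N]
    [Module A N] (f : Module.End A M) (g : Module.End A N) (n : ℕ) (x : M) (y : N) :
    (tensorSum f g ^ n) (x ⊗ₜ y) = ∑ i ∈ Finset.range (n + 1), (n.choose i) •
      ((f ^ i) x ⊗ₜ[A] (g ^ (n - i)) y) := by
  have hc : Commute (f.rTensor N : Module.End A (M ⊗[A] N)) (g.lTensor M) :=
    (LinearMap.rTensor_comp_lTensor M f g).trans (LinearMap.lTensor_comp_rTensor M f g).symm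
  rw [tensorSum, hc.add_pow, LinearMap.sum_apply]
  refine Finset.sum_congr rfl fun i _ => ?_
  rw [Module.End.mul_apply, Module.End.natCast_apply, map_nsmul, LinearMap.rTensor_pow,
    LinearMap.lTensor_pow, Module.End.mul_apply, LinearMap.lTensor_tmul, LinearMap.rTensor_tmul]

theorem Connection.curvature_pow_mulTensor (n : ℕ) (t : (Form k A ⊗[A] E) ⊗[A] (Form k A ⊗[A] F)) :
    ((nabla.tensor nabla').curvature ^ n) (mulTensor (Form k A) E F t) =
      mulTensor (Form k A) E F ((tensorSum (nabla.curvature.restrictScalars A)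
        (nabla'.curvature.restrictScalars A) ^ n) t) := by
  induction n generalizing t with
  | zero => rfl
  | succ n ih =>
    rw [pow_succ, pow_succ, Module.End.mul_apply, Module.End.mul_apply, ← ih]
    congr 1
    induction t using TensorProduct.induction_on with
    | zero => simp
    | add x y hx hy => simp only [map_add, hx, hy]
    | tmul x y =>
      rw [curvature_mulTensor, tensorSum, LinearMap.add_apply, map_add]
      rfl

theorem Connection.restrictScalars_curvature_pow (n : ℕ) :
    (nabla.curvature.restrictScalars A : Module.End A (Form k A ⊗[A] E)) ^ n =
      (nabla.curvature ^ n).restrictScalars A := by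
  induction n with
  | zero => rfl
  | succ n ih => rw [pow_succ, pow_succ, ih]; rfl

theorem Connection.curvaturePow_tensor (n : ℕ) :
    (nabla.tensor nabla').curvaturePow n = ∑ i ∈ Finset.range (n + 1), (n.choose i) •
      (mulTensor (Form k A) E F ∘ₗ
        TensorProduct.map (nabla.curvaturePow i) (nabla'.curvaturePow (n - i))) := by
  refine TensorProduct.ext' fun e f => ?_
  have h1 : (1 : Form k A) ⊗ₜ[A] (e ⊗ₜ[A] f) =
      mulTensor (Form k A) E F ((1 ⊗ₜ[A] e) ⊗ₜ[A] (1 ⊗ₜ[A] f)) := by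
    rw [mulTensor_tmul, one_mul]
  change ((nabla.tensor nabla').curvature ^ n) (1 ⊗ₜ[A] (e ⊗ₜ[A] f)) = _
  rw [h1, curvature_pow_mulTensor, tensorSum_pow_tmul, LinearMap.sum_apply, map_sum]
  refine Finset.sum_congr rfl fun i _ => ?_
  rw [LinearMap.smul_apply, map_nsmul, restrictScalars_curvature_pow,
    restrictScalars_curvature_pow]
  rfl

variable [Module.Finite A E] [Module.Projective A E] [Module.Finite A F] [Module.Projective A F]

/-- The curvature is R ⊗ 1 + 1 ⊗ R', so the binomial expansion applies, and the trace is
multiplicative on each summand. -/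
theorem Connection.traceForm_tensor (n : ℕ) :
    (nabla.tensor nabla').traceForm n = ∑ i ∈ Finset.range (n + 1), (n.choose i) •
      (nabla.traceForm i * nabla'.traceForm (n - i)) := by
  rw [traceForm, curvaturePow_tensor, map_sum]
  refine Finset.sum_congr rfl fun i _ => ?_
  rw [map_nsmul, coeffTrace_mulTensor]
  rfl

end Tensor

/-! ### Finite sums of eventually vanishing sequences -/

section Sums

theorem sum_range_eq_of_vanishing {M : Type*} [AddCommMonoid M] {f : ℕ → M} {m n : ℕ}
    (hm : ∀ i ≥ m, f i = 0) (hn : ∀ i ≥ n, f i = 0) :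
    ∑ i ∈ Finset.range m, f i = ∑ i ∈ Finset.range n, f i := by
  rcases le_total m n with h | h
  · refine Finset.sum_subset (Finset.range_mono h) fun i _ hi => hm i ?_
    simpa using hi
  · refine (Finset.sum_subset (Finset.range_mono h) fun i _ hi => hn i ?_).symm
    simpa using hi

open Polynomial in
/-- The Cauchy product of finite sums. -/
theorem sum_range_mul_sum_range {R : Type*} [Semiring R] {a b c : ℕ → R} {n : ℕ}
    (ha : ∀ i ≥ n, a i = 0) (hb : ∀ i ≥ n, b i = 0) (hc : ∀ i ≥ n, c i = 0)
    (h : ∀ m, c m = ∑ x ∈ Finset.HasAntidiagonal.antidiagonal m, a x.1 * b x.2) :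
    (∑ i ∈ Finset.range n, a i) * ∑ i ∈ Finset.range n, b i = ∑ i ∈ Finset.range n, c i := by
  -- The sums are values at 1 of generating polynomials, and the Cauchy product is the coefficient
  -- formula for their product. Evaluation at 1 is multiplicative even if `R` is not commutative.
  let P : (ℕ → R) → R[X] := fun f => ∑ i ∈ Finset.range n, C (f i) * X ^ i
  let e : R[X] →+* R := eval₂RingHom' (RingHom.id R) 1 fun a => Commute.one_right a
  have hcoeff (f : ℕ → R) (hf : ∀ i ≥ n, f i = 0) (m : ℕ) : (P f).coeff m = f m := by
    simp only [P, finsetSum_coeff, coeff_C_mul_X_pow, Finset.sum_ite_eq, Finset.mem_range]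
    split_ifs with hm
    · rfl
    · exact (hf m (not_lt.mp hm)).symm
  have heval (f : ℕ → R) : e (P f) = ∑ i ∈ Finset.range n, f i := by
    simp only [P, map_sum]
    refine Finset.sum_congr rfl fun i _ => ?_
    change eval₂ (RingHom.id R) 1 _ = _
    rw [C_mul_X_pow_eq_monomial, eval₂_monomial]
    simp
  rw [← heval, ← heval, ← heval, ← map_mul]
  congr 1
  ext m
  rw [coeff_mul, hcoeff c hc, h]
  exact Finset.sum_congr rfl fun x _ => by rw [hcoeff a ha, hcoeff b hb]

end Sums

/-! ### The Chern character as a ring homomorphism -/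

section Classes

universe u v

variable {k : Type u} {A : Type v} [Field k] [CommRing A] [Algebra k A]

/-- The form `tr (R ^ n)` as a closed form. -/
noncomputable def Connection.closedTrace {E : Type*} [AddCommGroup E] [Module A E]
    [Module.Finite A E] [Module.Projective A E] (nabla : Connection k A E) (n : ℕ) :
    closedForms k A := ⟨nabla.traceForm n, nabla.extD_traceForm n⟩

/-- The class of `(1 / n!) tr (R ^ n)`. -/
noncomputable def Connection.chernTerm {E : Type*} [AddCommGroup E] [Module A E]
    [Module.Finite A E] [Module.Projective A E] (nabla : Connection k A E) (n : ℕ) :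
    DeRhamCohomology k A :=
  ((n.factorial : k)⁻¹) • Ideal.Quotient.mkₐ k (exactForms k A) (nabla.closedTrace n)

section Finite

variable [Module.Finite A (Ω[A⁄k])]

variable (k A) in
/-- A degree from which on all forms vanish. -/
noncomputable def degreeBound : ℕ := (exists_forall_exteriorPower_eq_zero (k := k) (A := A)).choose

variable {E : Type*} [AddCommGroup E] [Module A E] [Module.Finite A E] [Module.Projective A E]
  (nabla : Connection k A E)

theorem Connection.closedTrace_eq_zero {n : ℕ} (hn : degreeBound k A ≤ n) :
    nabla.closedTrace n = 0 :=
  Subtype.ext ((exists_forall_exteriorPower_eq_zero (k := k) (A := A)).choose_spec (2 * n)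
    (le_trans hn (by omega)) _ (nabla.traceForm_mem n))

theorem Connection.chernTerm_eq_zero {n : ℕ} (hn : n ≥ degreeBound k A) :
    nabla.chernTerm n = 0 := by
  rw [chernTerm, nabla.closedTrace_eq_zero hn, map_zero, smul_zero]

/-- The Chern character form of a connection. -/
noncomputable def Connection.chern : DeRhamCohomology k A :=
  ∑ n ∈ Finset.range (degreeBound k A), nabla.chernTerm n

variable {F : Type*} [AddCommGroup F] [Module A F] [Module.Finite A F] [Module.Projective A F]
  (nabla' : Connection k A F)

theorem Connection.chern_prod : (nabla.prod nabla').chern = nabla.chern + nabla'.chern := by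
  rw [chern, chern, chern, ← Finset.sum_add_distrib]
  refine Finset.sum_congr rfl fun n _ => ?_
  rw [chernTerm, chernTerm, chernTerm, ← smul_add, ← map_add]
  congr 2
  exact Subtype.ext (nabla.traceForm_prod nabla' n)

theorem Connection.chern_transport (f : E ≃ₗ[A] F) : (nabla.transport f).chern = nabla.chern := by
  refine Finset.sum_congr rfl fun n _ => ?_
  rw [chernTerm, chernTerm]
  congr 2
  exact Subtype.ext (nabla.traceForm_transport f n)

theorem Connection.chern_unit : (Connection.unit A k).chern = 1 := by
  have h1 : (Connection.unit A k).chernTerm 0 = 1 := by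
    have : (Connection.unit A k).closedTrace 0 = 1 := Subtype.ext Connection.traceForm_zero_unit
    rw [chernTerm, this, map_one]
    simp
  have h2 : ∀ n ≥ 1, (Connection.unit A k).chernTerm n = 0 := fun n hn => by
    obtain ⟨m, rfl⟩ := Nat.exists_eq_succ_of_ne_zero (Nat.one_le_iff_ne_zero.mp hn)
    have : (Connection.unit A k).closedTrace (m + 1) = 0 :=
      Subtype.ext (Connection.traceForm_succ_unit m)
    rw [chernTerm, this, map_zero, smul_zero]
  -- Only n = 0 contributes. The ranges are compared instead of splitting off this term because the
  -- chosen bound may be 0 when 1 = 0.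
  rw [chern, sum_range_eq_of_vanishing (fun n hn => chernTerm_eq_zero _ hn) h2,
    Finset.sum_range_one, h1]

variable [CharZero k]

omit [Module.Finite A (Ω[A⁄k])] in
theorem Connection.chernTerm_eq (nabla nabla' : Connection k A E) (n : ℕ) :
    nabla'.chernTerm n = nabla.chernTerm n := by
  rw [chernTerm, chernTerm]
  congr 1
  refine Ideal.Quotient.eq.mpr ?_
  obtain ⟨z, hz⟩ := nabla.traceForm_sub_exact nabla' n
  exact ⟨z, hz.symm⟩

theorem Connection.chern_eq (nabla nabla' : Connection k A E) : nabla'.chern = nabla.chern :=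
  Finset.sum_congr rfl fun n _ => nabla.chernTerm_eq nabla' n

-- The weights 1/n! absorb the binomial coefficients, since C(i + j, i)/(i + j)! = 1/(i! j!).
omit [Module.Finite A (Ω[A⁄k])] in
theorem Connection.chernTerm_tensor (n : ℕ) : (nabla.tensor nabla').chernTerm n =
    ∑ x ∈ Finset.HasAntidiagonal.antidiagonal n, nabla.chernTerm x.1 * nabla'.chernTerm x.2 := by
  have h : (nabla.tensor nabla').closedTrace n = ∑ x ∈ Finset.HasAntidiagonal.antidiagonal n,
      (n.choose x.1) • (nabla.closedTrace x.1 * nabla'.closedTrace x.2) := by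
    rw [Finset.Nat.sum_antidiagonal_eq_sum_range_succ_mk]
    refine Subtype.ext ((nabla.traceForm_tensor nabla' n).trans ?_)
    rw [AddSubmonoidClass.coe_finsetSum]
    rfl
  rw [chernTerm, h, map_sum, Finset.smul_sum]
  refine Finset.sum_congr rfl fun x hx => ?_
  rw [chernTerm, chernTerm, map_nsmul, map_mul, smul_mul_smul_comm, ← Nat.cast_smul_eq_nsmul k,
    smul_smul]
  congr 1
  obtain ⟨i, j⟩ := x
  obtain rfl : i + j = n := Finset.HasAntidiagonal.mem_antidiagonal.mp hx
  have h0 : ∀ m : ℕ, (m.factorial : k) ≠ 0 := fun m => Nat.cast_ne_zero.mpr m.factorial_ne_zero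
  have := h0 i
  have := h0 j
  have := h0 (i + j)
  have hc : ((i + j).choose i : k) * i.factorial * j.factorial = (i + j).factorial := by
    rw [Nat.choose_symm_add]
    exact_mod_cast Nat.add_choose_mul_factorial_mul_factorial i j
  field_simp
  rw [← hc]

theorem Connection.chern_tensor : (nabla.tensor nabla').chern = nabla.chern * nabla'.chern :=
  (sum_range_mul_sum_range (fun _ h => nabla.chernTerm_eq_zero h)
    (fun _ h => nabla'.chernTerm_eq_zero h) (fun _ h => (nabla.tensor nabla').chernTerm_eq_zero h)
    (nabla.chernTerm_tensor nabla')).symm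

/-- An auxiliary connection. -/
noncomputable def someConnection (k : Type u) {A : Type v} [Field k] [CommRing A] [Algebra k A]
    (E : Type*) [AddCommGroup E] [Module A E] [Module.Projective A E] : Connection k A E :=
  Connection.nonempty_of_projective.some

variable (k A) in
/-- The Chern character on isomorphism classes. -/
noncomputable def chernIsoClass : IsoClass A →* DeRhamCohomology k A where
  toFun := Quotient.lift (fun E : FGProj A => (someConnection k E.carrier).chern) (by
    rintro E F ⟨f⟩
    rw [← (someConnection k E.carrier).chern_transport f]
    exact Connection.chern_eq _ _)
  map_one' := (Connection.chern_eq _ _).trans Connection.chern_unit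
  map_mul' := by
    rintro ⟨E⟩ ⟨F⟩
    exact (Connection.chern_eq _ _).trans (Connection.chern_tensor (someConnection k E.carrier)
      (someConnection k F.carrier))

theorem chernIsoClass_mk {E : Type v} [AddCommGroup E] [Module A E] [Module.Finite A E]
    [Module.Projective A E] (nabla : Connection k A E) :
    chernIsoClass k A (IsoClass.mk E) = nabla.chern := Connection.chern_eq _ _

variable (k A) in
/-- The Chern character. -/
noncomputable def chernCharacter : KZero A →+* DeRhamCohomology k A :=
  Ideal.Quotient.lift (directSumRelations A)
    (MonoidAlgebra.lift ℤ (DeRhamCohomology k A) (IsoClass A) (chernIsoClass k A)).toRingHom (by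
      intro x hx
      -- The kernel is an ideal, so only the generating relations need checking; additivity on
      -- direct sums kills these.
      refine (Ideal.span_le (I := RingHom.ker (MonoidAlgebra.lift ℤ (DeRhamCohomology k A)
        (IsoClass A) (chernIsoClass k A)).toRingHom)).mpr ?_ hx
      rintro _ ⟨E, F, rfl⟩
      change MonoidAlgebra.lift ℤ (DeRhamCohomology k A) (IsoClass A) (chernIsoClass k A) _ = 0
      rw [map_sub, map_sub, MonoidAlgebra.lift_of, MonoidAlgebra.lift_of, MonoidAlgebra.lift_of,
        chernIsoClass_mk ((someConnection k E.carrier).prod (someConnection k F.carrier)),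
        chernIsoClass_mk (someConnection k E.carrier),
        chernIsoClass_mk (someConnection k F.carrier), Connection.chern_prod]
      abel)

theorem chernCharacter_mk {E : Type v} [AddCommGroup E] [Module A E] [Module.Finite A E]
    [Module.Projective A E] (nabla : Connection k A E) :
    chernCharacter k A (KZero.mk E) = nabla.chern := by
  change MonoidAlgebra.lift ℤ (DeRhamCohomology k A) (IsoClass A) (chernIsoClass k A) _ = _
  rw [MonoidAlgebra.lift_of, chernIsoClass_mk nabla]

-- K₀ is a quotient of the monoid ring ℤ[M] on isomorphism classes; a ring homomorphism is forced on
-- ℤ, hence determined on M.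
omit [CharZero k] in
theorem KZero.ringHom_ext {R : Type*} [Ring R] {f g : KZero A →+* R}
    (h : ∀ (E : Type v) [AddCommGroup E] [Module A E] [Module.Finite A E] [Module.Projective A E],
      f (KZero.mk E) = g (KZero.mk E)) : f = g := by
  refine Ideal.Quotient.ringHom_ext (MonoidAlgebra.ringHom_ext (fun n => ?_) ?_)
  · have : (MonoidAlgebra.single (1 : IsoClass A) n : MonoidAlgebra ℤ (IsoClass A)) =
      (n : MonoidAlgebra ℤ (IsoClass A)) := by simp [MonoidAlgebra.intCast_def]
    rw [this, map_intCast, map_intCast]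
  · rintro ⟨E⟩
    exact h E.carrier

variable (k A) in
theorem isChernCharacter_chernCharacter : IsChernCharacter (chernCharacter k A) := by
  intro E _ _ _ _ nabla
  exact ⟨nabla.closedTrace, degreeBound k A, fun n => ⟨rfl, nabla.traceForm_mem n⟩,
    fun n hn => nabla.closedTrace_eq_zero hn, chernCharacter_mk nabla⟩

/-- For uniqueness one connection on each module suffices. Its truncation bound may differ from
`degreeBound`, but both tails vanish. -/
theorem isChernCharacter_iff (ch : KZero A →+* DeRhamCohomology k A) :
    IsChernCharacter ch ↔ ch = chernCharacter k A := by
  refine ⟨fun h => KZero.ringHom_ext fun E _ _ _ _ => ?_, ?_⟩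
  · obtain ⟨z, N, hz, hN, hch⟩ := h E (someConnection k E)
    rw [hch, chernCharacter_mk (someConnection k E), Connection.chern]
    have hz' : ∀ n, z n = (someConnection k E).closedTrace n := fun n => Subtype.ext (hz n).1
    have : ∀ n, (someConnection k E).chernTerm n =
      ((n.factorial : k)⁻¹) • Ideal.Quotient.mkₐ k (exactForms k A) (z n) := fun n => by
        rw [hz', Connection.chernTerm]
    rw [← Finset.sum_congr rfl fun n _ => this n]
    refine sum_range_eq_of_vanishing (fun n hn => ?_) fun n hn => Connection.chernTerm_eq_zero _ hn
    rw [this, hN n hn, map_zero, smul_zero]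
  · rintro rfl
    exact isChernCharacter_chernCharacter k A

end Finite

end Classes

/-! ### The duality between exterior powers -/

section Pairing

variable {A : Type*} [CommRing A]

theorem pairingDual_map_dualMap {M N : Type*} [AddCommGroup M] [Module A M] [AddCommGroup N]
    [Module A N] (g : M →ₗ[A] N) (p : ℕ) (x : ⋀[A]^p (Module.Dual A N)) :
    exteriorPower.pairingDual A M p (exteriorPower.map p g.dualMap x) =
      (exteriorPower.map p g).dualMap (exteriorPower.pairingDual A N p x) := by
  have : exteriorPower.pairingDual A M p ∘ₗ exteriorPower.map p g.dualMap =
      (exteriorPower.map p g).dualMap ∘ₗ exteriorPower.pairingDual A N p := by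
    ext f v
    simp
  exact LinearMap.congr_fun this x

/-- The exterior basis built on the dual basis goes to the dual of the exterior basis. -/
theorem pairingDual_bijective_of_basis {M : Type*} [AddCommGroup M] [Module A M] {n : ℕ}
    (b : Module.Basis (Fin n) A M) (p : ℕ) :
    Function.Bijective (exteriorPower.pairingDual A M p) := by
  let B := b.exteriorPower p
  let C := b.dualBasis.exteriorPower p
  have : exteriorPower.pairingDual A M p = (C.equiv B.dualBasis (Equiv.refl _)).toLinearMap := by
    refine C.ext fun s => ?_
    rw [LinearEquiv.coe_coe, Module.Basis.equiv_apply, Equiv.refl_apply,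
      Module.Basis.coe_dualBasis, exteriorPower.basis_coord, exteriorPower.basis_apply,
      Module.Basis.coe_dualBasis]
    rfl
  rw [this]
  exact LinearEquiv.bijective _

/-- A finitely generated projective module is a retract of a free one. The pairing is natural, so
injectivity and surjectivity both pass to the retract. -/
theorem pairingDual_bijective {M : Type*} [AddCommGroup M] [Module A M] [Module.Finite A M]
    [Module.Projective A M] (p : ℕ) : Function.Bijective (exteriorPower.pairingDual A M p) := by
  obtain ⟨n, r, s, -, -, hrs⟩ := Module.Finite.exists_comp_eq_id_of_projective A M
  have hF := pairingDual_bijective_of_basis (Pi.basisFun A (Fin n)) p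
  have hd : s.dualMap ∘ₗ r.dualMap = LinearMap.id := by
    rw [LinearMap.dualMap_comp_dualMap, hrs, LinearMap.dualMap_id]
  constructor
  · intro x y hxy
    have h : exteriorPower.map p r.dualMap x = exteriorPower.map p r.dualMap y := by
      apply hF.1
      rw [pairingDual_map_dualMap, pairingDual_map_dualMap, hxy]
    have h2 := congrArg (exteriorPower.map p s.dualMap) h
    rw [← LinearMap.comp_apply, ← LinearMap.comp_apply, ← exteriorPower.map_comp, hd,
      exteriorPower.map_id] at h2
    exact h2
  · intro φ
    obtain ⟨y, hy⟩ := hF.2 ((exteriorPower.map p r).dualMap φ)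
    refine ⟨exteriorPower.map p s.dualMap y, ?_⟩
    rw [pairingDual_map_dualMap, hy, ← LinearMap.comp_apply, LinearMap.dualMap_comp_dualMap,
      ← exteriorPower.map_comp, hrs, exteriorPower.map_id, LinearMap.dualMap_id]
    rfl

end Pairing

/-! ### Forms and alternating maps on derivations -/

section ToCochain

variable {k A : Type*} [CommRing k] [CommRing A] [Algebra k A]

theorem evalDer_apply (w : Ω[A⁄k]) (x : Derivation k A A) :
    evalDer k A w x = x.liftKaehlerDifferential w := rfl

variable [Module.Finite A (Ω[A⁄k])] [Module.Projective A (Ω[A⁄k])]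

instance finite_derivation : Module.Finite A (Derivation k A A) :=
  Module.Finite.equiv (KaehlerDifferential.linearMapEquivDerivation k A (M := A))

instance projective_derivation : Module.Projective A (Derivation k A A) :=
  Module.Projective.of_equiv (KaehlerDifferential.linearMapEquivDerivation k A (M := A))

/-- Derivations are the dual of Ω¹, so this is the reflexivity of a finitely generated projective
module. -/
theorem evalDer_bijective : Function.Bijective (evalDer k A) := by
  have : evalDer k A = ((Module.evalEquiv A (Ω[A⁄k])).trans
      (KaehlerDifferential.linearMapEquivDerivation k A (M := A)).symm.dualMap).toLinearMap := by
    ext; rfl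
  rw [this]
  exact LinearEquiv.bijective _

theorem exteriorPower_map_bijective {M N : Type*} [AddCommGroup M] [Module A M] [AddCommGroup N]
    [Module A N] {f : M →ₗ[A] N} (hf : Function.Bijective f) (p : ℕ) :
    Function.Bijective (exteriorPower.map p f) := by
  let e := LinearEquiv.ofBijective f hf
  have h1 : e.symm.toLinearMap ∘ₗ f = LinearMap.id := by
    ext x; exact e.symm_apply_apply x
  exact ⟨exteriorPower.map_injective e.symm.toLinearMap h1, exteriorPower.map_surjective hf.2⟩

theorem toCochain_bijective (p : ℕ) : Function.Bijective (toCochain k A p) := by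
  exact ((exteriorPower.alternatingMapLinearEquiv (R := A) (M := Derivation k A A) (N := A)
    (n := p)).symm.bijective).comp ((pairingDual_bijective p).comp
      (exteriorPower_map_bijective evalDer_bijective p))

end ToCochain

/-! ### Compatibility of the two differentials -/

section Differential

variable {k A : Type*} [CommRing k] [CommRing A] [Algebra k A]

theorem derivation_prod {ι : Type*} [DecidableEq ι] (x : Derivation k A A) (s : Finset ι)
    (f : ι → A) :
    x (∏ i ∈ s, f i) = ∑ j ∈ s, ∏ i ∈ s, Function.update f j (x (f j)) i := by
  induction s using Finset.induction_on with
  | empty => simp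
  | insert a s ha ih =>
    rw [Finset.prod_insert ha, Derivation.leibniz, ih, Finset.sum_insert ha, Finset.prod_insert ha,
      Function.update_self, smul_eq_mul, smul_eq_mul, Finset.mul_sum, add_comm, mul_comm]
    congr 1
    · congr 1
      refine Finset.prod_congr rfl fun i hi => ?_
      rw [Function.update_of_ne (ne_of_mem_of_not_mem hi ha)]
    · refine Finset.sum_congr rfl fun j hj => ?_
      rw [Finset.prod_insert ha, Function.update_of_ne (ne_of_mem_of_not_mem hj ha).symm]

theorem derivation_det {n : ℕ} (x : Derivation k A A) (M : Fin n → Fin n → A) :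
    x (Matrix.detRowAlternating M) =
      ∑ r, Matrix.detRowAlternating (Function.update M r fun c => x (M r c)) := by
  -- The product is indexed by rows, so that the Leibniz rule changes one row at a time.
  have h (M : Fin n → Fin n → A) : Matrix.detRowAlternating M =
      ∑ σ : Equiv.Perm (Fin n), (Equiv.Perm.sign σ : ℤ) • ∏ i, M i (σ i) := by
    change Matrix.det (Matrix.of M) = _
    rw [← Matrix.det_transpose, Matrix.det_apply]
    rfl
  simp only [h]
  rw [Finset.sum_comm, map_sum]
  refine Finset.sum_congr rfl fun σ _ => ?_
  rw [map_zsmul, derivation_prod, Finset.smul_sum]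
  refine Finset.sum_congr rfl fun r _ => ?_
  congr 1
  refine Finset.prod_congr rfl fun i _ => ?_
  rcases eq_or_ne i r with rfl | hi
  · rw [Function.update_self, Function.update_self]
  · rw [Function.update_of_ne hi, Function.update_of_ne hi]

/-- The cochain `db₁ ∧ ⋯ ∧ db_p`. -/
noncomputable def detCochain {p : ℕ} (b : Fin p → A) : Cochain A (Derivation k A A) p :=
  Matrix.detRowAlternating.compLinearMap
    (LinearMap.pi fun j => { toFun := fun x => x (b j)
                             map_add' := fun _ _ => rfl
                             map_smul' := fun _ _ => rfl })

theorem detCochain_apply {p : ℕ} (b : Fin p → A) (v : Fin p → Derivation k A A) :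
    detCochain b v = Matrix.detRowAlternating fun i j => v i (b j) := rfl

theorem toCochain_ιMulti_D {p : ℕ} (b : Fin p → A) :
    toCochain k A p (exteriorPower.ιMulti A p fun i => KaehlerDifferential.D k A (b i)) =
      detCochain b := by
  ext v
  rw [toCochain_apply, detCochain_apply]
  simp only [Derivation.liftKaehlerDifferential_comp_D]
  rfl

theorem lrDiff_apply {p : ℕ} (f : Cochain A (Derivation k A A) p)
    (v : Fin (p + 1) → Derivation k A A) :
    lrDiff k A (Derivation k A A) p f v =
      (∑ i : Fin (p + 1), (-1 : A) ^ (i : ℕ) * v i (f (i.removeNth v))) + bracketTerm p f v := rfl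

/-- Differentiating the determinants row by row puts second derivatives v_i(v_j b) into one row.
They occur in pairs (i, j), (j, i) with opposite signs, combine to [v_i, v_j] b, and cancel against
the bracket term. -/
theorem lrDiff_detCochain {p : ℕ} (b : Fin p → A) :
    lrDiff k A (Derivation k A A) p (detCochain b) = 0 := by
  ext v
  rw [lrDiff_apply]
  cases p with
  | zero =>
    have : ∀ w : Fin 0 → Derivation k A A, detCochain b w = 1 := fun w =>
      Matrix.det_isEmpty (A := Matrix.of fun i j => w i (b j))
    simp [bracketTerm, this]
  | succ q =>
    let r : (A → A) → Fin (q + 1) → A := fun T c => T (b c)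
    have hd (i : Fin (q + 2)) : v i (detCochain b (i.removeNth v)) =
        ∑ j : Fin (q + 1), Matrix.detRowAlternating (Function.update
          (fun l => r (i.removeNth v l)) j (r fun a => v i (i.removeNth v j a))) := by
      rw [detCochain_apply, derivation_det]
    simp only [hd, Finset.mul_sum]
    -- The terms are paired over the triangle i ≤ j, the index set of `bracketTerm`, where (i, j)
    -- stands for the positions i < j + 1.
    rw [Fin.sum_sum_eq_sum_triangle_add, bracketTerm, ← Finset.sum_add_distrib]
    refine Finset.sum_eq_zero fun i _ => ?_
    rw [← Finset.sum_add_distrib]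
    refine Finset.sum_eq_zero fun j hj => ?_
    rw [Finset.mem_Ici] at hj
    have H1 : i.castSucc.succAbove j = j.succ := by simp [Fin.succAbove_of_le_castSucc, hj]
    have H2 : j.predAbove i.castSucc = i := by simp [Fin.predAbove_of_le_castSucc, hj]
    have H3 : j.succ.succAbove i = i.castSucc := by simp [Fin.succAbove_of_castSucc_lt, hj]
    have hswap : i.removeNth (j.succ.removeNth v) = j.removeNth (i.castSucc.removeNth v) := by
      rw [Fin.removeNth_removeNth_eq_swap (i := j), H1, H2]
    set w := j.removeNth (i.castSucc.removeNth v) with hw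
    -- The determinant as a function of its first row; moving row j to the top costs (-1)^j.
    let D : (Fin (q + 1) → A) → A := fun y =>
      Matrix.detRowAlternating.curryLeft y fun l => r (w l)
    have hD (y : Fin (q + 1) → A) : Matrix.detRowAlternating (Matrix.vecCons y fun l => r (w l)) =
        D y := rfl
    have hsub (y z : Fin (q + 1) → A) : D (y - z) = D y - D z := by
      simp only [D]
      rw [map_sub, AlternatingMap.sub_apply]
    have h1 : Matrix.detRowAlternating (Function.update (fun l => r (i.castSucc.removeNth v l)) j
        (r fun a => v i.castSucc (i.castSucc.removeNth v j a))) =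
        (-1) ^ (j : ℕ) * D (r fun a => v i.castSucc (v j.succ a)) := by
      rw [← Fin.insertNth_removeNth, AlternatingMap.map_insertNth]
      change _ • D (r fun a => v i.castSucc (v (i.castSucc.succAbove j) a)) = _
      rw [H1]
      simp
    have h2 : Matrix.detRowAlternating (Function.update (fun l => r (j.succ.removeNth v l)) i
        (r fun a => v j.succ (j.succ.removeNth v i a))) =
        (-1) ^ (i : ℕ) * D (r fun a => v j.succ (v i.castSucc a)) := by
      rw [← Fin.insertNth_removeNth, AlternatingMap.map_insertNth]
      have : (i.removeNth fun l => r (j.succ.removeNth v l)) = fun l => r (w l) := by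
        rw [← hswap]; rfl
      rw [this]
      change _ • D (r fun a => v j.succ (v (j.succ.succAbove i) a)) = _
      rw [H3]
      simp
    have h3 : detCochain b (Matrix.vecCons ⁅v i.castSucc, v j.succ⁆ w) =
        D ((r fun a => v i.castSucc (v j.succ a)) - r fun a => v j.succ (v i.castSucc a)) := by
      rw [detCochain_apply, ← hD]
      congr 1
      ext l c
      refine Fin.cases ?_ (fun l => ?_) l
      · simp [r, Derivation.commutator_apply]
      · simp [r]
    rw [h1, h2, h3, hsub, Fin.val_castSucc, Fin.val_succ]
    ring

theorem bracketTerm_smul {p : ℕ} (a : A) (f : Cochain A (Derivation k A A) p)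
    (v : Fin (p + 1) → Derivation k A A) : bracketTerm p (a • f) v = a * bracketTerm p f v := by
  cases p with
  | zero => simp [bracketTerm]
  | succ q =>
    simp only [bracketTerm, AlternatingMap.smul_apply, Finset.mul_sum, smul_eq_mul]
    exact Finset.sum_congr rfl fun i _ => Finset.sum_congr rfl fun j _ => by ring

/-- Subtracting a times the vanishing differential of db₁ ∧ ⋯ ∧ db_p leaves only derivatives of a,
and these form the expansion of the larger determinant along its first column. -/
theorem lrDiff_smul_detCochain {p : ℕ} (a : A) (b : Fin p → A)
    (v : Fin (p + 1) → Derivation k A A) :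
    lrDiff k A (Derivation k A A) p (a • detCochain b) v = detCochain (Fin.cons a b) v := by
  have h0 : a * lrDiff k A (Derivation k A A) p (detCochain b) v = 0 := by
    rw [lrDiff_detCochain, Pi.zero_apply, mul_zero]
  have h1 : detCochain (Fin.cons a b) v =
      ∑ i : Fin (p + 1), (-1 : A) ^ (i : ℕ) * (v i a * detCochain b (i.removeNth v)) := by
    refine (Matrix.det_succ_column_zero _).trans (Finset.sum_congr rfl fun i _ => ?_)
    rw [mul_assoc]
    rfl
  rw [h1, ← add_zero (Finset.sum _ _), ← h0, lrDiff_apply, lrDiff_apply, bracketTerm_smul, mul_add,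
    Finset.mul_sum, ← add_assoc, ← Finset.sum_add_distrib]
  congr 1
  refine Finset.sum_congr rfl fun i _ => ?_
  rw [AlternatingMap.smul_apply, smul_eq_mul, Derivation.leibniz, smul_eq_mul, smul_eq_mul]
  ring

/-- The natural map commutes with the differentials. -/
theorem lrDiff_toCochain {p : ℕ} (w : Form k A) (hw : w ∈ ⋀[A]^p (Ω[A⁄k])) :
    lrDiff k A (Derivation k A A) p (toCochain k A p ⟨w, hw⟩) =
      fun v => toCochain k A (p + 1) ⟨extD k A w, extD_mem hw⟩ v := by
  suffices h : ∀ hw : w ∈ ⋀[A]^p (Ω[A⁄k]),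
      lrDiff k A (Derivation k A A) p (toCochain k A p ⟨w, hw⟩) =
        fun v => toCochain k A (p + 1) ⟨extD k A w, extD_mem hw⟩ v from h hw
  refine exteriorPower_induction (P := fun w => ∀ hw : w ∈ ⋀[A]^p (Ω[A⁄k]),
    lrDiff k A (Derivation k A A) p (toCochain k A p ⟨w, hw⟩) =
      fun v => toCochain k A (p + 1) ⟨extD k A w, extD_mem hw⟩ v) ?_ ?_ ?_ hw
  · intro h0
    have h1 : (⟨0, h0⟩ : ⋀[A]^p (Ω[A⁄k])) = 0 := rfl
    have h2 : (⟨extD k A 0, extD_mem h0⟩ : ⋀[A]^(p + 1) (Ω[A⁄k])) = 0 := Subtype.ext (map_zero _)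
    rw [h1, h2, map_zero, map_zero, map_zero]
    rfl
  · intro x y hx hy hx' hy' hxy
    have h1 : (⟨x + y, hxy⟩ : ⋀[A]^p (Ω[A⁄k])) = ⟨x, hx⟩ + ⟨y, hy⟩ := rfl
    have h2 : (⟨extD k A (x + y), extD_mem hxy⟩ : ⋀[A]^(p + 1) (Ω[A⁄k])) =
      ⟨extD k A x, extD_mem hx⟩ + ⟨extD k A y, extD_mem hy⟩ := Subtype.ext (map_add _ _ _)
    rw [h1, h2, map_add, map_add, map_add, hx', hy']
    rfl
  · intro a b hab
    have h1 : (⟨_, hab⟩ : ⋀[A]^p (Ω[A⁄k])) =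
      a • exteriorPower.ιMulti A p fun i => KaehlerDifferential.D k A (b i) := rfl
    have h2 : (⟨_, extD_mem hab⟩ : ⋀[A]^(p + 1) (Ω[A⁄k])) = exteriorPower.ιMulti A (p + 1)
        fun i => KaehlerDifferential.D k A ((Fin.cons a b : Fin (p + 1) → A) i) := by
      refine Subtype.ext ?_
      change extD k A (a • ExteriorAlgebra.ιMulti A p fun i => KaehlerDifferential.D k A (b i)) =
        ExteriorAlgebra.ιMulti A (p + 1) _
      rw [ExteriorAlgebra.ιMulti_succ_apply, extD_smul, extD_ιMulti_D, smul_zero, add_zero]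
      rfl
    ext v
    rw [h1, h2, map_smul, toCochain_ιMulti_D, toCochain_ιMulti_D, lrDiff_smul_detCochain]

end Differential

/-! ### The exterior derivative and homogeneous components -/

section Homogeneous

variable {k A : Type*} [CommRing k] [CommRing A] [Algebra k A]

/-- Since d raises degrees by one, an exact homogeneous form has a homogeneous primitive. -/
theorem decompose_extD (y : Form k A) (p : ℕ) :
    ((DirectSum.decompose (fun i : ℕ => ⋀[A]^i (Ω[A⁄k])) (extD k A y)) (p + 1) : Form k A) =
      extD k A (DirectSum.decompose (fun i : ℕ => ⋀[A]^i (Ω[A⁄k])) y p) := by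
  induction y using DirectSum.Decomposition.inductionOn (fun i : ℕ => ⋀[A]^i (Ω[A⁄k])) with
  | zero => simp
  | add x y hx hy => simp [hx, hy]
  | @homogeneous i m =>
    rcases eq_or_ne i p with rfl | h
    · rw [DirectSum.decompose_of_mem_same (fun i : ℕ => ⋀[A]^i (Ω[A⁄k])) m.2, DirectSum.decompose_of_mem_same (fun i : ℕ => ⋀[A]^i (Ω[A⁄k])) (extD_mem m.2)]
    · rw [DirectSum.decompose_of_mem_ne (fun i : ℕ => ⋀[A]^i (Ω[A⁄k])) m.2 h, map_zero,
        DirectSum.decompose_of_mem_ne (fun i : ℕ => ⋀[A]^i (Ω[A⁄k])) (extD_mem m.2) (by simpa using h)]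

theorem decompose_extD_zero (y : Form k A) :
    ((DirectSum.decompose (fun i : ℕ => ⋀[A]^i (Ω[A⁄k])) (extD k A y)) 0 : Form k A) = 0 := by
  induction y using DirectSum.Decomposition.inductionOn (fun i : ℕ => ⋀[A]^i (Ω[A⁄k])) with
  | zero => simp
  | add x y hx hy => simp [hx, hy]
  | @homogeneous i m => exact DirectSum.decompose_of_mem_ne (fun i : ℕ => ⋀[A]^i (Ω[A⁄k])) (extD_mem m.2) (by simp)

end Homogeneous

/-! ### De Rham and Lie–Rinehart cohomology -/

section Comparison

variable {k A : Type*} [CommRing k] [CommRing A] [Algebra k A]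

variable (k A) in
/-- The closed `p`-forms. -/
noncomputable def closedDegree (p : ℕ) : Submodule k (closedForms k A) :=
  Submodule.comap (closedForms k A).val.toLinearMap ((⋀[A]^p (Ω[A⁄k])).restrictScalars k)

variable (k A) in
/-- The de Rham class of a closed `p`-form. -/
noncomputable def deRhamClass (p : ℕ) : closedDegree k A p →ₗ[k] deRhamDegree k A p :=
  (Ideal.Quotient.mkₐ k (exactForms k A)).toLinearMap.submoduleMap (closedDegree k A p)

theorem toCochain_mem_lrCocycles {p : ℕ} {w : Form k A} (hw : w ∈ ⋀[A]^p (Ω[A⁄k]))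
    (hc : extD k A w = 0) : toCochain k A p ⟨w, hw⟩ ∈ lrCocycles k A (Derivation k A A) p := by
  rw [lrCocycles, LinearMap.mem_ker, lrDiff_toCochain w hw]
  have : (⟨extD k A w, extD_mem hw⟩ : ⋀[A]^(p + 1) (Ω[A⁄k])) = 0 := Subtype.ext hc
  rw [this, map_zero]
  rfl

variable (k A) in
/-- A closed `p`-form, as an element of the exterior power. -/
noncomputable def closedInclusion (p : ℕ) : closedDegree k A p →ₗ[k] ⋀[A]^p (Ω[A⁄k]) where
  toFun w := ⟨w.1.1, w.2⟩
  map_add' _ _ := rfl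
  map_smul' _ _ := rfl

theorem toCochain_smul {p : ℕ} (c : k) (w : ⋀[A]^p (Ω[A⁄k])) :
    toCochain k A p (c • w) = c • toCochain k A p w := by
  have : c • w = algebraMap k A c • w := Subtype.ext (algebraMap_smul A c w.1).symm
  rw [this, map_smul]
  ext v
  exact algebraMap_smul A c _

variable (k A) in
/-- The natural map from closed forms to cocycles. -/
noncomputable def closedToCocycle (p : ℕ) :
    closedDegree k A p →ₗ[k] lrCocycles k A (Derivation k A A) p :=
  LinearMap.codRestrict _ ({ toFun := toCochain k A p
                             map_add' := map_add _
                             map_smul' := toCochain_smul } ∘ₗ closedInclusion k A p) fun w =>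
    toCochain_mem_lrCocycles w.2 w.1.2

variable [Module.Finite A (Ω[A⁄k])] [Module.Projective A (Ω[A⁄k])]

/-- Bijectivity in degree p provides the form; injectivity in degree p + 1 shows that it is closed.
-/
theorem closedToCocycle_surjective (p : ℕ) : Function.Surjective (closedToCocycle k A p) := by
  rintro ⟨f, hf⟩
  obtain ⟨⟨w, hw⟩, rfl⟩ := (toCochain_bijective (k := k) (A := A) p).2 f
  have h : toCochain k A (p + 1) ⟨extD k A w, extD_mem hw⟩ = 0 := by
    rw [lrCocycles, LinearMap.mem_ker, lrDiff_toCochain w hw] at hf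
    exact AlternatingMap.ext fun v => congrFun hf v
  have h' := (toCochain_bijective (k := k) (A := A) (p + 1)).1 (h.trans (map_zero _).symm)
  exact ⟨⟨⟨w, congrArg Subtype.val h'⟩, hw⟩, rfl⟩

/-- Exactness in the full algebra allows an inhomogeneous primitive, which is replaced by its
component of degree p − 1. In degree 0 both conditions say that the form is zero. -/
theorem closedToCocycle_mem_coboundaries_iff {p : ℕ} (w : closedDegree k A p) :
    (closedToCocycle k A p w : Cochain A (Derivation k A A) p) ∈
      lrCoboundaries k A (Derivation k A A) p ↔ w.1 ∈ exactForms k A := by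
  obtain ⟨⟨w, hc⟩, hw : w ∈ ⋀[A]^p (Ω[A⁄k])⟩ := w
  cases p with
  | zero =>
    constructor
    · intro h
      have h0 : toCochain k A 0 ⟨w, hw⟩ = 0 := h
      have h' := (toCochain_bijective (k := k) (A := A) 0).1 (h0.trans (map_zero _).symm)
      exact ⟨0, (map_zero _).trans (congrArg Subtype.val h').symm⟩
    · rintro ⟨y, hy⟩
      change extD k A y = w at hy
      have h0 := decompose_extD_zero y
      rw [hy, DirectSum.decompose_of_mem_same (fun i : ℕ => ⋀[A]^i (Ω[A⁄k])) hw] at h0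
      subst h0
      exact map_zero (toCochain k A 0)
  | succ q =>
    constructor
    · rintro ⟨f, hf⟩
      obtain ⟨⟨y, hy⟩, rfl⟩ := (toCochain_bijective (k := k) (A := A) q).2 f
      rw [lrDiff_toCochain y hy] at hf
      have h : toCochain k A (q + 1) ⟨extD k A y, extD_mem hy⟩ = toCochain k A (q + 1) ⟨w, hw⟩ :=
        AlternatingMap.ext fun v => congrFun hf v
      exact ⟨y, congrArg Subtype.val ((toCochain_bijective (k := k) (A := A) (q + 1)).1 h)⟩
    · rintro ⟨y, hy⟩
      change extD k A y = w at hy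
      subst hy
      have h := decompose_extD y q
      rw [DirectSum.decompose_of_mem_same (fun i : ℕ => ⋀[A]^i (Ω[A⁄k])) hw] at h
      refine ⟨toCochain k A q (DirectSum.decompose (fun i : ℕ => ⋀[A]^i (Ω[A⁄k])) y q), ?_⟩
      refine (lrDiff_toCochain _ (SetLike.coe_mem _)).trans ?_
      have h' : (⟨_, extD_mem (SetLike.coe_mem (DirectSum.decompose
          (fun i : ℕ => ⋀[A]^i (Ω[A⁄k])) y q))⟩ : ⋀[A]^(q + 1) (Ω[A⁄k])) =
          ⟨extD k A y, hw⟩ := Subtype.ext h.symm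
      exact funext fun v => congrArg (fun z => toCochain k A (q + 1) z v) h'

variable (k A) in
/-- The Lie-Rinehart class of a closed `p`-form. -/
noncomputable def lrClass (p : ℕ) :
    closedDegree k A p →ₗ[k] LRCohomology k A (Derivation k A A) p :=
  Subquotient.mk _ _ ∘ₗ closedToCocycle k A p

/-- Both cohomology groups are quotients of the closed p-forms, so equal kernels yield the
comparison. -/
theorem ker_deRhamClass_eq (p : ℕ) :
    LinearMap.ker (deRhamClass k A p) = LinearMap.ker (lrClass k A p) := by
  ext w
  have h1 : w ∈ LinearMap.ker (deRhamClass k A p) ↔ w.1 ∈ exactForms k A := by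
    rw [LinearMap.mem_ker, ← Ideal.Quotient.eq_zero_iff_mem]
    exact Subtype.ext_iff
  have h2 : w ∈ LinearMap.ker (lrClass k A p) ↔
      (closedToCocycle k A p w : Cochain A (Derivation k A A) p) ∈
        lrCoboundaries k A (Derivation k A A) p := by
    rw [LinearMap.mem_ker]
    exact Submodule.Quotient.mk_eq_zero _
  rw [h1, h2, closedToCocycle_mem_coboundaries_iff]

variable (k A) in
/-- The comparison of de Rham cohomology with the Lie-Rinehart cohomology of the derivations. -/
noncomputable def comparison (p : ℕ) :
    deRhamDegree k A p ≃ₗ[k] LRCohomology k A (Derivation k A A) p :=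
  ((deRhamClass k A p).quotKerEquivOfSurjective
    (LinearMap.submoduleMap_surjective _ _)).symm.trans
  ((Submodule.quotEquivOfEq _ _ (ker_deRhamClass_eq p)).trans
    ((lrClass k A p).quotKerEquivOfSurjective
      ((Submodule.mkQ_surjective _).comp (closedToCocycle_surjective p))))

theorem comparison_deRhamClass {p : ℕ} (w : closedDegree k A p) :
    comparison k A p (deRhamClass k A p w) = lrClass k A p w := by
  have : ((deRhamClass k A p).quotKerEquivOfSurjective
      (LinearMap.submoduleMap_surjective _ _)).symm (deRhamClass k A p w) =
      (LinearMap.ker (deRhamClass k A p)).mkQ w := by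
    rw [LinearEquiv.symm_apply_eq]
    rfl
  rw [comparison, LinearEquiv.trans_apply, this]
  rfl

theorem isNaturalComparison_comparison {k A : Type*} [Field k] [CommRing A] [Algebra k A]
    [Module.Finite A (Ω[A⁄k])] [Module.Projective A (Ω[A⁄k])] :
    IsNaturalComparison (comparison k A) := fun p w hw =>
  ⟨(closedToCocycle k A p ⟨w, hw⟩).2, comparison_deRhamClass ⟨w, hw⟩⟩

end Comparison

/-! ### Exterior products as sums over all permutations -/

section Shuffles

/-- A shuffle is a coset of S_p × S_q; multiplying by p! q! replaces the sum over cosets by a sum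
over all permutations, with no choice of representatives. -/
theorem wedge_apply {A L N : Type*} [CommRing A] [LieRing L] [Module A L] [Ring N] [Algebra A N]
    {p q : ℕ} (f : L [⋀^Fin p]→ₗ[A] N) (g : L [⋀^Fin q]→ₗ[A] N) (v : Fin (p + q) → L) :
    (p.factorial * q.factorial) • wedge f g v = ∑ σ : Equiv.Perm (Fin p ⊕ Fin q),
      Equiv.Perm.sign σ • (f (fun i => v (finSumFinEquiv (σ (Sum.inl i)))) *
        g fun i => v (finSumFinEquiv (σ (Sum.inr i)))) := by
  have h := congrArg (fun F => LinearMap.mul' A N (F fun s => v (finSumFinEquiv s)))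
    (MultilinearMap.domCoprod_alternization_eq f g)
  simp only [MultilinearMap.alternatization_apply, map_sum, Fintype.card_fin] at h
  refine Eq.trans ?_ (h.symm.trans (Finset.sum_congr rfl fun σ _ => ?_))
  · rw [AlternatingMap.smul_apply, map_nsmul]
    rfl
  · simp only [Units.smul_def, map_zsmul]
    rfl

/-- The Laplace expansion as a sum over all permutations. -/
theorem sum_sign_det_mul_det {A : Type*} [CommRing A] {m n : Type*} [Fintype m] [Fintype n]
    [DecidableEq m] [DecidableEq n] (X : m ⊕ n → m ⊕ n → A) :
    ∑ σ : Equiv.Perm (m ⊕ n), Equiv.Perm.sign σ •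
      ((Matrix.of fun i j => X (σ (Sum.inl i)) (Sum.inl j)).det *
        (Matrix.of fun i j => X (σ (Sum.inr i)) (Sum.inr j)).det) =
      ((Fintype.card m).factorial * (Fintype.card n).factorial) • (Matrix.of X).det := by
  -- For fixed τ and ρ the substitution σ ↦ σ (τ ⊕ ρ) turns the sum into the full determinant, so
  -- each of the m! n! pairs contributes one copy.
  have h (τ : Equiv.Perm m) (ρ : Equiv.Perm n) : ∑ σ : Equiv.Perm (m ⊕ n), Equiv.Perm.sign σ •
      ((Equiv.Perm.sign τ • ∏ i, X (σ (Sum.inl (τ i))) (Sum.inl i)) *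
        Equiv.Perm.sign ρ • ∏ i, X (σ (Sum.inr (ρ i))) (Sum.inr i)) = (Matrix.of X).det := by
    rw [Matrix.det_apply]
    refine Eq.trans ?_ (Equiv.sum_comp (Equiv.mulRight (Equiv.Perm.sumCongr τ ρ)) _)
    refine Finset.sum_congr rfl fun σ _ => ?_
    rw [Equiv.coe_mulRight, Equiv.Perm.sign_mul, Equiv.Perm.sign_sumCongr, Fintype.prod_sum_type,
      smul_mul_smul_comm, smul_smul]
    rfl
  simp only [Matrix.det_apply _, Finset.sum_mul_sum, Finset.smul_sum]
  rw [Finset.sum_comm]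
  rw [Finset.sum_congr rfl fun τ _ => Finset.sum_comm]
  refine (Finset.sum_congr rfl fun τ _ => Finset.sum_congr rfl fun ρ _ => h τ ρ).trans ?_
  rw [← Finset.smul_sum, ← Matrix.det_apply, Finset.sum_const, Finset.sum_const, Finset.card_univ, Finset.card_univ,
    Fintype.card_perm, Fintype.card_perm, mul_smul]

end Shuffles

/-! ### Values of forms on derivations -/

section Eval

variable {k A : Type*} [CommRing k] [CommRing A] [Algebra k A]

/-- The value of the component of degree `p` of a form on `p` derivations. -/
noncomputable def formEval (p : ℕ) (v : Fin p → Derivation k A A) : Form k A →ₗ[A] A where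
  toFun w := toCochain k A p (DirectSum.decompose (fun i : ℕ => ⋀[A]^i (Ω[A⁄k])) w p) v
  map_add' x y := by
    rw [DirectSum.decompose_add, DirectSum.add_apply, map_add, AlternatingMap.add_apply]
  map_smul' a x := by
    rw [DirectSum.decompose_smul, DirectSum.smul_apply, map_smul, AlternatingMap.smul_apply]
    rfl

theorem formEval_of_mem {p : ℕ} (v : Fin p → Derivation k A A) {w : Form k A}
    (hw : w ∈ ⋀[A]^p (Ω[A⁄k])) : formEval p v w = toCochain k A p ⟨w, hw⟩ v := by
  have : DirectSum.decompose (fun i : ℕ => ⋀[A]^i (Ω[A⁄k])) w p = ⟨w, hw⟩ :=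
    Subtype.ext (DirectSum.decompose_of_mem_same _ hw)
  exact congrArg (fun z => toCochain k A p z v) this

theorem formEval_ιMulti {p : ℕ} (v : Fin p → Derivation k A A) (w : Fin p → Ω[A⁄k]) :
    formEval p v (ExteriorAlgebra.ιMulti A p w) =
      (Matrix.of fun i j => (v i).liftKaehlerDifferential (w j)).det :=
  (formEval_of_mem v (exteriorPower.ιMulti A p w).2).trans (toCochain_apply k A p w v)

theorem formEval_ι (v : Fin 1 → Derivation k A A) (w : Ω[A⁄k]) :
    formEval 1 v (ExteriorAlgebra.ι A w) = (v 0).liftKaehlerDifferential w := by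
  have : ExteriorAlgebra.ι A w = ExteriorAlgebra.ιMulti A 1 fun _ => w := by simp
  rw [this, formEval_ιMulti]
  simp

theorem formEval_one (v : Fin 0 → Derivation k A A) : formEval 0 v (1 : Form k A) = 1 := by
  have : (1 : Form k A) = ExteriorAlgebra.ιMulti A 0 ![] := by simp
  rw [this, formEval_ιMulti]
  simp

theorem ιMulti_mul_ιMulti {M : Type*} [AddCommGroup M] [Module A M] {p q : ℕ} (w : Fin p → M)
    (z : Fin q → M) : ExteriorAlgebra.ιMulti A p w * ExteriorAlgebra.ιMulti A q z =
      ExteriorAlgebra.ιMulti A (p + q) (Fin.append w z) := by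
  rw [ExteriorAlgebra.ιMulti_apply, ExteriorAlgebra.ιMulti_apply, ExteriorAlgebra.ιMulti_apply,
    ← List.prod_append, ← List.ofFn_fin_append]
  congr 2
  ext i
  refine Fin.addCases (fun i => ?_) (fun i => ?_) i <;> simp

/-- Both sides are bilinear, and on decomposable forms this is the Laplace expansion
`sum_sign_det_mul_det`. -/
theorem formEval_mul {p q : ℕ} (v : Fin (p + q) → Derivation k A A) {x y : Form k A}
    (hx : x ∈ ⋀[A]^p (Ω[A⁄k])) (hy : y ∈ ⋀[A]^q (Ω[A⁄k])) :
    (p.factorial * q.factorial) • formEval (p + q) v (x * y) =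
      ∑ σ : Equiv.Perm (Fin p ⊕ Fin q), Equiv.Perm.sign σ •
        (formEval p (fun i => v (finSumFinEquiv (σ (Sum.inl i)))) x *
          formEval q (fun i => v (finSumFinEquiv (σ (Sum.inr i)))) y) := by
  rw [← ExteriorAlgebra.ιMulti_span_fixedDegree] at hx hy
  induction hx using Submodule.span_induction with
  | zero => simp
  | add x x' _ _ hx hx' =>
    rw [add_mul, map_add, smul_add, hx, hx', ← Finset.sum_add_distrib]
    exact Finset.sum_congr rfl fun σ _ => by rw [map_add, add_mul, smul_add]
  | smul a x _ hx =>
    rw [smul_mul_assoc, map_smul, smul_comm, hx, Finset.smul_sum]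
    exact Finset.sum_congr rfl fun σ _ => by rw [map_smul, smul_mul_assoc, smul_comm]
  | mem x hx =>
    obtain ⟨w, rfl⟩ := hx
    induction hy using Submodule.span_induction with
    | zero => simp
    | add x x' _ _ hx hx' =>
      rw [mul_add, map_add, smul_add, hx, hx', ← Finset.sum_add_distrib]
      exact Finset.sum_congr rfl fun σ _ => by rw [map_add, mul_add, smul_add]
    | smul a x _ hx =>
      rw [mul_smul_comm, map_smul, smul_comm, hx, Finset.smul_sum]
      exact Finset.sum_congr rfl fun σ _ => by rw [map_smul, mul_smul_comm, smul_comm]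
    | mem y hy =>
      obtain ⟨z, rfl⟩ := hy
      have h := sum_sign_det_mul_det fun s t : Fin p ⊕ Fin q =>
        (v (finSumFinEquiv s)).liftKaehlerDifferential (Fin.append w z (finSumFinEquiv t))
      rw [Fintype.card_fin, Fintype.card_fin] at h
      rw [ιMulti_mul_ιMulti, formEval_ιMulti, ← Matrix.det_submatrix_equiv_self finSumFinEquiv]
      refine h.symm.trans (Finset.sum_congr rfl fun σ _ => ?_)
      rw [formEval_ιMulti, formEval_ιMulti]
      simp

/-- Cartan's formula, read off from the compatibility of the differentials in degree one. -/
theorem formEval_extD_ι (x y : Derivation k A A) (w : Ω[A⁄k]) :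
    formEval 2 ![x, y] (extD k A (ExteriorAlgebra.ι A w)) =
      x (y.liftKaehlerDifferential w) - y (x.liftKaehlerDifferential w) -
        ⁅x, y⁆.liftKaehlerDifferential w := by
  have h := congrFun (lrDiff_toCochain _ (ι_mem w)) ![x, y]
  rw [formEval_of_mem _ (extD_mem (ι_mem w)), ← h, lrDiff_apply]
  have h1 (u : Fin 1 → Derivation k A A) :
      toCochain k A 1 ⟨ExteriorAlgebra.ι A w, ι_mem w⟩ u = (u 0).liftKaehlerDifferential w := by
    rw [← formEval_of_mem, formEval_ι]
  simp only [h1, bracketTerm]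
  simp [Fin.sum_univ_two, Fin.removeNth]
  ring

theorem formEval_ι_mul_ι (x y : Derivation k A A) (w z : Ω[A⁄k]) :
    formEval 2 ![x, y] (ExteriorAlgebra.ι A w * ExteriorAlgebra.ι A z) =
      x.liftKaehlerDifferential w * y.liftKaehlerDifferential z -
        x.liftKaehlerDifferential z * y.liftKaehlerDifferential w := by
  have : ExteriorAlgebra.ι A w * ExteriorAlgebra.ι A z = ExteriorAlgebra.ιMulti A 2 ![w, z] := by
    simp [ExteriorAlgebra.ιMulti_apply]
  rw [this, formEval_ιMulti, Matrix.det_fin_two]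
  simp

end Eval

/-! ### Contraction, and the correspondence of connections -/

section Contraction

variable {k A : Type*} [CommRing k] [CommRing A] [Algebra k A]
variable {E : Type*} [AddCommGroup E] [Module A E]

/-- The map `Ω ⊗ E → E` given by the value of the component of degree `p` on `p` derivations. -/
noncomputable def moduleEval (E : Type*) [AddCommGroup E] [Module A E] (p : ℕ)
    (v : Fin p → Derivation k A A) : Form k A ⊗[A] E →ₗ[A] E :=
  (TensorProduct.lid A E).toLinearMap ∘ₗ (formEval p v).rTensor E

theorem moduleEval_tmul (p : ℕ) (v : Fin p → Derivation k A A) (w : Form k A) (e : E) :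
    moduleEval E p v (w ⊗ₜ e) = formEval p v w • e := by
  simp [moduleEval]

theorem projTrace_lid_comp {A : Type*} [CommRing A] {E : Type*} [AddCommGroup E] [Module A E]
    [Module.Finite A E] [Module.Projective A E] (t : E →ₗ[A] A ⊗[A] E) :
    projTrace A E ((TensorProduct.lid A E).toLinearMap ∘ₗ t) = coeffTrace A E A t := by
  induction t using hom_tensor_induction with
  | h0 => simp
  | ha x y hx hy => rw [LinearMap.comp_add, map_add, map_add, hx, hy]
  | h1 a f x =>
    have h : (TensorProduct.lid A E).toLinearMap ∘ₗ rankOne a f x =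
        dualTensorHom A E E (f ⊗ₜ (a • x)) := by
      ext e
      simp [rankOne_apply, smul_comm a]
    rw [h, projTrace_dualTensorHom, coeffTrace_rankOne, map_smul, smul_eq_mul, smul_eq_mul,
      mul_comm]

/-- Evaluation acts on the coefficients alone, so this is naturality of the trace in the
coefficients. -/
theorem projTrace_moduleEval [Module.Finite A E] [Module.Projective A E] (p : ℕ)
    (v : Fin p → Derivation k A A) (u : E →ₗ[A] Form k A ⊗[A] E) :
    projTrace A E (moduleEval E p v ∘ₗ u) = formEval p v (coeffTrace A E (Form k A) u) := by
  rw [← coeffTrace_rTensor_comp, moduleEval, LinearMap.comp_assoc, projTrace_lid_comp]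

variable (k A E) in
/-- Contraction of a one-form with values in `E` with derivations. -/
noncomputable def contractDer : Ω[A⁄k] ⊗[A] E →ₗ[A] Derivation k A A →ₗ[A] E :=
  dualTensorHom A (Derivation k A A) E ∘ₗ (evalDer k A).rTensor E

theorem contractDer_tmul (w : Ω[A⁄k]) (e : E) (x : Derivation k A A) :
    contractDer k A E (w ⊗ₜ e) x = x.liftKaehlerDifferential w • e := by
  simp [contractDer, evalDer_apply]

theorem contractDer_bijective [Module.Finite A (Ω[A⁄k])] [Module.Projective A (Ω[A⁄k])] :
    Function.Bijective (contractDer k A E) := by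
  have h1 : Function.Bijective (dualTensorHom A (Derivation k A A) E) :=
    (dualTensorHomEquiv A (Derivation k A A) E).bijective
  have h2 : Function.Bijective ((evalDer k A).rTensor E) :=
    ((LinearEquiv.ofBijective _ evalDer_bijective).rTensor E).bijective
  exact h1.comp h2

/-- The two kinds of connections correspond to each other. -/
def LRConnection.IsContraction (nabla' : LRConnection A (Derivation k A A) E)
    (nabla : Connection k A E) : Prop :=
  ∀ x e, nabla'.toLinearMap x e = contractDer k A E (nabla.toAddMonoidHom e) x

theorem Connection.exists_isContraction (nabla : Connection k A E) :
    ∃ nabla' : LRConnection A (Derivation k A A) E, nabla'.IsContraction nabla := by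
  refine ⟨⟨{ toFun := fun x => { toFun := fun e => contractDer k A E (nabla.toAddMonoidHom e) x
                                 map_zero' := by simp
                                 map_add' := by simp }
             map_add' := fun x y => by ext; simp
             map_smul' := fun a x => by ext; simp }, fun x a e => ?_⟩, fun x e => rfl⟩
  change contractDer k A E (nabla.toAddMonoidHom (a • e)) x =
    a • contractDer k A E (nabla.toAddMonoidHom e) x + x a • e
  rw [nabla.leibniz, map_add, map_smul, LinearMap.add_apply, LinearMap.smul_apply,
    contractDer_tmul, Derivation.liftKaehlerDifferential_comp_D]

/-- The map e ↦ (x ↦ ∇_x e) is pulled back through Ω¹ ⊗ E ≅ Hom_A(Der, E); by injectivity the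
Leibniz rule may be tested after contraction. -/
theorem LRConnection.exists_isContraction [Module.Finite A (Ω[A⁄k])]
    [Module.Projective A (Ω[A⁄k])] (nabla' : LRConnection A (Derivation k A A) E) :
    ∃ nabla : Connection k A E, nabla'.IsContraction nabla := by
  let Φ := LinearEquiv.ofBijective (contractDer k A E) contractDer_bijective
  let g : E → Derivation k A A →ₗ[A] E := fun e =>
    { toFun := fun x => nabla'.toLinearMap x e
      map_add' := fun x y => by simp
      map_smul' := fun a x => by simp }
  have hΦ (e : E) : contractDer k A E (Φ.symm (g e)) = g e := Φ.apply_symm_apply (g e)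
  have h0 : g 0 = 0 := LinearMap.ext fun x => map_zero (nabla'.toLinearMap x)
  have ha (d e : E) : g (d + e) = g d + g e :=
    LinearMap.ext fun x => map_add (nabla'.toLinearMap x) d e
  refine ⟨⟨⟨⟨fun e => Φ.symm (g e), ?_⟩, ?_⟩, ?_⟩, fun x e => ?_⟩
  · rw [h0, map_zero]
  · intro x y
    rw [← map_add, ← ha]
  · intro a e
    apply contractDer_bijective.1
    change contractDer k A E (Φ.symm (g (a • e))) = contractDer k A E (a • Φ.symm (g e) + _)
    rw [map_add, map_smul, hΦ, hΦ]
    ext x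
    rw [LinearMap.add_apply, LinearMap.smul_apply, contractDer_tmul,
      Derivation.liftKaehlerDifferential_comp_D]
    exact nabla'.leibniz x a e
  · exact (LinearMap.congr_fun (hΦ e) x).symm

theorem moduleEval_ι_smul (x y : Derivation k A A) (w : Ω[A⁄k]) (m : Ω[A⁄k] ⊗[A] E) :
    moduleEval E 2 ![x, y] (ExteriorAlgebra.ι A w • (ExteriorAlgebra.ι A).rTensor E m) =
      x.liftKaehlerDifferential w • contractDer k A E m y -
        y.liftKaehlerDifferential w • contractDer k A E m x := by
  induction m using TensorProduct.induction_on with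
  | zero => simp
  | add m m' h h' =>
    rw [map_add, smul_add, map_add, h, h', map_add, LinearMap.add_apply, LinearMap.add_apply,
      smul_add, smul_add]
    abel
  | tmul z e =>
    rw [LinearMap.rTensor_tmul, TensorProduct.smul_tmul', smul_eq_mul, moduleEval_tmul,
      formEval_ι_mul_ι, contractDer_tmul, contractDer_tmul, sub_smul, smul_smul, smul_smul,
      mul_comm (x.liftKaehlerDifferential z)]

/-- The wedge product of a form with a form with values in `E`. -/
theorem moduleEval_smul {p q : ℕ} (v : Fin (p + q) → Derivation k A A)
    {w : Form k A} (hw : w ∈ ⋀[A]^q (Ω[A⁄k])) (hcomm : ∀ z : Form k A, w * z = z * w)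
    {m : Form k A ⊗[A] E} (hm : m ∈ degreePart k A E p) :
    (p.factorial * q.factorial) • moduleEval E (p + q) v (w • m) =
      ∑ σ : Equiv.Perm (Fin p ⊕ Fin q), Equiv.Perm.sign σ •
        formEval q (fun i => v (finSumFinEquiv (σ (Sum.inr i)))) w •
          moduleEval E p (fun i => v (finSumFinEquiv (σ (Sum.inl i)))) m := by
  refine degreePart_induction (P := fun m => (p.factorial * q.factorial) •
    moduleEval E (p + q) v (w • m) = ∑ σ : Equiv.Perm (Fin p ⊕ Fin q), Equiv.Perm.sign σ •
        formEval q (fun i => v (finSumFinEquiv (σ (Sum.inr i)))) w •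
          moduleEval E p (fun i => v (finSumFinEquiv (σ (Sum.inl i)))) m) ?_ ?_ ?_ hm
  · simp
  · intro x y hx hy
    rw [smul_add, map_add, smul_add, hx, hy, ← Finset.sum_add_distrib]
    exact Finset.sum_congr rfl fun σ _ => by rw [map_add, smul_add, smul_add]
  · intro z hz e
    -- w multiplies from the left but is to receive the last q arguments, so it is first moved to
    -- the right of z.
    rw [TensorProduct.smul_tmul', smul_eq_mul, moduleEval_tmul, hcomm, ← smul_assoc,
      formEval_mul v hz hw, Finset.sum_smul]
    refine Finset.sum_congr rfl fun σ _ => ?_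
    rw [moduleEval_tmul, smul_smul, mul_comm, smul_assoc]

/-- Passing two one-forms applies the grading involution twice, so two-forms, curvatures in
particular, are central. -/
theorem mul_comm_of_mem_two {w : Form k A} (hw : w ∈ ⋀[A]^2 (Ω[A⁄k]))
    (z : Form k A) : w * z = z * w := by
  refine exteriorPower_induction (P := fun w => w * z = z * w) ?_ ?_ ?_ hw
  · simp
  · intro x y _ _ hx hy
    rw [add_mul, mul_add, hx, hy]
  · intro a b
    rw [smul_mul_assoc, mul_smul_comm]
    congr 1
    have h : ExteriorAlgebra.ιMulti A 2 (fun i => KaehlerDifferential.D k A (b i)) =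
        dOne (b 0) * dOne (b 1) := by
      rw [ExteriorAlgebra.ιMulti_apply, List.ofFn_succ, List.ofFn_succ, List.ofFn_zero]
      simp [dOne]
    rw [h, dOne, dOne, mul_assoc, ι_mul_comm _ z, ← mul_assoc, ι_mul_comm _ (sgn z), sgn_sgn, mul_assoc]

theorem nsmul_injective_of_charZero (k : Type*) {A E : Type*} [Field k]
    [CharZero k] [CommRing A] [Algebra k A] [AddCommGroup E] [Module A E] {n : ℕ} (hn : n ≠ 0)
    {x y : E} (h : n • x = n • y) : x = y := by
  have hk : (n : k) ≠ 0 := Nat.cast_ne_zero.mpr hn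
  have h1 (z : E) : algebraMap k A (n : k)⁻¹ • n • z = z := by
    rw [← Nat.cast_smul_eq_nsmul A, smul_smul, ← map_natCast (algebraMap k A), ← map_mul,
      inv_mul_cancel₀ hk, map_one, one_smul]
  rw [← h1 x, h, h1]

end Contraction

/-! ### Comparison of the curvatures -/

section Curvature

variable {k A : Type*} [CommRing k] [CommRing A] [Algebra k A]
variable {E : Type*} [AddCommGroup E] [Module A E]
variable {nabla' : LRConnection A (Derivation k A A) E} {nabla : Connection k A E}

namespace LRConnection.IsContraction

/-- On w ⊗ e one has ∇(w ⊗ e) = dw ⊗ e − w ∧ ∇e. Cartan's formula supplies the derivatives of w(x)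
and w(y), which are the Leibniz terms of ∇_x(w(y) e) and ∇_y(w(x) e). -/
theorem moduleEval_extend (h : nabla'.IsContraction nabla) (x y : Derivation k A A)
    (m : Ω[A⁄k] ⊗[A] E) :
    moduleEval E 2 ![x, y] (nabla.extend ((ExteriorAlgebra.ι A).rTensor E m)) =
      nabla'.toLinearMap x (contractDer k A E m y) - nabla'.toLinearMap y (contractDer k A E m x) -
        contractDer k A E m ⁅x, y⁆ := by
  induction m using TensorProduct.induction_on with
  | zero => simp
  | add m m' h h' =>
    simp only [map_add, LinearMap.add_apply, h, h']
    abel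
  | tmul w e =>
    have hs : sgn (ExteriorAlgebra.ι A w) = ExteriorAlgebra.ι A (-w) :=
      (sgn_ι w).trans (map_neg _ _).symm
    have ht : moduleEval E 2 ![x, y] (ExteriorAlgebra.ι A (-w) • nabla.toForm e) = _ :=
      moduleEval_ι_smul x y (-w) (nabla.toAddMonoidHom e)
    rw [LinearMap.rTensor_tmul, Connection.extend_tmul, hs, map_add, moduleEval_tmul,
      formEval_extD_ι, ht, map_neg, map_neg, neg_smul, neg_smul]
    rw [contractDer_tmul, contractDer_tmul, contractDer_tmul, nabla'.leibniz, nabla'.leibniz,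
      h x e, h y e]
    change _ = _ + x _ • e - (_ + y _ • e) - _
    simp only [sub_smul]
    abel

theorem moduleEval_curvature (h : nabla'.IsContraction nabla) (v : Fin 2 → Derivation k A A)
    (e : E) : moduleEval E 2 v (nabla.curvature (1 ⊗ₜ e)) = nabla'.curvature v e := by
  have hv : v = ![v 0, v 1] := by ext i; fin_cases i <;> rfl
  rw [Connection.curvature_apply, Connection.extend_one_tmul, hv]
  refine (h.moduleEval_extend (v 0) (v 1) (nabla.toAddMonoidHom e)).trans ?_
  rw [← h, ← h, ← h]
  rfl

end LRConnection.IsContraction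

end Curvature

/-! ### Comparison of the curvature powers and their traces -/

section Powers

variable {k A : Type*} [Field k] [CharZero k] [CommRing A] [Algebra k A]
variable {E : Type*} [AddCommGroup E] [Module A E]
variable {nabla' : LRConnection A (Derivation k A A) E} {nabla : Connection k A E}

namespace LRConnection.IsContraction

/-- Induction through Rⁿ⁺¹ = Rⁿ ∘ R. Both sides become the same sum over permutations after
multiplication by (2n)! 2!, which is invertible in characteristic zero. -/
theorem moduleEval_curvaturePow (h : nabla'.IsContraction nabla) (n : ℕ)
    (v : Fin (2 * n) → Derivation k A A) (e : E) :
    moduleEval E (2 * n) v (nabla.curvaturePow n e) = nabla'.curvaturePow n v e := by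
  induction n generalizing e with
  | zero =>
    change moduleEval E 0 v (1 ⊗ₜ e) = e
    rw [moduleEval_tmul, formEval_one, one_smul]
  | succ n ih =>
    -- R(1 ⊗ e) is only a sum of tensors w ⊗ e', hence the general m. On each tensor, linearity
    -- gives Rⁿ(w ⊗ e') = w Rⁿ(1 ⊗ e'), to which the induction hypothesis applies.
    have key : ∀ m ∈ degreePart k A E 2,
        ((2 * n).factorial * (2).factorial) •
          moduleEval E (2 * n + 2) v ((nabla.curvature ^ n) m) =
        ∑ σ : Equiv.Perm (Fin (2 * n) ⊕ Fin 2), Equiv.Perm.sign σ •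
          nabla'.curvaturePow n (fun i => v (finSumFinEquiv (σ (Sum.inl i))))
            (moduleEval E 2 (fun i => v (finSumFinEquiv (σ (Sum.inr i)))) m) := by
      intro m hm
      refine degreePart_induction (P := fun m => ((2 * n).factorial * (2).factorial) •
          moduleEval E (2 * n + 2) v ((nabla.curvature ^ n) m) =
        ∑ σ : Equiv.Perm (Fin (2 * n) ⊕ Fin 2), Equiv.Perm.sign σ •
          nabla'.curvaturePow n (fun i => v (finSumFinEquiv (σ (Sum.inl i))))
            (moduleEval E 2 (fun i => v (finSumFinEquiv (σ (Sum.inr i)))) m)) ?_ ?_ ?_ hm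
      · simp
      · intro x y hx hy
        rw [map_add, map_add, smul_add, hx, hy, ← Finset.sum_add_distrib]
        exact Finset.sum_congr rfl fun σ _ => by rw [map_add, map_add, smul_add]
      · intro w hw e
        have hwe : w ⊗ₜ[A] e = w • (1 : Form k A) ⊗ₜ[A] e := by
          rw [TensorProduct.smul_tmul', smul_eq_mul, mul_one]
        rw [hwe, map_smul, moduleEval_smul (p := 2 * n) v hw (mul_comm_of_mem_two hw)
          (nabla.curvature_pow_mem_degreePart n e), ← hwe]
        refine Finset.sum_congr rfl fun σ _ => ?_
        rw [moduleEval_tmul, map_smul, ← ih]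
        rfl
    refine nsmul_injective_of_charZero k (A := A)
      (mul_ne_zero (2 * n).factorial_ne_zero (2).factorial_ne_zero) ?_
    refine (key _ (nabla.curvature_pow_mem_degreePart 1 e)).trans ?_
    have hw := congrArg (fun φ : Module.End A E => φ e)
      (wedge_apply (nabla'.curvaturePow n) nabla'.curvature v)
    refine Eq.trans ?_ hw.symm
    simp only [LinearMap.sum_apply]
    refine Finset.sum_congr rfl fun σ _ => ?_
    rw [pow_one, h.moduleEval_curvature]
    rfl

variable [Module.Finite A E] [Module.Projective A E]

theorem toCochain_traceForm (h : nabla'.IsContraction nabla) (n : ℕ) :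
    toCochain k A (2 * n) ⟨nabla.traceForm n, nabla.traceForm_mem n⟩ = nabla'.traceForm n := by
  ext v
  rw [← formEval_of_mem, Connection.traceForm, ← projTrace_moduleEval]
  exact congrArg (projTrace A E) (LinearMap.ext fun e => h.moduleEval_curvaturePow n v e)

end LRConnection.IsContraction

end Powers

/-! ### The two characterisations -/

section Main

universe u v

variable {k : Type u} {A : Type v} [Field k] [CharZero k] [CommRing A] [Algebra k A]
  [Module.Finite A (Ω[A⁄k])] [Module.Projective A (Ω[A⁄k])]

/-- The form `tr (R ^ n)` as a closed form of degree `2 n`. -/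
noncomputable def Connection.closedTraceDegree {E : Type*} [AddCommGroup E] [Module A E]
    [Module.Finite A E] [Module.Projective A E] (nabla : Connection k A E) (n : ℕ) :
    closedDegree k A (2 * n) := ⟨nabla.closedTrace n, nabla.traceForm_mem n⟩

theorem LRConnection.IsContraction.comparison_symm {E : Type*} [AddCommGroup E] [Module A E]
    [Module.Finite A E] [Module.Projective A E]
    {nabla' : LRConnection A (Derivation k A A) E} {nabla : Connection k A E}
    (h : nabla'.IsContraction nabla) {n : ℕ}
    (c : lrCocycles k A (Derivation k A A) (2 * n))
    (hc : (c : Cochain A (Derivation k A A) (2 * n)) = nabla'.traceForm n) :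
    (((comparison k A (2 * n)).symm (Subquotient.mk _ _ c) : deRhamDegree k A (2 * n)) :
      DeRhamCohomology k A) = Ideal.Quotient.mkₐ k (exactForms k A) (nabla.closedTrace n) := by
  have : c = closedToCocycle k A (2 * n) (nabla.closedTraceDegree n) :=
    Subtype.ext (hc.trans (h.toCochain_traceForm n).symm)
  have h2 : (comparison k A (2 * n)).symm (Subquotient.mk _ _ c) =
      deRhamClass k A (2 * n) (nabla.closedTraceDegree n) := by
    rw [LinearEquiv.symm_apply_eq, comparison_deRhamClass, this]
    rfl
  rw [h2]
  rfl

/-- Uniqueness needs one connection per module, obtained by contracting a Kähler connection.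
Existence needs every connection along derivations to be such a contraction, which rests on Ω¹ being
finitely generated projective. -/
theorem isLRChernCharacter_iff (ch : KZero A →+* DeRhamCohomology k A) :
    IsLRChernCharacter (comparison k A) ch ↔ ch = chernCharacter k A := by
  constructor
  · intro hch
    refine KZero.ringHom_ext fun E _ _ _ _ => ?_
    let nabla : Connection k A E := someConnection k E
    obtain ⟨nabla', h⟩ := nabla.exists_isContraction
    obtain ⟨c, N, hc, hN, hE⟩ := hch E nabla'
    rw [hE, chernCharacter_mk nabla, Connection.chern]
    have hcn (n : ℕ) : ((n.factorial : k)⁻¹) •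
        (((comparison k A (2 * n)).symm (Subquotient.mk _ _ (c n)) : deRhamDegree k A (2 * n)) :
          DeRhamCohomology k A) = nabla.chernTerm n := by
      rw [h.comparison_symm (c n) (hc n), Connection.chernTerm]
    rw [Finset.sum_congr rfl fun n _ => hcn n]
    refine sum_range_eq_of_vanishing (fun n hn => ?_) fun n hn => nabla.chernTerm_eq_zero hn
    rw [← hcn n, hN n hn, map_zero, map_zero, ZeroMemClass.coe_zero,
      smul_zero]
  · rintro rfl E _ _ _ _ nabla'
    obtain ⟨nabla, h⟩ := nabla'.exists_isContraction
    refine ⟨fun n => closedToCocycle k A (2 * n) (nabla.closedTraceDegree n), degreeBound k A,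
      h.toCochain_traceForm, fun n hn => ?_, ?_⟩
    · have : nabla.closedTraceDegree n = 0 := Subtype.ext (nabla.closedTrace_eq_zero hn)
      exact (congrArg _ this).trans (map_zero _)
    · rw [chernCharacter_mk nabla, Connection.chern]
      refine Finset.sum_congr rfl fun n _ => ?_
      rw [h.comparison_symm _ (h.toCochain_traceForm n)]
      rfl

end Main

end ChernCharacter

/-- Smoothness enters only through Ω¹ being finitely generated and projective; each equivalence
contains existence and uniqueness together. -/
theorem corollary3 (k : Type*) (A : Type*) [Field k] [CharZero k] [CommRing A] [Algebra k A]
    [Algebra.Smooth k A] :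
    ∃ i : ∀ p : ℕ, ChernCharacter.deRhamDegree k A p ≃ₗ[k]
        ChernCharacter.LRCohomology k A (Derivation k A A) p,
      ChernCharacter.IsNaturalComparison i ∧
      ∃ ch : ChernCharacter.KZero A →+* ChernCharacter.DeRhamCohomology k A,
        (∀ ch' : ChernCharacter.KZero A →+* ChernCharacter.DeRhamCohomology k A,
          ChernCharacter.IsChernCharacter ch' ↔ ch' = ch) ∧
        (∀ ch' : ChernCharacter.KZero A →+* ChernCharacter.DeRhamCohomology k A,
          ChernCharacter.IsLRChernCharacter i ch' ↔ ch' = ch) :=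
  ⟨ChernCharacter.comparison k A, ChernCharacter.isNaturalComparison_comparison,
    ChernCharacter.chernCharacter k A, ChernCharacter.isChernCharacter_iff,
    ChernCharacter.isLRChernCharacter_iff⟩
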